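/- Let $p$ be a prime, $B$ a perfect ring of characteristic $p$ (i.e. a nonzero perfect $\mathbb{F}_p$-algebra), $n\ge 0$, and $$C:=B[x_1^{p^{-\infty}},\ldots,x_n^{p^{-\infty}}]/(x_1,\ldots,x_n),$$ where $B[x_1^{p^{-\infty}},\ldots,x_n^{p^{-\infty}}]$ is the ring of finite sums $\sum_\alpha b_\alpha x^\alpha$ with $b_\alpha\in B$, $\alpha\in\mathbb{Z}_+[1/p]^n$, $\mathbb{Z}_+[1/p]=\{a\in\mathbb{Z}[1/p] : a\ge 0\}$. Notation. Let $C^\flat$ be the inverse limit of $\cdots\to C\to C\to C$ along the Frobenius maps $c\mapsto c^p$, and $\nu_k:C^\flat\to C$, $(c_0,c_1,\ldots)\mapsto c_k$, for $k\ge 0$; $C^\flat$ carries the inverse limit topology, for which the ideals $\operatorname{Ker}\nu_k$ form a basis of neighbourhoods of $0$. Let $W(C^\flat)$ be the ring of $p$-typical Witt vectors, with Frobenius $F$, Verschiebung $V$ and Teichmüller lifts $[c]$. Let $A_{\mathrm{cris}}(C)$ be the $p$-adic completion of the PD hull of the surjection $W(C^\flat)\to C$ induced by $\nu_0$ (divided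 powers compatible with the canonical ones on $(p)$), with divided powers $\gamma_m$, with its $p$-adic topology and with the endomorphism $F$ induced by the Frobenius of $C$. Put $$A'_{\mathrm{cris}}(C):=\{u\in A_{\mathrm{cris}}(C) : p^m u\in F^m(A_{\mathrm{cris}}(C))\text{ for all } m\ge 0\},$$ which is a $W(C^\flat)$-submodule of $A_{\mathrm{cris}}(C)$ stable under $F$. Let $\overline{M}(C)$ be Fontaine's module of Witt bivectors: the set of formal expressions $\sum_{m\in\mathbb{Z}}V^m[x_m]$ with $x_m\in C^\flat$, such that $x_m\in\operatorname{Ker}\nu_0$ for $m<0$ and the ideal $I\subset C^\flat$ generated by $x_{-1},x_{-2},\ldots$ is topologically nilpotent (for each $k$ there is an $r$ with $I^r\subset\operatorname{Ker}\nu_k$). Its sum is the coordinatewise limit, as $N\to\infty$, of the sums of the truncations $\sum_{m\ge -N}V^m[x_m]$, computed in $V^{-N}W(C^\flat)$; the action of $a\in W(C^\flat)$ is the coordinatewise limit of its action on the truncations, where $a\cdot V^{-N}w=V^{-N}(F^{-N}(a)\,w)$; and $F\big(\sum_m V^m[x_m]\big)=\sum_m V^m[x_m^p]$. **Proposition.**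 For every element of $\overline{M}(C)$ the series below converges in $A_{\mathrm{cris}}(C)$, and the map $$\bar f\Big(\sum_{m\in\mathbb{Z}}V^m[x_m]\Big):=\sum_{m=0}^{\infty}V^m[x_m]+\sum_{l=1}^{\infty}(p^l-1)!\cdot\gamma_{p^l}([x_{-l}])$$ (where the first sum is the element of $A_{\mathrm{cris}}(C)$ defined by an element of $W(C^\flat)$) takes values in $A'_{\mathrm{cris}}(C)$ and is an isomorphism $\bar f:\overline{M}(C)\to A'_{\mathrm{cris}}(C)$ of $W(C^\flat)$-modules that commutes with $F$. -/

import Mathlib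

namespace Fontaine
open WittVector
variable {p : ℕ} [hp : Fact p.Prime] {R : Type*} [CommRing R]

/-- The Witt vector `(c_1, c_2, …)` obtained from `c = (c_0, c_1, …)` by deleting `c_0`. -/
def wtl (c : WittVector p R) : WittVector p R := WittVector.mk p fun i => c.coeff (i + 1)

lemma cons_coeff_zero (a : R) (b : WittVector p R) :
    (teichmuller p a + verschiebung b).coeff 0 = a := by
  rw [coeff_add_of_disjoint]
  · simp
  · intro n; cases n with
    | zero => right; simp
    | succ n => left; exact teichmuller_coeff_pos p a _ (Nat.succ_pos n)

lemma cons_coeff_succ (a : R) (b : WittVector p R) (i : ℕ) :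
    (teichmuller p a + verschiebung b).coeff (i + 1) = b.coeff i := by
  rw [coeff_add_of_disjoint]
  · simp [teichmuller_coeff_pos p a (i+1) (Nat.succ_pos i)]
  · intro n; cases n with
    | zero => right; simp
    | succ n => left; exact teichmuller_coeff_pos p a _ (Nat.succ_pos n)

lemma eq_cons (c : WittVector p R) :
    c = teichmuller p (c.coeff 0) + verschiebung (wtl c) := by
  ext i
  cases i with
  | zero => rw [cons_coeff_zero]
  | succ i => rw [cons_coeff_succ]; rfl

lemma wtl_cons (a : R) (b : WittVector p R) :
    wtl (teichmuller p a + verschiebung b) = b := by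
  ext i; exact cons_coeff_succ a b i

lemma add_coeff_zero' (c d : WittVector p R) : (c + d).coeff 0 = c.coeff 0 + d.coeff 0 :=
  (constantCoeff (p := p)).map_add c d

lemma wtl_add (c d : WittVector p R) :
    wtl (c + d) = wtl (teichmuller p (c.coeff 0) + teichmuller p (d.coeff 0)) + wtl c + wtl d := by
  have h : c + d = teichmuller p (c.coeff 0 + d.coeff 0) + verschiebung
      (wtl (teichmuller p (c.coeff 0) + teichmuller p (d.coeff 0)) + wtl c + wtl d) := by
    have h1 := eq_cons (teichmuller p (c.coeff 0) + teichmuller p (d.coeff 0))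
    rw [add_coeff_zero', teichmuller_coeff_zero, teichmuller_coeff_zero] at h1
    rw [verschiebung.map_add, verschiebung.map_add, ← add_assoc, ← add_assoc, ← h1]
    conv_lhs => rw [eq_cons c, eq_cons d]
    abel
  rw [h, wtl_cons]

section charp
variable [CharP R p]

lemma frob_teich (t : R) : WittVector.frobenius (teichmuller p t) = teichmuller p (t ^ p) := by
  rw [frobenius_eq_map_frobenius, map_teichmuller]; rfl

lemma teich_mul_eq (t : R) (w : WittVector p R) : teichmuller p t * w =
    teichmuller p (t * w.coeff 0) + verschiebung (teichmuller p (t ^ p) * wtl w) := by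
  conv_lhs => rw [eq_cons w, mul_add, ← map_mul]
  rw [← frob_teich, mul_comm (WittVector.frobenius _), verschiebung_mul_frobenius, mul_comm (verschiebung _)]

lemma teich_mul_coeff (j : ℕ) (t : R) (w : WittVector p R) :
    (teichmuller p t * w).coeff j = t ^ p ^ j * w.coeff j := by
  induction j generalizing t w with
  | zero => rw [teich_mul_eq, cons_coeff_zero]; simp
  | succ j ih => rw [teich_mul_eq, cons_coeff_succ, ih, ← pow_mul, pow_succ']; rfl

lemma wtl_mul (a c : WittVector p R) :
    wtl (a * c) = wtl (a * teichmuller p (c.coeff 0)) + WittVector.frobenius a * wtl c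
      ∧ (a * c).coeff 0 = a.coeff 0 * c.coeff 0 := by
  refine ⟨?_, (constantCoeff (p := p)).map_mul a c⟩
  have h : a * c = teichmuller p (a.coeff 0 * c.coeff 0) + verschiebung
      (wtl (a * teichmuller p (c.coeff 0)) + WittVector.frobenius a * wtl c) := by
    have h1 := eq_cons (a * teichmuller p (c.coeff 0))
    have h0 : (a * teichmuller p (c.coeff 0)).coeff 0 = a.coeff 0 * c.coeff 0 := by
      rw [mul_comm, teich_mul_coeff]; simp [mul_comm]
    rw [h0] at h1
    rw [verschiebung.map_add, ← add_assoc, ← h1]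
    conv_lhs => rw [eq_cons c, mul_add]
    rw [mul_comm (WittVector.frobenius a), verschiebung_mul_frobenius, mul_comm a (verschiebung _)]
  rw [h, wtl_cons]



open MvPolynomial in
lemma coeff_aeval_smul (K : Type*) [CommRing K] [Algebra K R] (P : MvPolynomial (Fin 2) K)
    (v : Fin 2 → R) (d : ℕ) :
    (aeval (fun i => Polynomial.C (v i) * Polynomial.X) P : Polynomial R).coeff d
      = aeval v (homogeneousComponent d P) := by
  induction P using MvPolynomial.induction_on' with
  | add a b ha hb => simp only [map_add, Polynomial.coeff_add, ha, hb]
  | monomial m c =>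
    rw [homogeneousComponent_of_mem (isHomogeneous_monomial c (n := m.degree) rfl)]
    have h1 : (aeval (fun i => Polynomial.C (v i) * Polynomial.X) (monomial m c) : Polynomial R)
        = Polynomial.C (aeval v (monomial m c)) * Polynomial.X ^ m.degree := by
      simp only [aeval_monomial, Finsupp.prod_fintype, mul_pow, pow_zero, implies_true,
        Finsupp.degree_eq_sum]
      simp [Polynomial.algebraMap_apply]
      ring
    rw [h1, Polynomial.coeff_C_mul_X_pow]
    split_ifs <;> simp

variable (R) in
open MvPolynomial in
/-- The `j`-th coordinate of `[x] + [y]` is a homogeneous polynomial of degree `p ^ j`. -/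
lemma exists_homog [Algebra (ZMod p) R] (j : ℕ) :
    ∃ Q : MvPolynomial (Fin 2) (ZMod p), Q.IsHomogeneous (p ^ j) ∧
    ∀ (v : Fin 2 → R),
      (teichmuller p (v 0) + teichmuller p (v 1)).coeff j = aeval v Q := by
  set P : MvPolynomial (Fin 2) (ZMod p) :=
    (teichmuller p (X 0) + teichmuller p (X 1) : WittVector p _).coeff j with hP
  have key : ∀ (S : Type _) [CommRing S] [Algebra (ZMod p) S] (v : Fin 2 → S),
      (teichmuller p (v 0) + teichmuller p (v 1)).coeff j = aeval v P := by
    intro S _ _ v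
    have := WittVector.map_coeff (aeval v : MvPolynomial (Fin 2) (ZMod p) →ₐ[ZMod p] S).toRingHom
      (teichmuller p (X 0) + teichmuller p (X 1)) j
    rw [map_add, map_teichmuller, map_teichmuller] at this
    simpa [P] using this
  refine ⟨homogeneousComponent (p ^ j) P, homogeneousComponent_isHomogeneous _ _, fun v => ?_⟩
  rw [← coeff_aeval_smul, ← key, mul_comm, mul_comm (Polynomial.C (v 1)),
    (teichmuller p).map_mul, (teichmuller p).map_mul, ← mul_add,
    teich_mul_coeff, Polynomial.coeff_X_pow_mul', if_pos le_rfl, Nat.sub_self,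
    ← map_teichmuller, ← map_teichmuller, ← RingHom.map_add, WittVector.map_coeff,
    Polynomial.coeff_C_zero]

lemma homog_diff (I : Ideal R) (A : ℕ → Ideal R) (hA : ∀ q, I * A q ≤ A (q + 1))
    (v v' : Fin 2 → R) (hv : ∀ i, v i ∈ I) (hv' : ∀ i, v' i ∈ I) (h d : ℕ)
    (hd : ∀ i, v i - v' i ∈ A h) [Algebra (ZMod p) R] (hd0 : 0 < d)
    (Q : MvPolynomial (Fin 2) (ZMod p)) (hQ : Q.IsHomogeneous d) :
    MvPolynomial.aeval v Q - MvPolynomial.aeval v' Q ∈ A (h + (d - 1)) := by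
  have hI : ∀ n, I ^ n * A h ≤ A (h + n) := by
    intro n
    induction n with
    | zero => simp
    | succ n ih =>
      rw [pow_succ', mul_assoc]
      exact (Ideal.mul_mono_right ih).trans (hA _)
  let D : ℕ → R → R → Prop := fun a u u' => u ∈ I ^ a ∧ u' ∈ I ^ a ∧
    (0 < a → u - u' ∈ I ^ (a - 1) * A h) ∧ (a = 0 → u = u')
  have D0 : D 0 1 1 := ⟨by simp, by simp, by simp, fun _ => rfl⟩
  have D1 : ∀ i, D 1 (v i) (v' i) := fun i => ⟨by simpa using hv i, by simpa using hv' i,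
    fun _ => by simpa using hd i, by simp⟩
  have Dm : ∀ a b u u' w w', D a u u' → D b w w' → D (a + b) (u * w) (u' * w') := by
    rintro a b u u' w w' ⟨h1, h2, h3, h4⟩ ⟨k1, k2, k3, k4⟩
    refine ⟨?_, ?_, ?_, ?_⟩
    · rw [pow_add]; exact Ideal.mul_mem_mul h1 k1
    · rw [pow_add]; exact Ideal.mul_mem_mul h2 k2
    · intro hab
      have e : u * w - u' * w' = w * (u - u') + u' * (w - w') := by ring
      rw [e]
      refine Ideal.add_mem _ ?_ ?_
      · rcases Nat.eq_zero_or_pos a with ha | ha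
        · rw [h4 ha]; simp
        · have : a + b - 1 = b + (a - 1) := by omega
          rw [this, pow_add, mul_assoc]
          exact Ideal.mul_mem_mul k1 (h3 ha)
      · rcases Nat.eq_zero_or_pos b with hb | hb
        · rw [k4 hb]; simp
        · have : a + b - 1 = a + (b - 1) := by omega
          rw [this, pow_add, mul_assoc]
          exact Ideal.mul_mem_mul h2 (k3 hb)
    · intro hab
      rw [h4 (by omega), k4 (by omega)]
  have Dp : ∀ i a, D a (v i ^ a) (v' i ^ a) := by
    intro i a
    induction a with
    | zero => simpa using D0
    | succ a ih => rw [pow_succ, pow_succ]; exact Dm _ _ _ _ _ _ ih (D1 i)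
  rw [MvPolynomial.aeval_def, MvPolynomial.aeval_def, MvPolynomial.eval₂_eq, MvPolynomial.eval₂_eq,
    ← Finset.sum_sub_distrib]
  refine Ideal.sum_mem _ fun m hm => ?_
  rw [← mul_sub]
  refine Ideal.mul_mem_left _ _ ?_
  have hdeg : m 0 + m 1 = d := by
    have := hQ (MvPolynomial.mem_support_iff.mp hm)
    rw [← this, Finsupp.weight_apply, Finsupp.sum_fintype _ _ (by simp)]
    simp
  have h5 := (Dm _ _ _ _ _ _ (Dp 0 (m 0)) (Dp 1 (m 1))).2.2.1 (by omega)
  rw [hdeg] at h5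
  have e : ∀ w : Fin 2 → R, ∏ i ∈ m.support, w i ^ m i = w 0 ^ m 0 * w 1 ^ m 1 := by
    intro w
    rw [← Fin.prod_univ_two (fun i => w i ^ m i)]
    refine Finset.prod_subset (Finset.subset_univ _) fun i _ hi => ?_
    rw [Finsupp.notMem_support_iff.mp hi, pow_zero]
  rw [e, e]
  exact hI _ h5


lemma teich_add_congr (K : Ideal R) (x x' y y' : R) (hx : x - x' ∈ K) (hy : y - y' ∈ K) (j : ℕ) :
    (teichmuller p x + teichmuller p y).coeff j - (teichmuller p x' + teichmuller p y').coeff j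
      ∈ K := by
  rw [← Ideal.Quotient.mk_eq_mk_iff_sub_mem] at *
  rw [← WittVector.map_coeff, ← WittVector.map_coeff, map_add, map_add, map_teichmuller,
    map_teichmuller, map_teichmuller, map_teichmuller, hx, hy]

lemma teich_add_mem (K : Ideal R) (x y : R) (hx : x ∈ K) (hy : y ∈ K) (j : ℕ) :
    (teichmuller p x + teichmuller p y).coeff j ∈ K := by
  have := teich_add_congr (p := p) K x 0 y 0 (by simpa) (by simpa) j
  rw [teichmuller_zero, add_zero, WittVector.zero_coeff, sub_zero] at this
  exact this

lemma add_coeff_succ' (c d : WittVector p R) (j : ℕ) : (c + d).coeff (j + 1) =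
    (wtl (teichmuller p (c.coeff 0) + teichmuller p (d.coeff 0)) + wtl c + wtl d).coeff j := by
  rw [← wtl_add]; rfl

lemma mul_coeff_succ' (a c : WittVector p R) (j : ℕ) : (a * c).coeff (j + 1) =
    (wtl (a * teichmuller p (c.coeff 0)) + WittVector.frobenius a * wtl c).coeff j := by
  rw [← (wtl_mul a c).1]; rfl

lemma wtl_coeff (c : WittVector p R) (j : ℕ) : (wtl c).coeff j = c.coeff (j + 1) := rfl

lemma add_coeff_mem (I : Ideal R) (j : ℕ) : ∀ c d : WittVector p R,
    (∀ i ≤ j, c.coeff i ∈ I) → (∀ i ≤ j, d.coeff i ∈ I) → (c + d).coeff j ∈ I := by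
  induction j using Nat.strong_induction_on with
  | _ j ih =>
    intro c d hc hd
    cases j with
    | zero => rw [add_coeff_zero']; exact I.add_mem (hc 0 le_rfl) (hd 0 le_rfl)
    | succ j =>
      rw [add_coeff_succ']
      refine ih j (by omega) _ _ (fun i hi => ih i (by omega) _ _ (fun k hk => ?_) (fun k hk => ?_))
        (fun i hi => ?_)
      · rw [wtl_coeff]; exact teich_add_mem I _ _ (hc 0 (by omega)) (hd 0 (by omega)) _
      · rw [wtl_coeff]; exact hc _ (by omega)
      · rw [wtl_coeff]; exact hd _ (by omega)

lemma mul_teich_coeff (a : WittVector p R) (x : R) (j : ℕ) :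
    (a * teichmuller p x).coeff j = x ^ p ^ j * a.coeff j := by
  rw [mul_comm, teich_mul_coeff]

lemma mul_coeff_mem (I : Ideal R) (j : ℕ) : ∀ a c : WittVector p R,
    (∀ i ≤ j, c.coeff i ∈ I) → (a * c).coeff j ∈ I := by
  induction j using Nat.strong_induction_on with
  | _ j ih =>
    intro a c hc
    cases j with
    | zero => rw [(wtl_mul a c).2]; exact I.mul_mem_left _ (hc 0 le_rfl)
    | succ j =>
      rw [mul_coeff_succ']
      refine add_coeff_mem I j _ _ (fun i hi => ?_) (fun i hi => ih i (by omega) _ _ (fun k hk => ?_))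
      · rw [wtl_coeff, mul_teich_coeff]
        exact I.mul_mem_right _ (I.pow_mem_of_mem (hc 0 (by omega)) _ (pow_pos hp.out.pos _))
      · rw [wtl_coeff]; exact hc _ (by omega)

/-- The growth condition on the exponents of the congruences. -/
def Adm (p : ℕ) (q : ℕ → ℕ) (L : ℕ) : Prop :=
  (∀ i, q (i + 1) ≤ q i + (p - 1)) ∧ ∀ i, L ≤ i → q (i + 1) ≤ q i

lemma Adm.shift {q : ℕ → ℕ} {L : ℕ} (h : Adm p q L) : Adm p (fun i => q (i + 1)) (L - 1) :=
  ⟨fun i => h.1 _, fun i hi => h.2 _ (by omega)⟩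

lemma Adm.le_zero {q : ℕ → ℕ} (h : Adm p q 0) (i : ℕ) : q i ≤ q 0 := by
  induction i with
  | zero => exact le_rfl
  | succ i ih => exact (h.2 i (Nat.zero_le _)).trans ih

lemma Adm.le_pow {q : ℕ → ℕ} {L : ℕ} (h : Adm p q L) (i : ℕ) : q i ≤ q 0 + (p ^ i - 1) := by
  have h1 : q i ≤ q 0 + i * (p - 1) := by
    induction i with
    | zero => simp
    | succ i ih => have := h.1 i; rw [add_mul]; omega
  have h2 : 1 + i * (p - 1) ≤ p ^ i := by
    have h3 := hp.out.one_lt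
    have := one_add_mul_le_pow (R := ℤ) (a := (p : ℤ) - 1) (by omega) i
    zify [h3.le]
    simpa using this
  omega

lemma teich_add_filt (I : Ideal R) (A : ℕ → Ideal R) (hA : ∀ q, I * A q ≤ A (q + 1))
    (hA' : Antitone A) {q : ℕ → ℕ} {L : ℕ} (hq : Adm p q L) (x x' y y' : R)
    (hI : 0 < L → x ∈ I ∧ x' ∈ I ∧ y ∈ I ∧ y' ∈ I) (hx : x - x' ∈ A (q 0)) (hy : y - y' ∈ A (q 0))
    (i : ℕ) : (teichmuller p x + teichmuller p y).coeff i
      - (teichmuller p x' + teichmuller p y').coeff i ∈ A (q i) := by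
  rcases Nat.eq_zero_or_pos L with rfl | hL
  · exact hA' (hq.le_zero i) (teich_add_congr _ _ _ _ _ hx hy i)
  · let _ := ZMod.algebra R p
    obtain ⟨Q, hQ, hQ'⟩ := exists_homog (p := p) R i
    obtain ⟨h1, h2, h3, h4⟩ := hI hL
    have := homog_diff (p := p) I A hA ![x, y] ![x', y']
      (by intro i; fin_cases i <;> simpa) (by intro i; fin_cases i <;> simpa) (q 0) (p ^ i)
      (by intro i; fin_cases i <;> simpa) (pow_pos hp.out.pos _) Q hQ
    rw [← hQ', ← hQ'] at this
    exact hA' (hq.le_pow i) this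

lemma pow_filt (I : Ideal R) (A : ℕ → Ideal R) (hA : ∀ q, I * A q ≤ A (q + 1))
    (hA' : Antitone A) {q : ℕ → ℕ} {L : ℕ} (hq : Adm p q L) (x x' : R)
    (hI : 0 < L → x ∈ I ∧ x' ∈ I) (hx : x - x' ∈ A (q 0))
    (i : ℕ) : x ^ p ^ i - x' ^ p ^ i ∈ A (q i) := by
  rcases Nat.eq_zero_or_pos L with rfl | hL
  · exact hA' (hq.le_zero i) (Ideal.mem_of_dvd _ (sub_dvd_pow_sub_pow _ _ _) hx)
  · let _ := ZMod.algebra R p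
    obtain ⟨h1, h2⟩ := hI hL
    have := homog_diff (p := p) I A hA (fun _ => x) (fun _ => x')
      (fun _ => h1) (fun _ => h2) (q 0) (p ^ i)
      (fun _ => hx) (pow_pos hp.out.pos _) (MvPolynomial.X 0 ^ p ^ i)
      (by simpa using (MvPolynomial.isHomogeneous_X (ZMod p) (0 : Fin 2)).pow (p ^ i))
    simp only [map_pow, MvPolynomial.aeval_X] at this
    exact hA' (hq.le_pow i) this

/-- If the first coordinates of two pairs of Witt vectors lie in `I` and the coordinates
are congruent modulo a filtration, the same holds for the coordinates of the sums. -/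
lemma add_filt (I : Ideal R) (A : ℕ → Ideal R) (hA : ∀ q, I * A q ≤ A (q + 1))
    (hA' : Antitone A) (j : ℕ) : ∀ (q : ℕ → ℕ) (L : ℕ) (c c' d d' : WittVector p R), Adm p q L →
      (∀ i, i < L → i ≤ j → c.coeff i ∈ I ∧ c'.coeff i ∈ I ∧ d.coeff i ∈ I ∧ d'.coeff i ∈ I) →
      (∀ i, i ≤ j → c.coeff i - c'.coeff i ∈ A (q i) ∧ d.coeff i - d'.coeff i ∈ A (q i)) →
      (c + d).coeff j - (c' + d').coeff j ∈ A (q j) := by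
  induction j using Nat.strong_induction_on with
  | _ j ih =>
    intro q L c c' d d' hq hI hc
    cases j with
    | zero =>
      rw [add_coeff_zero', add_coeff_zero', add_sub_add_comm]
      exact (A _).add_mem (hc 0 le_rfl).1 (hc 0 le_rfl).2
    | succ j =>
      rw [add_coeff_succ', add_coeff_succ']
      have hI0 := fun hL => hI 0 hL (by omega)
      have hI1 := fun i hi hij => hI (i + 1) hi hij
      have g1 : ∀ k, 0 < L → (wtl (teichmuller p (c.coeff 0) + teichmuller p (d.coeff 0))).coeff k
          ∈ I := fun k hL => by
        rw [wtl_coeff]; exact teich_add_mem I _ _ (hI0 hL).1 (hI0 hL).2.2.1 (k + 1)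
      have g2 : ∀ k, 0 < L → (wtl (teichmuller p (c'.coeff 0) + teichmuller p (d'.coeff 0))).coeff k
          ∈ I := fun k hL => by
        rw [wtl_coeff]; exact teich_add_mem I _ _ (hI0 hL).2.1 (hI0 hL).2.2.2 (k + 1)
      have g3 : ∀ k, (wtl (teichmuller p (c.coeff 0) + teichmuller p (d.coeff 0))).coeff k
          - (wtl (teichmuller p (c'.coeff 0) + teichmuller p (d'.coeff 0))).coeff k
          ∈ A (q (k + 1)) := fun k => by
        rw [wtl_coeff, wtl_coeff]
        exact teich_add_filt I A hA hA' hq _ _ _ _ hI0 (hc 0 (by omega)).1 (hc 0 (by omega)).2 (k + 1)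
      generalize wtl (teichmuller p (c.coeff 0) + teichmuller p (d.coeff 0)) = g at *
      generalize wtl (teichmuller p (c'.coeff 0) + teichmuller p (d'.coeff 0)) = g' at *
      have s1 : ∀ i ≤ j, (g + wtl c).coeff i - (g' + wtl c').coeff i ∈ A (q (i + 1)) := by
        intro i hi
        exact ih i (by omega) (fun i => q (i + 1)) (L - 1) g g' (wtl c) (wtl c') hq.shift
          (fun k hk hki => ⟨g1 k (by omega), g2 k (by omega), (hI1 k (by omega) (by omega)).1,
            (hI1 k (by omega) (by omega)).2.1⟩)
          (fun k hk => ⟨g3 k, (hc (k + 1) (by omega)).1⟩)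
      have s2 : ∀ i, i < L - 1 → i ≤ j → (g + wtl c).coeff i ∈ I := fun i hi hij =>
        add_coeff_mem I i g (wtl c) (fun k hk => g1 k (by omega))
          (fun k hk => (hI1 k (by omega) (by omega)).1)
      have s3 : ∀ i, i < L - 1 → i ≤ j → (g' + wtl c').coeff i ∈ I := fun i hi hij =>
        add_coeff_mem I i g' (wtl c') (fun k hk => g2 k (by omega))
          (fun k hk => (hI1 k (by omega) (by omega)).2.1)
      exact ih j (by omega) (fun i => q (i + 1)) (L - 1) (g + wtl c) (g' + wtl c') (wtl d) (wtl d')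
        hq.shift (fun i hi hij => ⟨s2 i hi hij, s3 i hi hij, (hI1 i (by omega) (by omega)).2.2.1,
          (hI1 i (by omega) (by omega)).2.2.2⟩)
        (fun i hi => ⟨s1 i hi, (hc (i + 1) (by omega)).2⟩)

/-- The analogue of the previous lemma for multiplication by a fixed Witt vector. -/
lemma mul_filt (I : Ideal R) (A : ℕ → Ideal R) (hA : ∀ q, I * A q ≤ A (q + 1))
    (hA' : Antitone A) (j : ℕ) : ∀ (q : ℕ → ℕ) (L : ℕ) (a c c' : WittVector p R), Adm p q L →
      (∀ i, i < L → i ≤ j → c.coeff i ∈ I ∧ c'.coeff i ∈ I) →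
      (∀ i, i ≤ j → c.coeff i - c'.coeff i ∈ A (q i)) →
      (a * c).coeff j - (a * c').coeff j ∈ A (q j) := by
  induction j using Nat.strong_induction_on with
  | _ j ih =>
    intro q L a c c' hq hI hc
    cases j with
    | zero =>
      rw [(wtl_mul a c).2, (wtl_mul a c').2, ← mul_sub]
      exact (A _).mul_mem_left _ (hc 0 le_rfl)
    | succ j =>
      rw [mul_coeff_succ', mul_coeff_succ']
      have hI0 := fun hL => hI 0 hL (by omega)
      refine add_filt I A hA hA' j (fun i => q (i + 1)) (L - 1) _ _ _ _ hq.shift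
        (fun i hi hij => ⟨?_, ?_, ?_, ?_⟩) (fun i hi => ⟨?_, ?_⟩)
      · rw [wtl_coeff, mul_teich_coeff]
        exact I.mul_mem_right _ (I.pow_mem_of_mem (hI0 (by omega)).1 _ (pow_pos hp.out.pos _))
      · rw [wtl_coeff, mul_teich_coeff]
        exact I.mul_mem_right _ (I.pow_mem_of_mem (hI0 (by omega)).2 _ (pow_pos hp.out.pos _))
      · exact mul_coeff_mem I _ _ _ fun k hk => (hI (k + 1) (by omega) (by omega)).1
      · exact mul_coeff_mem I _ _ _ fun k hk => (hI (k + 1) (by omega) (by omega)).2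
      · rw [wtl_coeff, wtl_coeff, mul_teich_coeff, mul_teich_coeff, ← sub_mul]
        exact (A _).mul_mem_right _ (pow_filt I A hA hA' hq _ _ hI0 (hc 0 (by omega)) _)
      · exact ih i (by omega) (fun i => q (i + 1)) (L - 1) _ _ _ hq.shift
          (fun k hk hki => hI (k + 1) (by omega) (by omega)) (fun k hk => hc (k + 1) (by omega))

end charp

noncomputable section barM
open Filter

variable (C : Type*) [CommRing C] (p : ℕ) [hp : Fact p.Prime] [CharP C p]

/-- An ideal of `C^♭` is topologically nilpotent (for the inverse limit topology, in which the
kernels of the projections `ν_k : C^♭ → C` form a basis of neighbourhoods of `0`) if its image in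
each quotient `C^♭ / Ker ν_k` is nilpotent. -/
def TopNilpotent {C : Type*} [CommRing C] {p : ℕ} [Fact p.Prime] [CharP C p]
    (I : Ideal (Perfection C p)) : Prop :=
  ∀ k, ∃ r, I ^ r ≤ RingHom.ker (Perfection.coeff C p k)

/-- Fontaine's module `M̄(C)`: formal expressions `∑_{m ∈ ℤ} V^m [x_m]`, with `x_m ∈ C^♭`, such that
`x_m ∈ Ker ν_0` for `m < 0` and the ideal generated by `x_{-1}, x_{-2}, …` is topologically
nilpotent. -/
def BarM : Type _ :=
  {x : ℤ → Perfection C p // (∀ m < 0, Perfection.coeff C p 0 (x m) = 0) ∧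
    TopNilpotent (Ideal.span (x '' Set.Iio 0))}

variable {C p}

/-- The Witt vector `∑_{i ≥ 0} V^i [x_{i - N}]`, that is, `V^N` applied to the truncation
`∑_{m ≥ -N} V^m [x_m]` of the formal expression `∑_m V^m [x_m]`. -/
def trunc (x : ℤ → Perfection C p) (N : ℕ) : WittVector p (Perfection C p) :=
  WittVector.mk p fun i => x ((i : ℤ) - N)

/-- A sequence of Witt vectors `s_N`, thought of as the sequence of formal expressions
`V^{-N} s_N`, converges coordinatewise to `∑_m V^m [x_m]` (each coordinate converges in the
topology of `C^♭`). -/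
def IsLim (s : ℕ → WittVector p (Perfection C p)) (x : ℤ → Perfection C p) : Prop :=
  ∀ (k : ℕ) (n : ℤ), ∀ᶠ N : ℕ in atTop,
    Perfection.coeff C p k ((s N).coeff (n + N).toNat) = Perfection.coeff C p k (x n)

open Classical in
/-- The coordinatewise limit of `V^{-N} s_N`, if it exists. -/
def limit (s : ℕ → WittVector p (Perfection C p)) : ℤ → Perfection C p :=
  if h : ∃ x, IsLim s x then h.choose else 0

lemma IsLim.unique {s : ℕ → WittVector p (Perfection C p)} {x y : ℤ → Perfection C p}
    (hx : IsLim s x) (hy : IsLim s y) : x = y := by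
  funext n
  ext k
  obtain ⟨N, h1, h2⟩ := ((hx k n).and (hy k n)).exists
  rw [← h1, h2]

lemma isLim_limit {s : ℕ → WittVector p (Perfection C p)} (h : ∃ x, IsLim s x) :
    IsLim s (limit s) := by
  rw [limit, dif_pos h]; exact h.choose_spec

/-- Convergence to a limit, with uniform topological nilpotence of the polar parts. -/
def NilLim (s : ℕ → WittVector p (Perfection C p)) (x : ℤ → Perfection C p) : Prop :=
  (∃ I : Ideal (Perfection C p), TopNilpotent I ∧ I ≤ RingHom.ker (Perfection.coeff C p 0) ∧
    ∀ N j, j < N → (s N).coeff j ∈ I) ∧ IsLim s x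

lemma TopNilpotent.sup {I J : Ideal (Perfection C p)} (hI : TopNilpotent I)
    (hJ : TopNilpotent J) : TopNilpotent (I ⊔ J) := by
  intro k
  obtain ⟨a, ha⟩ := hI k
  obtain ⟨b, hb⟩ := hJ k
  exact ⟨a + b, Ideal.sup_pow_add_le_pow_sup_pow.trans (sup_le ha hb)⟩

lemma TopNilpotent.mono {I J : Ideal (Perfection C p)} (hI : TopNilpotent I) (h : J ≤ I) :
    TopNilpotent J := fun k => (hI k).imp fun _ hr => (Ideal.pow_right_mono h _).trans hr

/-- The congruence exponents used below. -/
def qfun (p L r : ℕ) (i : ℕ) : ℕ := 1 + (p - 1) * (min i L - (L - r))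

lemma qfun_adm (L r : ℕ) : Adm p (qfun p L r) L := by
  constructor
  · intro i
    have : min (i + 1) L - (L - r) ≤ (min i L - (L - r)) + 1 := by omega
    calc _ ≤ 1 + (p - 1) * ((min i L - (L - r)) + 1) :=
          Nat.add_le_add_left (Nat.mul_le_mul_left _ this) _
      _ = _ := by rw [qfun]; ring
  · intro i hi
    rw [qfun, qfun, min_eq_right hi, min_eq_right (by omega)]

lemma le_qfun {L r i : ℕ} (h1 : r ≤ L) (h2 : L ≤ i) : r ≤ qfun p L r i := by
  rw [qfun, min_eq_right h2, Nat.sub_sub_self h1]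
  have := hp.out.two_le
  calc r = 1 * r := (one_mul r).symm
    _ ≤ (p - 1) * r := Nat.mul_le_mul_right _ (by omega)
    _ ≤ _ := Nat.le_add_left _ _

lemma qfun_low {L r i : ℕ} (h : i < L - r) : qfun p L r i = 1 := by
  rw [qfun, min_eq_left (by omega), Nat.sub_eq_zero_of_le h.le, mul_zero, add_zero]

/-- The filtration used below. -/
def fil (I J : Ideal (Perfection C p)) (q : ℕ) : Ideal (Perfection C p) := I ^ q ⊔ J

lemma fil_mul (I J : Ideal (Perfection C p)) (q : ℕ) : I * fil I J q ≤ fil I J (q + 1) := by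
  rw [fil, fil, Ideal.mul_sup, pow_succ']
  exact sup_le_sup_left Ideal.mul_le_right _

lemma fil_anti (I J : Ideal (Perfection C p)) : Antitone (fil I J) :=
  fun _ _ h => sup_le_sup_right (Ideal.pow_le_pow_right h) _

/-- Two sequences with the same limit are eventually close enough, in the required range. -/
lemma close {s s' : ℕ → WittVector p (Perfection C p)} {x : ℤ → Perfection C p}
    (h : IsLim s x) (h' : IsLim s' x) {I : Ideal (Perfection C p)}
    (hI : ∀ N j, j < N → (s N).coeff j ∈ I ∧ (s' N).coeff j ∈ I) (k : ℕ) (n : ℤ) (r : ℕ) :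
    ∀ᶠ N : ℕ in atTop, ∀ i, i ≤ (n + N).toNat →
      (s N).coeff i - (s' N).coeff i ∈
        fil I (RingHom.ker (Perfection.coeff C p k)) (qfun p (N - n.natAbs) r i) := by
  have h1 : ∀ᶠ N : ℕ in atTop, ∀ m ∈ Finset.Icc (-(n.natAbs + r : ℤ)) n,
      Perfection.coeff C p k ((s N).coeff (m + N).toNat)
        = Perfection.coeff C p k ((s' N).coeff (m + N).toNat) := by
    rw [Filter.eventually_all_finset]
    intro m _
    filter_upwards [h k m, h' k m] with N e1 e2
    rw [e1, e2]
  filter_upwards [h1, eventually_ge_atTop (n.natAbs + r)] with N hN hN' i hi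
  by_cases hlow : i < N - n.natAbs - r
  · rw [qfun_low hlow, fil, pow_one]
    have := hI N i (by omega)
    exact Ideal.mem_sup_left (I.sub_mem this.1 this.2)
  · have := hN ((i : ℤ) - N) (by rw [Finset.mem_Icc]; omega)
    rw [sub_add_cancel, Int.toNat_natCast] at this
    refine Ideal.mem_sup_right ?_
    rw [RingHom.mem_ker, map_sub, this, sub_self]

lemma fil_top {I : Ideal (Perfection C p)} {k r : ℕ}
    (hr : I ^ r ≤ RingHom.ker (Perfection.coeff C p k)) {q : ℕ} (hq : r ≤ q)
    {u v : Perfection C p} (h : u - v ∈ fil I (RingHom.ker (Perfection.coeff C p k)) q) :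
    Perfection.coeff C p k u = Perfection.coeff C p k v := by
  have := (sup_le ((Ideal.pow_le_pow_right hq).trans hr) le_rfl :
    fil I (RingHom.ker (Perfection.coeff C p k)) q ≤ _) h
  rwa [RingHom.mem_ker, map_sub, sub_eq_zero] at this

lemma agree_add {s s' t t' : ℕ → WittVector p (Perfection C p)} {x y : ℤ → Perfection C p}
    (hs : NilLim s x) (hs' : NilLim s' x) (ht : NilLim t y) (ht' : NilLim t' y) (k : ℕ) (n : ℤ) :
    ∀ᶠ N : ℕ in atTop, Perfection.coeff C p k ((s N + t N).coeff (n + N).toNat)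
      = Perfection.coeff C p k ((s' N + t' N).coeff (n + N).toNat) := by
  obtain ⟨⟨I1, n1, -, b1⟩, l1⟩ := hs
  obtain ⟨⟨I2, n2, -, b2⟩, l2⟩ := hs'
  obtain ⟨⟨I3, n3, -, b3⟩, l3⟩ := ht
  obtain ⟨⟨I4, n4, -, b4⟩, l4⟩ := ht'
  set I := I1 ⊔ I2 ⊔ (I3 ⊔ I4) with hI
  have m1 : I1 ≤ I := le_sup_left.trans le_sup_left
  have m2 : I2 ≤ I := le_sup_right.trans le_sup_left
  have m3 : I3 ≤ I := le_sup_left.trans le_sup_right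
  have m4 : I4 ≤ I := le_sup_right.trans le_sup_right
  obtain ⟨r, hr⟩ := ((n1.sup n2).sup (n3.sup n4)) k
  filter_upwards [close l1 l2 (fun N j hj => ⟨m1 (b1 N j hj), m2 (b2 N j hj)⟩) k n r,
    close l3 l4 (fun N j hj => ⟨m3 (b3 N j hj), m4 (b4 N j hj)⟩) k n r,
    eventually_ge_atTop (n.natAbs + r)] with N e1 e2 hN
  refine fil_top hr (le_qfun (by omega) (by omega)) (add_filt I _ (fil_mul _ _) (fil_anti _ _)
    (n + N).toNat _ (N - n.natAbs) _ _ _ _ (qfun_adm _ r) (fun i hi _ => ?_)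
    fun i hi => ⟨e1 i hi, e2 i hi⟩)
  exact ⟨m1 (b1 N i (by omega)), m2 (b2 N i (by omega)), m3 (b3 N i (by omega)),
    m4 (b4 N i (by omega))⟩

lemma agree_mul (a : ℕ → WittVector p (Perfection C p))
    {s s' : ℕ → WittVector p (Perfection C p)} {x : ℤ → Perfection C p}
    (hs : NilLim s x) (hs' : NilLim s' x) (k : ℕ) (n : ℤ) :
    ∀ᶠ N : ℕ in atTop, Perfection.coeff C p k ((a N * s N).coeff (n + N).toNat)
      = Perfection.coeff C p k ((a N * s' N).coeff (n + N).toNat) := by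
  obtain ⟨⟨I1, n1, -, b1⟩, l1⟩ := hs
  obtain ⟨⟨I2, n2, -, b2⟩, l2⟩ := hs'
  obtain ⟨r, hr⟩ := (n1.sup n2) k
  have m1 : I1 ≤ I1 ⊔ I2 := le_sup_left
  have m2 : I2 ≤ I1 ⊔ I2 := le_sup_right
  filter_upwards [close l1 l2 (fun N j hj => ⟨m1 (b1 N j hj), m2 (b2 N j hj)⟩) k n r,
    eventually_ge_atTop (n.natAbs + r)] with N e1 hN
  exact fil_top hr (le_qfun (by omega) (by omega)) (mul_filt (I1 ⊔ I2) _ (fil_mul _ _)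
    (fil_anti _ _) (n + N).toNat _ (N - n.natAbs) _ _ _ (qfun_adm _ r)
    (fun i hi _ => ⟨m1 (b1 N i (by omega)), m2 (b2 N i (by omega))⟩) e1)

/-- The reindexed sequence: `V^{-N} (V s_{N-1}) = V^{-(N-1)} s_{N-1}`. -/
def vshift (s : ℕ → WittVector p (Perfection C p)) (N : ℕ) : WittVector p (Perfection C p) :=
  WittVector.verschiebung (s (N - 1))

lemma shift_coeff (s : ℕ → WittVector p (Perfection C p)) (n : ℤ) {N : ℕ} (h : n.natAbs < N) :
    (vshift s N).coeff (n + N).toNat = (s (N - 1)).coeff (n + (N - 1 : ℕ)).toNat := by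
  have : (n + N).toNat = (n + (N - 1 : ℕ)).toNat + 1 := by omega
  rw [vshift, this, WittVector.verschiebung_coeff_add_one]

lemma nilLim_vshift {s : ℕ → WittVector p (Perfection C p)} {x : ℤ → Perfection C p} (h : NilLim s x) :
    NilLim (vshift s) x := by
  obtain ⟨⟨I, h1, h2, h3⟩, h4⟩ := h
  refine ⟨⟨I, h1, h2, fun N j hj => ?_⟩, fun k n => ?_⟩
  · cases j with
    | zero => rw [vshift, WittVector.verschiebung_coeff_zero]; exact I.zero_mem
    | succ j =>
      rw [vshift, WittVector.verschiebung_coeff_add_one]; exact h3 _ _ (by omega)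
  · filter_upwards [(tendsto_sub_atTop_nat 1).eventually (h4 k n),
      eventually_gt_atTop n.natAbs] with N e hN
    rw [shift_coeff s n hN, e]

lemma exists_isLim {s : ℕ → WittVector p (Perfection C p)}
    (h : ∀ (k : ℕ) (n : ℤ), ∀ᶠ N : ℕ in atTop,
      Perfection.coeff C p k ((s N).coeff (n + N).toNat)
        = Perfection.coeff C p k ((vshift s N).coeff (n + N).toNat)) : ∃ x, IsLim s x := by
  have h1 : ∀ (k : ℕ) (n : ℤ), ∃ c : C, ∀ᶠ N : ℕ in atTop,
      Perfection.coeff C p k ((s N).coeff (n + N).toNat) = c := by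
    intro k n
    obtain ⟨N₀, hN₀⟩ := eventually_atTop.mp ((h k n).and (eventually_gt_atTop n.natAbs))
    refine ⟨Perfection.coeff C p k ((s N₀).coeff (n + N₀).toNat), ?_⟩
    filter_upwards [eventually_ge_atTop N₀] with N hN
    induction N, hN using Nat.le_induction with
    | base => rfl
    | succ N hN ih =>
      obtain ⟨e1, e2⟩ := hN₀ (N + 1) (by omega)
      rw [e1, shift_coeff s n e2]
      exact ih
  choose c hc using h1
  refine ⟨fun n => ⟨fun k => c k n, fun k => ?_⟩, fun k n => hc k n⟩
  obtain ⟨N, e1, e2⟩ := ((hc (k + 1) n).and (hc k n)).exists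
  change c (k + 1) n ^ p = c k n
  rw [← e1, ← e2, Perfection.coeff_pow_p']

lemma NilLim.mem {s : ℕ → WittVector p (Perfection C p)} {x : ℤ → Perfection C p} (h : NilLim s x) :
    (∀ m < 0, Perfection.coeff C p 0 (x m) = 0) ∧
      TopNilpotent (Ideal.span (x '' Set.Iio 0)) := by
  obtain ⟨⟨I, h1, h2, h3⟩, h4⟩ := h
  have key : ∀ (k : ℕ), ∀ m < 0, x m ∈ I ⊔ RingHom.ker (Perfection.coeff C p k) := by
    intro k m hm
    obtain ⟨N, e, hN⟩ := ((h4 k m).and (eventually_gt_atTop m.natAbs)).exists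
    have e1 : x m = (s N).coeff (m + N).toNat + (x m - (s N).coeff (m + N).toNat) := by ring
    rw [e1]
    refine Submodule.add_mem_sup (h3 _ _ (by omega)) ?_
    rw [RingHom.mem_ker, map_sub, e, sub_self]
  refine ⟨fun m hm => (sup_le h2 le_rfl : I ⊔ _ ≤ _) (key 0 m hm), fun k => ?_⟩
  obtain ⟨r, hr⟩ := h1 k
  refine ⟨r + 1, (Ideal.pow_right_mono (Ideal.span_le.mpr ?_) _).trans
    ((Ideal.sup_pow_add_le_pow_sup_pow (I := I)
      (J := RingHom.ker (Perfection.coeff C p k)) (n := r) (m := 1)).trans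
      (sup_le hr (by rw [pow_one])))⟩
  rintro _ ⟨m, hm, rfl⟩
  exact key k m hm

lemma nilLim_trunc (x : BarM C p) : NilLim (trunc x.1) x.1 := by
  refine ⟨⟨_, x.2.2, Ideal.span_le.mpr ?_, fun N j hj => Ideal.subset_span ⟨(j : ℤ) - N, ?_, rfl⟩⟩,
    fun k n => ?_⟩
  · rintro _ ⟨m, hm, rfl⟩
    exact x.2.1 m hm
  · rw [Set.mem_Iio]; omega
  · filter_upwards [eventually_gt_atTop n.natAbs] with N hN
    have : (((n + N).toNat : ℕ) : ℤ) - N = n := by omega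
    rw [trunc, WittVector.coeff_mk, this]

lemma NilLim.congr {s s' : ℕ → WittVector p (Perfection C p)} {x : ℤ → Perfection C p}
    (h : IsLim s x) (hss' : ∀ (k : ℕ) (n : ℤ), ∀ᶠ N : ℕ in atTop,
      Perfection.coeff C p k ((s' N).coeff (n + N).toNat)
        = Perfection.coeff C p k ((s N).coeff (n + N).toNat)) : IsLim s' x := fun k n => by
  filter_upwards [h k n, hss' k n] with N e1 e2
  rw [e2, e1]

lemma NilLim.add {s t : ℕ → WittVector p (Perfection C p)} {x y : ℤ → Perfection C p}
    (hs : NilLim s x) (ht : NilLim t y) : NilLim (fun N => s N + t N) (limit fun N => s N + t N) := by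
  refine ⟨?_, isLim_limit (exists_isLim fun k n => ?_)⟩
  · obtain ⟨⟨I, h1, h2, h3⟩, h4⟩ := hs
    obtain ⟨⟨J, k1, k2, k3⟩, k4⟩ := ht
    refine ⟨I ⊔ J, h1.sup k1, sup_le h2 k2, fun N j hj => add_coeff_mem _ _ _ _
      (fun i hi => Ideal.mem_sup_left (h3 _ _ (by omega)))
      (fun i hi => Ideal.mem_sup_right (k3 _ _ (by omega)))⟩
  · filter_upwards [agree_add hs (nilLim_vshift hs) ht (nilLim_vshift ht) k n] with N e
    rw [e, vshift, vshift, vshift, map_add]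

lemma NilLim.mul {s : ℕ → WittVector p (Perfection C p)} {x : ℤ → Perfection C p} (hs : NilLim s x)
    (a : ℕ → WittVector p (Perfection C p))
    (ha : ∀ N, WittVector.frobenius (a (N + 1)) = a N) :
    NilLim (fun N => a N * s N) (limit fun N => a N * s N) := by
  refine ⟨?_, isLim_limit (exists_isLim fun k n => ?_)⟩
  · obtain ⟨⟨I, h1, h2, h3⟩, h4⟩ := hs
    exact ⟨I, h1, h2, fun N j hj => mul_coeff_mem _ _ _ _ fun i hi => h3 _ _ (by omega)⟩
  · filter_upwards [agree_mul a hs (nilLim_vshift hs) k n, eventually_gt_atTop 0] with N e hN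
    obtain ⟨N, rfl⟩ : ∃ M, N = M + 1 := ⟨N - 1, by omega⟩
    rw [e, vshift, vshift, Nat.add_sub_cancel, ← ha N,
      mul_comm (WittVector.frobenius _), WittVector.verschiebung_mul_frobenius, mul_comm]

/-- The element `F^{-N} a` of `W(C^♭)`. -/
def frobInv (a : WittVector p (Perfection C p)) (N : ℕ) : WittVector p (Perfection C p) :=
  (WittVector.frobeniusEquiv p (Perfection C p)).symm^[N] a

lemma frob_frobInv (a : WittVector p (Perfection C p)) (N : ℕ) :
    WittVector.frobenius (frobInv a (N + 1)) = frobInv a N := by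
  rw [frobInv, frobInv, Function.iterate_succ_apply']
  exact (WittVector.frobeniusEquiv p (Perfection C p)).apply_symm_apply _

namespace BarM

/-- Addition of formal expressions: the coordinatewise limit of the sums of the truncations
`∑_{m ≥ -N} V^m [x_m]` and `∑_{m ≥ -N} V^m [y_m]`, computed in `V^{-N} W(C^♭)`. -/
instance : Add (BarM C p) :=
  ⟨fun x y => ⟨limit fun N => trunc x.1 N + trunc y.1 N, ((nilLim_trunc x).add (nilLim_trunc y)).mem⟩⟩

instance : Neg (BarM C p) :=
  ⟨fun x => ⟨limit fun N => -1 * trunc x.1 N,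
    ((nilLim_trunc x).mul (fun _ => -1) (fun _ => by simp)).mem⟩⟩

instance : Zero (BarM C p) :=
  ⟨⟨0, fun _ _ => map_zero _, fun k => ⟨1, by
    rw [pow_one, Ideal.span_le]; rintro _ ⟨m, -, rfl⟩; exact map_zero _⟩⟩⟩

/-- The action of `W(C^♭)`, characterized by `a • V^{-N} w = V^{-N} (F^{-N}(a) * w)` and
continuity. -/
instance : SMul (WittVector p (Perfection C p)) (BarM C p) :=
  ⟨fun a x => ⟨limit fun N => frobInv a N * trunc x.1 N,
    ((nilLim_trunc x).mul (frobInv a) (frob_frobInv a)).mem⟩⟩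

lemma spec_add {s t : ℕ → WittVector p (Perfection C p)} {x y : BarM C p}
    (hs : NilLim s x.1) (ht : NilLim t y.1) : NilLim (fun N => s N + t N) (x + y).1 :=
  ⟨(hs.add ht).1, NilLim.congr ((nilLim_trunc x).add (nilLim_trunc y)).2
    (agree_add hs (nilLim_trunc x) ht (nilLim_trunc y))⟩

lemma spec_neg {s : ℕ → WittVector p (Perfection C p)} {x : BarM C p}
    (hs : NilLim s x.1) : NilLim (fun N => -1 * s N) (-x).1 :=
  ⟨(hs.mul (fun _ => -1) (fun _ => by simp)).1,
    NilLim.congr ((nilLim_trunc x).mul (fun _ => -1) (fun _ => by simp)).2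
      (agree_mul _ hs (nilLim_trunc x))⟩

lemma spec_smul (a : WittVector p (Perfection C p))
    {s : ℕ → WittVector p (Perfection C p)} {x : BarM C p}
    (hs : NilLim s x.1) : NilLim (fun N => frobInv a N * s N) (a • x).1 :=
  ⟨(hs.mul _ (frob_frobInv a)).1, NilLim.congr ((nilLim_trunc x).mul _ (frob_frobInv a)).2
      (agree_mul _ hs (nilLim_trunc x))⟩

lemma spec_zero : NilLim (fun _ => 0) (0 : BarM C p).1 :=
  ⟨⟨⊥, fun _ => ⟨1, by simp⟩, bot_le, by simp⟩, fun k n =>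
    Eventually.of_forall fun N => by rw [WittVector.zero_coeff]; rfl⟩

lemma eq_of_nilLim {s t : ℕ → WittVector p (Perfection C p)} {x y : BarM C p}
    (hs : NilLim s x.1) (ht : NilLim t y.1) (h : ∀ N, s N = t N) : x = y := by
  obtain rfl : s = t := funext h
  exact Subtype.ext (hs.2.unique ht.2)

instance : AddCommGroup (BarM C p) where
  add_assoc x y z := eq_of_nilLim (spec_add (spec_add (nilLim_trunc x) (nilLim_trunc y)) (nilLim_trunc z))
    (spec_add (nilLim_trunc x) (spec_add (nilLim_trunc y) (nilLim_trunc z))) fun N => add_assoc _ _ _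
  zero_add x := eq_of_nilLim (spec_add spec_zero (nilLim_trunc x)) (nilLim_trunc x) fun N => zero_add _
  add_zero x := eq_of_nilLim (spec_add (nilLim_trunc x) spec_zero) (nilLim_trunc x) fun N => add_zero _
  nsmul := nsmulRec
  zsmul := zsmulRec
  neg_add_cancel x := eq_of_nilLim (spec_add (spec_neg (nilLim_trunc x)) (nilLim_trunc x)) spec_zero
    fun N => by ring
  add_comm x y := eq_of_nilLim (spec_add (nilLim_trunc x) (nilLim_trunc y))
    (spec_add (nilLim_trunc y) (nilLim_trunc x)) fun N => add_comm _ _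

lemma frobInv_add (a b : WittVector p (Perfection C p)) (N : ℕ) :
    frobInv (a + b) N = frobInv a N + frobInv b N := iterate_map_add _ _ _ _

lemma frobInv_mul (a b : WittVector p (Perfection C p)) (N : ℕ) :
    frobInv (a * b) N = frobInv a N * frobInv b N := iterate_map_mul _ _ _ _

instance : Module (WittVector p (Perfection C p)) (BarM C p) where
  one_smul x := eq_of_nilLim (spec_smul 1 (nilLim_trunc x)) (nilLim_trunc x) fun N => by
    rw [frobInv, iterate_map_one, one_mul]
  mul_smul a b x := eq_of_nilLim (spec_smul (a * b) (nilLim_trunc x))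
    (spec_smul a (spec_smul b (nilLim_trunc x))) fun N => by rw [frobInv_mul, mul_assoc]
  smul_zero a := eq_of_nilLim (spec_smul a spec_zero) spec_zero fun N => mul_zero _
  zero_smul x := eq_of_nilLim (spec_smul 0 (nilLim_trunc x)) spec_zero fun N => by
    rw [frobInv, iterate_map_zero, zero_mul]
  smul_add a x y := eq_of_nilLim (spec_smul a (spec_add (nilLim_trunc x) (nilLim_trunc y)))
    (spec_add (spec_smul a (nilLim_trunc x)) (spec_smul a (nilLim_trunc y))) fun N => mul_add _ _ _
  add_smul a b x := eq_of_nilLim (spec_smul (a + b) (nilLim_trunc x))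
    (spec_add (spec_smul a (nilLim_trunc x)) (spec_smul b (nilLim_trunc x))) fun N => by
      rw [frobInv_add, add_mul]

/-- The operator `F` on `M̄(C)`: `∑ V^m [x_m] ↦ ∑ V^m [x_m ^ p]`. -/
def frob (x : BarM C p) : BarM C p :=
  ⟨fun m => x.1 m ^ p, fun m hm => by rw [map_pow, x.2.1 m hm, zero_pow hp.out.ne_zero],
    x.2.2.mono (Ideal.span_le.mpr (by
      rintro _ ⟨m, hm, rfl⟩
      exact Ideal.pow_mem_of_mem _ (Ideal.subset_span (Set.mem_image_of_mem x.1 hm)) _ hp.out.pos))⟩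

end BarM

end barM

noncomputable section pdHull
open scoped Nat

/-- The relations imposed on the divided power algebra `Γ_A(I)` in order to obtain the PD hull of
`A → A ⧸ I` compatible with the divided powers of `p`: the degree one generator attached to
`x ∈ I` is identified with `x`, and `γ_n(p) = p ^ n / n!`. -/
inductive PDRel (p : ℕ) {A : Type*} [CommRing A] (I : Ideal A) : DividedPowerAlgebra A I → Prop
  | deg_one (x : I) : PDRel p I (DividedPowerAlgebra.dp A 1 x - algebraMap A _ (x : A))
  | base (x : I) (hx : (x : A) = p) (n : ℕ) (a : A) (ha : (n ! : A) * a = (p : A) ^ n) :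
      PDRel p I (DividedPowerAlgebra.dp A n x - algebraMap A _ a)

/-- The PD hull of `A → A ⧸ I` (with the condition `γ_n(p) = p ^ n / n!`), for a ring `A` in which
`p ^ n / n!` makes sense and an ideal `I` containing `p`: the quotient of `Γ_A(I)` by the
relations `PDRel`. -/
def PDHull (p : ℕ) {A : Type*} [CommRing A] (I : Ideal A) : Type _ :=
  DividedPowerAlgebra A I ⧸ Ideal.span {t | PDRel p I t}

instance (p : ℕ) {A : Type*} [CommRing A] (I : Ideal A) : CommRing (PDHull p I) :=
  inferInstanceAs (CommRing (DividedPowerAlgebra A I ⧸ Ideal.span {t | PDRel p I t}))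

instance (p : ℕ) {A : Type*} [CommRing A] (I : Ideal A) : Algebra A (PDHull p I) :=
  inferInstanceAs (Algebra A (DividedPowerAlgebra A I ⧸ Ideal.span {t | PDRel p I t}))

/-- The projection from `Γ_A(I)` to the PD hull. -/
def PDHull.mk (p : ℕ) {A : Type*} [CommRing A] (I : Ideal A) :
    DividedPowerAlgebra A I →+* PDHull p I :=
  Ideal.Quotient.mk (Ideal.span {t | PDRel p I t})

/-- The divided power `γ_n(x)` in the PD hull, for `x ∈ I`. -/
def PDHull.gamma (p : ℕ) {A : Type*} [CommRing A] (I : Ideal A) (n : ℕ) (x : I) : PDHull p I :=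
  PDHull.mk p I (DividedPowerAlgebra.dp A n x)

/-- A ring endomorphism `g` of `A` with `g(I) ⊆ I` induces an endomorphism of `Γ_A(I)`
sending `γ_n(x)` to `γ_n(g(x))`. -/
def dpMap {A : Type*} [CommRing A] {I : Ideal A} (g : A →+* A) (hg : ∀ x ∈ I, g x ∈ I) :
    DividedPowerAlgebra A I →+* DividedPowerAlgebra A I :=
  RingCon.lift (DividedPowerAlgebra.ringCon A I)
    (MvPolynomial.eval₂Hom ((algebraMap A (DividedPowerAlgebra A I)).comp g)
      fun nx : ℕ × I => DividedPowerAlgebra.dp A nx.1 ⟨g nx.2, hg _ nx.2.2⟩) (by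
    refine RingCon.ringConGen_le.mpr ?_
    intro a b h
    rw [RingCon.ker_apply]
    cases h with
    | rfl_zero => rfl
    | zero => simp [DividedPowerAlgebra.dp_zero]
    | @smul r n a =>
      simp only [MvPolynomial.smul_eq_C_mul, map_mul, map_pow, MvPolynomial.coe_eval₂Hom,
        MvPolynomial.eval₂_X, MvPolynomial.eval₂_C, RingHom.comp_apply]
      rw [← map_pow, ← Algebra.smul_def, ← DividedPowerAlgebra.dp_smul]
      congr 1
      ext
      simp
    | mul => simp [DividedPowerAlgebra.dp_mul]
    | @add n a b =>
      simp only [map_sum, map_mul, MvPolynomial.coe_eval₂Hom, MvPolynomial.eval₂_X]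
      refine Eq.trans ?_ (DividedPowerAlgebra.dp_add (x := (⟨g a, hg _ a.2⟩ : I))
        (y := (⟨g b, hg _ b.2⟩ : I)))
      congr 1
      ext
      simp)

lemma dpMap_dp {A : Type*} [CommRing A] {I : Ideal A} (g : A →+* A) (hg : ∀ x ∈ I, g x ∈ I)
    (n : ℕ) (x : I) :
    dpMap g hg (DividedPowerAlgebra.dp A n x) = DividedPowerAlgebra.dp A n ⟨g x, hg _ x.2⟩ :=
  MvPolynomial.eval₂Hom_X' _ _ (n, x)

lemma dpMap_algebraMap {A : Type*} [CommRing A] {I : Ideal A} (g : A →+* A)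
    (hg : ∀ x ∈ I, g x ∈ I) (a : A) :
    dpMap g hg (algebraMap A _ a) = algebraMap A _ (g a) := by
  change MvPolynomial.eval₂Hom _ _ (MvPolynomial.C a) = _
  rw [MvPolynomial.eval₂Hom_C]
  rfl

/-- A ring endomorphism `g` of `A` with `g(I) ⊆ I` induces an endomorphism of the PD hull
sending `γ_n(x)` to `γ_n(g(x))`. -/
def PDHull.map (p : ℕ) {A : Type*} [CommRing A] {I : Ideal A} (g : A →+* A)
    (hg : ∀ x ∈ I, g x ∈ I) : PDHull p I →+* PDHull p I :=
  Ideal.quotientMap (Ideal.span {t | PDRel p I t}) (dpMap g hg) (by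
    rw [Ideal.span_le]
    rintro _ (⟨x⟩ | ⟨x, hx, n, a, ha⟩)
    · refine Ideal.subset_span ?_
      rw [map_sub, dpMap_dp, dpMap_algebraMap]
      exact PDRel.deg_one ⟨g x, hg _ x.2⟩
    · refine Ideal.subset_span ?_
      rw [map_sub, dpMap_dp, dpMap_algebraMap]
      refine PDRel.base _ (by simp [hx]) n _ ?_
      rw [← map_natCast g, ← map_mul, ha, map_pow, map_natCast])

lemma PDHull.map_gamma (p : ℕ) {A : Type*} [CommRing A] {I : Ideal A} (g : A →+* A)
    (hg : ∀ x ∈ I, g x ∈ I) (n : ℕ) (x : I) :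
    PDHull.map p g hg (PDHull.gamma p I n x) = PDHull.gamma p I n ⟨g x, hg _ x.2⟩ := by
  rw [PDHull.gamma, PDHull.gamma, ← dpMap_dp]
  rfl

lemma PDHull.map_algebraMap (p : ℕ) {A : Type*} [CommRing A] {I : Ideal A} (g : A →+* A)
    (hg : ∀ x ∈ I, g x ∈ I) (a : A) :
    PDHull.map p g hg (algebraMap A (PDHull p I) a) = algebraMap A (PDHull p I) (g a) := by
  change PDHull.mk p I (dpMap g hg (algebraMap A _ a)) = PDHull.mk p I (algebraMap A _ (g a))
  rw [dpMap_algebraMap]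

lemma padicCompletionMap_aux (p : ℕ) {D : Type*} [CommRing D] (g : D →+* D) (n : ℕ) :
    Ideal.span {(p : D)} ^ n ≤ (Ideal.span {(p : D)} ^ n).comap g := by
  rw [← Ideal.map_le_iff_le_comap, Ideal.map_pow, Ideal.map_span, Set.image_singleton,
    map_natCast]

lemma padicCompletionMap_compat (p : ℕ) {D : Type*} [CommRing D] (g : D →+* D) {m n : ℕ}
    (hle : m ≤ n) : (Ideal.Quotient.factorPow (Ideal.span {(p : D)}) hle).comp
      ((Ideal.quotientMap (Ideal.span {(p : D)} ^ n) g (padicCompletionMap_aux p g n)).comp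
        (AdicCompletion.evalₐ (Ideal.span {(p : D)}) n).toRingHom) =
      (Ideal.quotientMap (Ideal.span {(p : D)} ^ m) g (padicCompletionMap_aux p g m)).comp
        (AdicCompletion.evalₐ (Ideal.span {(p : D)}) m).toRingHom := by
    ext x
    obtain ⟨f, rfl⟩ := AdicCompletion.mk_surjective _ _ x
    have h1 : g (f n) - g (f m) ∈ Ideal.span {(p : D)} ^ m := by
      rw [← map_sub]
      have h2 : f n - f m ∈ Ideal.span {(p : D)} ^ m := by
        have := AdicCompletion.AdicCauchySequence.mk_eq_mk hle f
        rw [Submodule.Quotient.eq] at this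
        simpa using this
      exact padicCompletionMap_aux p g m h2
    simpa [AdicCompletion.evalₐ_mk, Ideal.Quotient.mk_eq_mk_iff_sub_mem] using h1

/-- A ring endomorphism `g` of `D` induces an endomorphism of the `p`-adic completion of `D`. -/
def padicCompletionMap (p : ℕ) {D : Type*} [CommRing D] (g : D →+* D) :
    AdicCompletion (Ideal.span {(p : D)}) D →+* AdicCompletion (Ideal.span {(p : D)}) D :=
  AdicCompletion.liftRingHom (Ideal.span {(p : D)})
    (fun n => (Ideal.quotientMap (Ideal.span {(p : D)} ^ n) g (padicCompletionMap_aux p g n)).comp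
      (AdicCompletion.evalₐ (Ideal.span {(p : D)}) n).toRingHom)
    (padicCompletionMap_compat p g)

lemma evalₐ_padicCompletionMap (p : ℕ) {D : Type*} [CommRing D] (g : D →+* D) (n : ℕ) (y : D) :
    AdicCompletion.evalₐ (Ideal.span {(p : D)}) n
      (padicCompletionMap p g (AdicCompletion.of _ D y)) = Ideal.Quotient.mk _ (g y) := by
  rw [padicCompletionMap, AdicCompletion.evalₐ_liftRingHom _ _ (padicCompletionMap_compat p g)]
  simp

end pdHull

noncomputable section acris
open scoped Nat

/-- The kernel of the map `W(C^♭) → C` induced by `ν_0 : C^♭ → C`. -/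
def thetaKer (C : Type*) [CommRing C] (p : ℕ) [Fact p.Prime] [CharP C p] :
    Ideal (WittVector p (Perfection C p)) :=
  RingHom.ker ((Perfection.coeff C p 0).comp WittVector.constantCoeff)

/-- `A_cris(C)`: the `p`-adic completion of the PD hull of `W(C^♭) → C`. -/
def Acris (C : Type*) [CommRing C] (p : ℕ) [Fact p.Prime] [CharP C p] : Type _ :=
  AdicCompletion (Ideal.span {(p : PDHull p (thetaKer C p))}) (PDHull p (thetaKer C p))

variable {C : Type*} [CommRing C] {p : ℕ} [hp : Fact p.Prime] [CharP C p]

instance : CommRing (Acris C p) :=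
  inferInstanceAs (CommRing (AdicCompletion (Ideal.span {(p : PDHull p (thetaKer C p))})
    (PDHull p (thetaKer C p))))

instance : Algebra (PDHull p (thetaKer C p)) (Acris C p) :=
  inferInstanceAs (Algebra _ (AdicCompletion (Ideal.span {(p : PDHull p (thetaKer C p))})
    (PDHull p (thetaKer C p))))

instance : Algebra (WittVector p (Perfection C p)) (Acris C p) :=
  inferInstanceAs (Algebra _ (AdicCompletion (Ideal.span {(p : PDHull p (thetaKer C p))})
    (PDHull p (thetaKer C p))))

/-- The `p`-adic topology on `A_cris(C)`. -/
instance : TopologicalSpace (Acris C p) := (Ideal.span {(p : Acris C p)}).adicTopology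

lemma frobenius_mem_thetaKer (w : WittVector p (Perfection C p)) (hw : w ∈ thetaKer C p) :
    WittVector.frobenius w ∈ thetaKer C p := by
  have hw' : Perfection.coeff C p 0 (w.coeff 0) = 0 := hw
  change Perfection.coeff C p 0 ((WittVector.frobenius w).coeff 0) = 0
  rw [WittVector.coeff_frobenius_charP, map_pow, hw', zero_pow hp.out.ne_zero]

lemma teichmuller_mem_thetaKer (c : Perfection C p) (hc : Perfection.coeff C p 0 c = 0) :
    WittVector.teichmuller p c ∈ thetaKer C p := by
  change Perfection.coeff C p 0 ((WittVector.teichmuller p c).coeff 0) = 0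
  rw [WittVector.teichmuller_coeff_zero, hc]

namespace Acris

/-- The endomorphism `F` of `A_cris(C)` induced by the Frobenius of `C`. -/
def frob : Acris C p →+* Acris C p :=
  padicCompletionMap p (PDHull.map p WittVector.frobenius frobenius_mem_thetaKer)

/-- The divided power `γ_n(w) ∈ A_cris(C)` of `w ∈ Ker (W(C^♭) → C)`. -/
def gamma (n : ℕ) (w : thetaKer C p) : Acris C p :=
  algebraMap (PDHull p (thetaKer C p)) (Acris C p) (PDHull.gamma p _ n w)


lemma frob_algebraMap (y : PDHull p (thetaKer C p)) :
    frob (algebraMap (PDHull p (thetaKer C p)) (Acris C p) y) =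
      algebraMap (PDHull p (thetaKer C p)) (Acris C p)
        (PDHull.map p WittVector.frobenius frobenius_mem_thetaKer y) := by
  refine AdicCompletion.ext_evalₐ fun n => ?_
  exact (evalₐ_padicCompletionMap p _ n y).trans (AdicCompletion.evalₐ_of _ n _).symm

lemma frob_algebraMap_witt (a : WittVector p (Perfection C p)) :
    frob (algebraMap _ (Acris C p) a) = algebraMap _ (Acris C p) (WittVector.frobenius a) := by
  change frob (algebraMap (PDHull p (thetaKer C p)) (Acris C p) (algebraMap _ _ a)) = _
  rw [frob_algebraMap, PDHull.map_algebraMap]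
  rfl

variable (C p) in
/-- `A'_cris(C) = {u ∈ A_cris(C) | p^n u ∈ F^n(A_cris(C)) for all n}`, as a `W(C^♭)`-submodule
of `A_cris(C)`. -/
def prime : Submodule (WittVector p (Perfection C p)) (Acris C p) where
  carrier := {u | ∀ n : ℕ, ∃ v : Acris C p, (p : Acris C p) ^ n * u = frob^[n] v}
  zero_mem' n := ⟨0, by rw [mul_zero, iterate_map_zero]⟩
  add_mem' hu hv n := by
    obtain ⟨a, ha⟩ := hu n
    obtain ⟨b, hb⟩ := hv n
    exact ⟨a + b, by rw [mul_add, ha, hb, iterate_map_add]⟩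
  smul_mem' w u hu n := by
    obtain ⟨v, hv⟩ := hu n
    have h1 : ∀ m : ℕ, ∃ w' : WittVector p (Perfection C p),
        frob^[m] (algebraMap _ (Acris C p) w') = algebraMap _ (Acris C p) w := by
      intro m
      induction m with
      | zero => exact ⟨w, rfl⟩
      | succ m ih =>
        obtain ⟨w', hw'⟩ := ih
        obtain ⟨w'', rfl⟩ := (WittVector.frobenius_bijective p (Perfection C p)).2 w'
        exact ⟨w'', by rw [Function.iterate_succ_apply, frob_algebraMap_witt, hw']⟩
    obtain ⟨w', hw'⟩ := h1 n
    exact ⟨algebraMap _ _ w' * v, by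
      rw [iterate_map_mul, hw', ← hv, Algebra.smul_def, mul_left_comm]⟩

end Acris

end acris

noncomputable section fbarMap
open scoped Nat

variable {C : Type*} [CommRing C] {p : ℕ} [hp : Fact p.Prime] [CharP C p]

/-- The term `(p^l - 1)! γ_{p^l}([x_{-l}])`, `l ≥ 1`, of the series defining `f̄(x)`; the index is
`l - 1`. -/
def polarTerm (x : BarM C p) (i : ℕ) : Acris C p :=
  ((p ^ (i + 1) - 1)! : ℕ) • Acris.gamma (p ^ (i + 1))
    ⟨WittVector.teichmuller p (x.1 (-(i + 1 : ℤ))),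
      teichmuller_mem_thetaKer _ (x.2.1 _ (by omega))⟩

/-- The map `f̄ : M̄(C) → A_cris(C)`,
`∑_m V^m [x_m] ↦ ∑_{m ≥ 0} V^m [x_m] + ∑_{l ≥ 1} (p^l - 1)! γ_{p^l}([x_{-l}])`. -/
def fbar (x : BarM C p) : Acris C p :=
  algebraMap (WittVector p (Perfection C p)) (Acris C p)
      (WittVector.mk p fun m : ℕ => x.1 m) + ∑' i : ℕ, polarTerm x i

end fbarMap

noncomputable section keyExample

/-- The monoid `ℤ_+[1/p]` of non-negative elements of `ℤ[1/p]`. -/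
def PExp (p : ℕ) : AddSubmonoid ℚ≥0 where
  carrier := {q | ∃ k m : ℕ, q * (p : ℚ≥0) ^ k = m}
  zero_mem' := ⟨0, 0, by simp⟩
  add_mem' := by
    rintro a b ⟨k, m, h⟩ ⟨k', m', h'⟩
    refine ⟨k + k', m * p ^ k' + m' * p ^ k, ?_⟩
    push_cast
    rw [← h, ← h']
    ring

/-- The element `1` of `ℤ_+[1/p]`. -/
def PExp.one (p : ℕ) : PExp p := ⟨1, 0, 1, by simp⟩

/-- The ring `B[x_1^{p^{-∞}}, …, x_n^{p^{-∞}}]` of finite sums `∑ b_α x^α`, `α ∈ ℤ_+[1/p]^n`. -/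
abbrev PerfPoly (B : Type*) [CommRing B] (p n : ℕ) : Type _ :=
  AddMonoidAlgebra B (Fin n → PExp p)

/-- The variable `x_i`. -/
def PerfPoly.X (B : Type*) [CommRing B] (p n : ℕ) (i : Fin n) : PerfPoly B p n :=
  AddMonoidAlgebra.single (Pi.single i (PExp.one p)) 1

/-- The ring `C = B[x_1^{p^{-∞}}, …, x_n^{p^{-∞}}] / (x_1, …, x_n)`. -/
abbrev KeyRing (B : Type*) [CommRing B] (p n : ℕ) : Type _ :=
  PerfPoly B p n ⧸ Ideal.span (Set.range (PerfPoly.X B p n))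

variable (B : Type*) [CommRing B] (p n : ℕ)

lemma PExp.add_eq_zero (a b : Fin n → PExp p) : a + b = 0 ↔ a = 0 ∧ b = 0 := by
  constructor
  · intro h
    have h' : ∀ i, (a i : ℚ≥0) = 0 ∧ (b i : ℚ≥0) = 0 := fun i => by
      have h1 : ((a i : ℚ≥0) + (b i : ℚ≥0)) = 0 := congrArg Subtype.val (congrFun h i)
      exact _root_.add_eq_zero.mp h1
    exact ⟨funext fun i => Subtype.ext (h' i).1, funext fun i => Subtype.ext (h' i).2⟩
  · rintro ⟨rfl, rfl⟩
    exact add_zero _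

open Classical in
/-- The homomorphism `B[x^{p^{-∞}}] → B` sending `x^α` to `0` for `α ≠ 0`. -/
def PerfPoly.aug : PerfPoly B p n →ₐ[B] B :=
  AddMonoidAlgebra.lift B B (Fin n → PExp p)
    { toFun := fun a => if a.toAdd = 0 then 1 else 0
      map_one' := by simp
      map_mul' := fun a b => by
        have h : (a * b).toAdd = 0 ↔ a.toAdd = 0 ∧ b.toAdd = 0 := by
          rw [toAdd_mul, PExp.add_eq_zero]
        by_cases h1 : a.toAdd = 0
        · by_cases h2 : b.toAdd = 0
          · rw [if_pos (h.mpr ⟨h1, h2⟩), if_pos h1, if_pos h2, one_mul]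
          · rw [if_neg fun h' => h2 (h.mp h').2, if_neg h2, mul_zero]
        · rw [if_neg fun h' => h1 (h.mp h').1, if_neg h1, zero_mul] }

instance [Fact p.Prime] [CharP B p] : CharP (KeyRing B p n) p := by
  have h : ∀ y ∈ Ideal.span (Set.range (PerfPoly.X B p n)), PerfPoly.aug B p n y = 0 := by
    intro y hy
    rw [← RingHom.mem_ker]
    refine (Ideal.span_le.mpr ?_ : _ ≤ RingHom.ker (PerfPoly.aug B p n)) hy
    rintro _ ⟨i, rfl⟩
    have h1 : (Pi.single i (PExp.one p) : Fin n → PExp p) ≠ 0 := fun h0 => by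
      have h2 : ((Pi.single i (PExp.one p) : Fin n → PExp p) i : ℚ≥0) = 0 := by rw [h0]; rfl
      rw [Pi.single_eq_same] at h2
      exact one_ne_zero h2
    rw [SetLike.mem_coe, RingHom.mem_ker, PerfPoly.X, PerfPoly.aug, AddMonoidAlgebra.lift_single]
    simp [h1]
  refine charP_of_injective_ringHom (f := algebraMap B (KeyRing B p n)) (fun a b hab => ?_) p
  have := congrArg (Ideal.Quotient.liftₐ _ (PerfPoly.aug B p n) h) hab
  simpa using this

end keyExample

end Fontaine

/-!
If `x ∈ M̄(C)` and `s_N ∈ W(C^♭)` represents the truncation of `x` at `V^{-N}`, then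
`p^l · (p^l - 1)! γ_{p^l}([r]) = [r]^{p^l}` shows that `f̄(x)` is the limit of `p^{-N} F^N(s_N)`.
If `A_cris(C)` is torsion free, this determines `f̄(x)`, and only the limit of the `s_N` matters; so
`f̄` is additive, `W(C^♭)`-linear and compatible with `F`, and `p f̄(x) = F(f̄(V x))`, whence
`f̄(x) ∈ A'_cris(C)`.

Every element of `A_cris(C)` has a unique expansion `∑ a_α x^α / ⌊α⌋!` with `a_α ∈ W(B)` tending
to `0`, where `⌊α⌋! = ∏ ⌊α_i⌋!`; uniqueness comes from a map to the `p`-adic completion of the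
torsion-free ring `⨁ W(B) x^α / ⌊α⌋!`. In particular `A_cris(C)` is torsion free.

Injectivity: `F` is injective on `A_cris(C)`, so `f̄(x) = 0` forces `f̄(V^M x) = 0` for all `M ≥ 0`.
Hence the component of `V^M x` in `W(C^♭)` has the same image as the negative of the divided power
terms, in which all monomials have degree at least `1`, and so its `i`-th coordinate `x_{i-M}` has
degree at least `p^i`. For fixed `m = i - M` this degree is unbounded, so `x_m = 0`.

Surjectivity: cut the expansion of `u ∈ A'_cris(C)` into layers of exponents
`p^L ≤ max α_i < p^{L+1}`, with `max α_i < p` for `L = 0`. As `p^L u ∈ F^L(A_cris(C))` and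
`⌊α / p^L⌋!` is prime to `p`, the `L`-th layer is `p^{-L} F^L(w_L)` with `w_L ∈ W(C^♭)`, and `u` is
the image of `∑ V^{-L} w_L`.
-/

namespace Fontaine

open WittVector

section adic

variable {S : Type*} [CommRing S]

lemma sModEq_span_singleton_pow_iff {ϖ x y : S} {m : ℕ} :
    x ≡ y [SMOD (Ideal.span {ϖ} ^ m • ⊤ : Submodule S S)] ↔ ϖ ^ m ∣ y - x := by
  rw [SModEq.comm, SModEq.sub_mem, smul_eq_mul, Ideal.mul_top, Ideal.span_singleton_pow,
    Ideal.mem_span_singleton]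

lemma eq_of_forall_pow_dvd_sub (ϖ : S) [IsHausdorff (Ideal.span {ϖ}) S] {x y : S}
    (h : ∀ m, ϖ ^ m ∣ x - y) : x = y :=
  (IsHausdorff.eq_iff_smodEq (I := Ideal.span {ϖ})).mpr fun m =>
    (sModEq_span_singleton_pow_iff.mpr (h m)).symm

lemma eq_zero_of_forall_pow_dvd (ϖ : S) [IsHausdorff (Ideal.span {ϖ}) S] {x : S}
    (h : ∀ m, ϖ ^ m ∣ x) : x = 0 :=
  eq_of_forall_pow_dvd_sub ϖ fun m => by rw [sub_zero]; exact h m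

lemma pow_dvd_sub_of_le {ϖ : S} {f : ℕ → S} (h : ∀ m, ϖ ^ m ∣ f (m + 1) - f m) {m k : ℕ}
    (hmk : m ≤ k) : ϖ ^ m ∣ f k - f m := by
  induction k, hmk using Nat.le_induction with
  | base => simp
  | succ k hk ih =>
    rw [← sub_add_sub_cancel _ (f k)]
    exact dvd_add ((pow_dvd_pow _ hk).trans (h k)) ih

lemma exists_forall_pow_dvd_sub {ϖ : S} [IsPrecomplete (Ideal.span {ϖ}) S] {f : ℕ → S}
    (h : ∀ m, ϖ ^ m ∣ f (m + 1) - f m) : ∃ u, ∀ m, ϖ ^ m ∣ u - f m := by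
  obtain ⟨u, hu⟩ := IsPrecomplete.prec (I := Ideal.span {ϖ}) inferInstance
    (f := f) fun hmk => sModEq_span_singleton_pow_iff.mpr (pow_dvd_sub_of_le h hmk)
  exact ⟨u, fun m => sModEq_span_singleton_pow_iff.mp (hu m)⟩

end adic

section torsionFree

variable {S : Type*} [CommRing S]

lemma isLeftRegular_natCast [IsAddTorsionFree S] {k : ℕ} (hk : k ≠ 0) :
    IsLeftRegular (k : S) := fun x y h =>
  nsmul_right_injective hk (by simpa only [nsmul_eq_mul] using h)

lemma pow_add_dvd_pow_mul_iff [IsAddTorsionFree S] {p : ℕ} (hp : p ≠ 0) {N M : ℕ} {x : S} :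
    (p : S) ^ (N + M) ∣ (p : S) ^ N * x ↔ (p : S) ^ M ∣ x := by
  rw [pow_add, ((isLeftRegular_natCast hp).pow N).dvd_cancel_left]

lemma isAddTorsionFree_of_natCast_mul_eq_zero
    (h : ∀ (k : ℕ) (x : S), k ≠ 0 → (k : S) * x = 0 → x = 0) : IsAddTorsionFree S :=
  ⟨fun k hk x y hxy => sub_eq_zero.mp (h k _ hk (by
    rw [mul_sub, ← nsmul_eq_mul, ← nsmul_eq_mul]; exact sub_eq_zero.mpr hxy))⟩

end torsionFree

section padic
open scoped Nat

variable {p : ℕ}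

lemma isUnit_natCast_of_coprime {S : Type*} [CommRing S]
    [IsAdicComplete (Ideal.span {(p : S)}) S] {k : ℕ} (hk : k.Coprime p) : IsUnit (k : S) := by
  obtain ⟨a, b, hab⟩ := Nat.isCoprime_iff_coprime.mpr hk
  have hp : (p : S) ∈ (⊥ : Ideal S).jacobson :=
    IsAdicComplete.le_jacobson_bot (Ideal.span {(p : S)}) (Ideal.mem_span_singleton_self _)
  have h : (p : S) * -(b : S) + 1 = a * k := by
    have := congrArg (Int.cast (R := S)) hab
    push_cast at this
    rw [← this]; ring
  exact isUnit_of_mul_isUnit_right (h ▸ Ideal.mem_jacobson_bot.mp hp (-(b : S)))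

variable [hp : Fact p.Prime]

lemma pow_dvd_factorial_pow_succ (i : ℕ) : p ^ i ∣ (p ^ (i + 1) - 1)! :=
  Nat.dvd_factorial (pow_pos hp.out.pos i)
    (Nat.le_sub_one_of_lt (Nat.pow_lt_pow_right hp.out.one_lt i.lt_succ_self))

variable {S : Type*} [CommRing S] [IsAdicComplete (Ideal.span {(p : S)}) S]

lemma exists_natCast_mul_eq_pow {k : ℕ} (hk : k ≠ 0) :
    ∃ u : S, (k : S) * u = (p : S) ^ padicValNat p k := by
  obtain ⟨m, hm⟩ := pow_padicValNat_dvd (p := p) (n := k)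
  have hmp : ¬ p ∣ m := fun ⟨c, hc⟩ => pow_succ_padicValNat_not_dvd (p := p) hk
    ⟨c, by rw [pow_succ, mul_assoc, ← hc, ← hm]⟩
  obtain ⟨u, hu⟩ := isUnit_natCast_of_coprime (S := S)
    ((Nat.Prime.coprime_iff_not_dvd hp.out).mpr hmp).symm
  refine ⟨↑u⁻¹, ?_⟩
  conv_lhs => rw [hm]
  rw [Nat.cast_mul, Nat.cast_pow, ← hu, mul_assoc, u.mul_inv, mul_one]

lemma exists_factorial_mul_p_mul_eq_pow {k : ℕ} (hk : k ≠ 0) :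
    ∃ c : S, (k ! : S) * (p * c) = (p : S) ^ k := by
  obtain ⟨u, hu⟩ := exists_natCast_mul_eq_pow (p := p) (S := S) (Nat.factorial_ne_zero k)
  obtain ⟨j, hj⟩ := Nat.exists_eq_add_of_lt (padicValNat_factorial_lt_of_ne_zero p hk)
  refine ⟨p ^ j * u, ?_⟩
  rw [mul_left_comm, mul_left_comm _ (_ ^ j), hu, ← pow_add, ← pow_succ', add_comm j, ← hj]

lemma exists_factorial_mul_eq_pow (k : ℕ) : ∃ c : S, (k ! : S) * c = (p : S) ^ k := by
  rcases eq_or_ne k 0 with rfl | hk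
  · exact ⟨1, by simp⟩
  · obtain ⟨c, hc⟩ := exists_factorial_mul_p_mul_eq_pow (p := p) (S := S) hk
    exact ⟨_, hc⟩

lemma isAddTorsionFree_of_isLeftRegular (h : IsLeftRegular (p : S)) : IsAddTorsionFree S :=
  isAddTorsionFree_of_natCast_mul_eq_zero fun k x hk hx => by
    obtain ⟨u, hu⟩ := exists_natCast_mul_eq_pow (p := p) (S := S) hk
    refine h.pow (padicValNat p k) ?_
    dsimp only
    rw [← hu, mul_right_comm, hx, zero_mul, mul_zero]

end padic

instance {p : ℕ} [hp : Fact p.Prime] {R : Type*} [CommRing R] [CharP R p] [PerfectRing R p] :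
    IsAddTorsionFree (WittVector p R) :=
  isAddTorsionFree_of_isLeftRegular (p := p) fun x y h => sub_eq_zero.mp
    (eq_zero_of_p_mul_eq_zero _ (by rw [mul_comm, mul_sub]; exact sub_eq_zero.mpr h))

section adicCompletion

variable {p : ℕ} {D : Type*} [CommRing D]

lemma isAdicComplete_adicCompletion : IsAdicComplete
    (Ideal.span {(p : AdicCompletion (Ideal.span {(p : D)}) D)})
    (AdicCompletion (Ideal.span {(p : D)}) D) := by
  have h := AdicCompletion.isAdicComplete (I := Ideal.span {(p : D)}) (M := D)
    ⟨{(p : D)}, by simp⟩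
  have e : Ideal.span {(p : AdicCompletion (Ideal.span {(p : D)}) D)} =
      (Ideal.span {(p : D)}).map (algebraMap D (AdicCompletion (Ideal.span {(p : D)}) D)) := by
    rw [Ideal.map_span, Set.image_singleton, map_natCast]
  rw [e]
  exact { haus' := (IsHausdorff.map_algebraMap_iff.mpr h.toIsHausdorff).haus'
          prec' := (IsPrecomplete.map_algebraMap_iff.mpr h.toIsPrecomplete).prec' }

lemma pow_dvd_of_evalₐ_eq_zero {m : ℕ} {u : AdicCompletion (Ideal.span {(p : D)}) D}
    (h : AdicCompletion.evalₐ (Ideal.span {(p : D)}) m u = 0) :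
    (p : AdicCompletion (Ideal.span {(p : D)}) D) ^ m ∣ u := by
  have hker : u ∈ (AdicCompletion.eval (Ideal.span {(p : D)}) D m).ker := by
    rw [LinearMap.mem_ker, ← AdicCompletion.factor_evalₐ_eq_eval (I := Ideal.span {(p : D)})
      (n := m) u (by simp), h, map_zero]
  rw [← AdicCompletion.pow_smul_top_eq_ker_eval ⟨{(p : D)}, by simp⟩,
    Ideal.span_singleton_pow, Submodule.ideal_span_singleton_smul] at hker
  obtain ⟨v, -, rfl⟩ := (Submodule.mem_smul_pointwise_iff_exists _ _ _).mp hker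
  exact ⟨v, by rw [Algebra.smul_def, map_pow, map_natCast]⟩

lemma exists_pow_dvd_sub_algebraMap (m : ℕ) (u : AdicCompletion (Ideal.span {(p : D)}) D) :
    ∃ d : D, (p : AdicCompletion (Ideal.span {(p : D)}) D) ^ m ∣ u - algebraMap D _ d := by
  obtain ⟨d, hd⟩ := Ideal.Quotient.mk_surjective (AdicCompletion.evalₐ (Ideal.span {(p : D)}) m u)
  refine ⟨d, pow_dvd_of_evalₐ_eq_zero ?_⟩
  rw [map_sub, ← hd, sub_eq_zero]
  exact (AdicCompletion.evalₐ_of _ _ _).symm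

lemma pow_dvd_of_pow_dvd_algebraMap {m : ℕ} {d : D}
    (h : (p : AdicCompletion (Ideal.span {(p : D)}) D) ^ m ∣ algebraMap D _ d) :
    (p : D) ^ m ∣ d := by
  have heval : AdicCompletion.evalₐ (Ideal.span {(p : D)}) m (algebraMap D _ d)
    = Ideal.Quotient.mk _ d := AdicCompletion.evalₐ_of _ _ _
  have hp : (p : D ⧸ Ideal.span {(p : D)} ^ m) ^ m = 0 := by
    rw [← map_natCast (Ideal.Quotient.mk (Ideal.span {(p : D)} ^ m)), ← map_pow,
      Ideal.Quotient.eq_zero_iff_mem]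
    exact Ideal.pow_mem_pow (Ideal.mem_span_singleton_self _) _
  obtain ⟨c, hc⟩ := h
  rw [← Ideal.mem_span_singleton, ← Ideal.span_singleton_pow, ← Ideal.Quotient.eq_zero_iff_mem,
    ← heval, hc, map_mul, map_pow, map_natCast, hp, zero_mul]

lemma isAddTorsionFree_adicCompletion [hp : Fact p.Prime] [IsAddTorsionFree D] :
    IsAddTorsionFree (AdicCompletion (Ideal.span {(p : D)}) D) := by
  have := isAdicComplete_adicCompletion (p := p) (D := D)
  refine isAddTorsionFree_of_isLeftRegular (p := p) (isLeftRegular_of_non_zero_divisor _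
    fun u hu => eq_zero_of_forall_pow_dvd (p : AdicCompletion _ D) fun m => ?_)
  obtain ⟨d, v, hd⟩ := exists_pow_dvd_sub_algebraMap (m + 1) u
  have hpd : (p : D) ^ (1 + m) ∣ p ^ 1 * d := pow_dvd_of_pow_dvd_algebraMap ⟨-(p * v), by
    rw [map_mul, map_pow, map_natCast]
    linear_combination hu - (p : AdicCompletion (Ideal.span {(p : D)}) D) * hd⟩
  obtain ⟨c, rfl⟩ := (pow_add_dvd_pow_mul_iff hp.out.ne_zero).mp hpd
  refine ⟨algebraMap D _ c + p * v, ?_⟩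
  rw [map_mul, map_pow, map_natCast] at hd
  linear_combination hd

end adicCompletion

section pdHull
open scoped Nat

variable {p : ℕ} {A : Type*} [CommRing A] {I : Ideal A}

namespace PDHull

lemma exists_lift {S : Type*} [CommRing S] (g : A →+* S) (dpS : ℕ → I → S)
    (h_zero : ∀ x, dpS 0 x = 1) (h_one : ∀ x, dpS 1 x = g x)
    (h_smul : ∀ n (a : A) (x : I), dpS n (a • x) = g a ^ n * dpS n x)
    (h_mul : ∀ m n x, dpS m x * dpS n x = (m + n).choose m • dpS (m + n) x)
    (h_add : ∀ n x y, dpS n (x + y) =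
      ∑ k ∈ Finset.HasAntidiagonal.antidiagonal n, dpS k.1 x * dpS k.2 y)
    (h_base : ∀ (x : I), (x : A) = p → ∀ (n : ℕ) (a : A), (n ! : A) * a = (p : A) ^ n →
      dpS n x = g a) :
    ∃ f : PDHull p I →+* S, (∀ a, f (algebraMap A _ a) = g a) ∧
      ∀ n x, f (gamma p I n x) = dpS n x := by
  let _ := g.toAlgebra
  let f₀ : DividedPowerAlgebra A I →ₐ[A] S :=
    DividedPowerAlgebra.lift' (f := fun nx => dpS nx.1 nx.2) h_zero
      (fun n a x => by rw [h_smul, ← map_pow, Algebra.smul_def]; rfl)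
      (fun m n x => by rw [h_mul]) h_add
  have f₀_dp : ∀ n x, f₀ (DividedPowerAlgebra.dp A n x) = dpS n x := fun n x =>
    DividedPowerAlgebra.lift'_apply_dp _ _ _ _ n x
  have f₀_algebraMap : ∀ a, f₀ (algebraMap A _ a) = g a := fun a => f₀.commutes a
  have hle : Ideal.span {t | PDRel p I t} ≤ RingHom.ker f₀.toRingHom := by
    rw [Ideal.span_le]
    rintro _ (⟨x⟩ | ⟨x, hx, n, a, ha⟩)
    · change f₀ _ = 0
      rw [map_sub, f₀_dp, f₀_algebraMap, h_one, sub_self]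
    · change f₀ _ = 0
      rw [map_sub, f₀_dp, f₀_algebraMap, h_base x hx n a ha, sub_self]
  exact ⟨Ideal.Quotient.lift _ f₀.toRingHom fun t ht => hle ht, f₀_algebraMap, f₀_dp⟩

lemma induction_on {P : PDHull p I → Prop} (d : PDHull p I)
    (algebraMap : ∀ a, P (algebraMap A _ a)) (add : ∀ x y, P x → P y → P (x + y))
    (gamma : ∀ x n y, P x → P (x * PDHull.gamma p I n y)) : P d := by
  obtain ⟨d, rfl⟩ := Ideal.Quotient.mk_surjective d
  induction d using DividedPowerAlgebra.induction_on with
  | C a => exact algebraMap a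
  | add f g hf hg => exact add _ _ hf hg
  | dp f n m hf => exact gamma _ _ _ hf

lemma mk_eq_mk_of_pdRel {s t : DividedPowerAlgebra A I} (h : PDRel p I (s - t)) :
    mk p I s = mk p I t :=
  Ideal.Quotient.eq.mpr (Ideal.subset_span h)

lemma gamma_zero (x : I) : gamma p I 0 x = 1 := by
  rw [gamma, DividedPowerAlgebra.dp_zero, map_one]

lemma gamma_one (x : I) : gamma p I 1 x = algebraMap A _ (x : A) :=
  mk_eq_mk_of_pdRel (PDRel.deg_one x)

lemma factorial_mul_gamma (n : ℕ) (x : I) :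
    (n ! : PDHull p I) * gamma p I n x = algebraMap A _ (x : A) ^ n := by
  rw [← gamma_one, gamma, gamma, ← map_pow, ← DividedPowerAlgebra.natFactorial_mul_dp_eq, map_mul,
    map_natCast]

lemma gamma_mul (m n : ℕ) (x : I) :
    gamma p I m x * gamma p I n x = (m + n).choose m • gamma p I (m + n) x := by
  rw [gamma, gamma, ← map_mul, DividedPowerAlgebra.dp_mul, map_nsmul]
  rfl

lemma gamma_add (n : ℕ) (x y : I) : gamma p I n (x + y) =
    ∑ k ∈ Finset.HasAntidiagonal.antidiagonal n, gamma p I k.1 x * gamma p I k.2 y := by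
  rw [gamma, DividedPowerAlgebra.dp_add, map_sum]
  simp only [map_mul]
  rfl

lemma gamma_smul (n : ℕ) (a : A) (x : I) :
    gamma p I n (a • x) = algebraMap A _ (a ^ n) * gamma p I n x := by
  rw [gamma, DividedPowerAlgebra.dp_smul, Algebra.smul_def, map_mul]
  rfl

lemma gamma_natCast (x : I) (hx : (x : A) = p) (n : ℕ) (a : A)
    (ha : (n ! : A) * a = (p : A) ^ n) : gamma p I n x = algebraMap A _ a :=
  mk_eq_mk_of_pdRel (PDRel.base x hx n a ha)

end PDHull

end pdHull

noncomputable section general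
open scoped Nat
open Filter Topology

variable {C : Type*} [CommRing C] {p : ℕ} [hp : Fact p.Prime] [CharP C p]

instance : IsAdicComplete (Ideal.span {(p : Acris C p)}) (Acris C p) :=
  isAdicComplete_adicCompletion (D := PDHull p (thetaKer C p))

lemma Acris.algebraMap_witt (w : WittVector p (Perfection C p)) :
    algebraMap _ (Acris C p) w =
      algebraMap (PDHull p (thetaKer C p)) (Acris C p) (algebraMap _ _ w) := rfl

lemma Acris.factorial_mul_gamma (k : ℕ) (w : thetaKer C p) :
    (k ! : Acris C p) * Acris.gamma k w =
      algebraMap (WittVector p (Perfection C p)) (Acris C p) (w : WittVector p _) ^ k := by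
  rw [Acris.gamma, Acris.algebraMap_witt, ← map_pow, ← PDHull.factorial_mul_gamma, map_mul,
    map_natCast]

section topology

lemma Acris.tendsto_nhds_iff {ι : Type*} {l : Filter ι} {f : ι → Acris C p} {a : Acris C p} :
    Tendsto f l (𝓝 a) ↔ ∀ m, ∀ᶠ i in l, (p : Acris C p) ^ m ∣ a - f i := by
  rw [(Ideal.hasBasis_nhds_adic (Ideal.span {(p : Acris C p)}) a).tendsto_right_iff]
  refine ⟨fun h m => (h m trivial).mono fun i hi => ?_, fun h m _ => (h m).mono fun i hi => ?_⟩
  · obtain ⟨y, hy, hy'⟩ := hi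
    rw [SetLike.mem_coe, Ideal.span_singleton_pow, Ideal.mem_span_singleton] at hy
    have : a - f i = -y := by rw [← hy']; simp
    rw [this]
    exact hy.neg_right
  · refine ⟨f i - a, ?_, by simp⟩
    rw [SetLike.mem_coe, Ideal.span_singleton_pow, Ideal.mem_span_singleton, ← neg_sub]
    exact hi.neg_right

instance : T2Space (Acris C p) := by
  refine t2_iff_nhds.mpr fun {x y} h => eq_of_forall_pow_dvd_sub (p : Acris C p) fun m => ?_
  have h1 := Acris.tendsto_nhds_iff.mp
    (tendsto_id'.mpr (inf_le_left : 𝓝 x ⊓ 𝓝 y ≤ 𝓝 x)) m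
  have h2 := Acris.tendsto_nhds_iff.mp
    (tendsto_id'.mpr (inf_le_right : 𝓝 x ⊓ 𝓝 y ≤ 𝓝 y)) m
  obtain ⟨z, h3, h4⟩ := (h1.and h2).exists
  have := dvd_sub h3 h4
  rwa [sub_sub_sub_cancel_right] at this

lemma Acris.exists_hasSum {f : ℕ → Acris C p} (h : ∀ i, (p : Acris C p) ^ i ∣ f i) :
    ∃ a, HasSum f a ∧ ∀ N, (p : Acris C p) ^ N ∣ a - ∑ i ∈ Finset.range N, f i := by
  obtain ⟨a, ha⟩ := exists_forall_pow_dvd_sub (ϖ := (p : Acris C p))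
    (f := fun N => ∑ i ∈ Finset.range N, f i) fun m => by
      rw [Finset.sum_range_succ, add_sub_cancel_left]; exact h m
  refine ⟨a, Acris.tendsto_nhds_iff.mpr fun m => ?_, ha⟩
  filter_upwards [eventually_ge_atTop (Finset.range m)] with S hS
  have h1 : (p : Acris C p) ^ m ∣ ∑ i ∈ S \ Finset.range m, f i := Finset.dvd_sum fun i hi => by
    rw [Finset.mem_sdiff, Finset.mem_range, not_lt] at hi
    exact (pow_dvd_pow _ hi.2).trans (h i)
  rw [← Finset.sum_sdiff hS, add_comm, ← sub_sub]
  exact dvd_sub (ha m) h1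

end topology

section frobeniusPowers

open Classical in
/-- The element `(p^l - 1)! γ_{p^l}([r])` for `r ∈ Ker ν_0`, totalised by `0` elsewhere. -/
def polar (l : ℕ) (r : Perfection C p) : Acris C p :=
  if h : Perfection.coeff C p 0 r = 0 then
    ((p ^ l - 1)! : ℕ) • Acris.gamma (p ^ l) ⟨teichmuller p r, teichmuller_mem_thetaKer _ h⟩
  else 0

lemma polarTerm_eq_polar (x : BarM C p) (i : ℕ) :
    polarTerm x i = polar (i + 1) (x.1 (-(i + 1 : ℤ))) := by
  rw [polar, dif_pos (x.2.1 _ (by omega))]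
  rfl

lemma pow_dvd_polar (i : ℕ) (r : Perfection C p) :
    (p : Acris C p) ^ i ∣ polar (i + 1) r := by
  rw [polar]
  split_ifs with h
  · rw [nsmul_eq_mul]
    refine Dvd.dvd.mul_right ?_ _
    rw [← Nat.cast_pow]
    exact Nat.cast_dvd_cast (pow_dvd_factorial_pow_succ i)
  · exact dvd_zero _

lemma iterate_frobenius_teichmuller (l : ℕ) (r : Perfection C p) :
    WittVector.frobenius^[l] (teichmuller p r) = teichmuller p r ^ p ^ l := by
  induction l generalizing r with
  | zero => simp
  | succ l ih => rw [Function.iterate_succ_apply, frob_teich, ih, map_pow, ← pow_mul, pow_succ']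

lemma pow_mul_polar (l : ℕ) (r : Perfection C p) (h : Perfection.coeff C p 0 r = 0) :
    (p : Acris C p) ^ l * polar l r =
      algebraMap (WittVector p (Perfection C p)) (Acris C p)
        (WittVector.frobenius^[l] (teichmuller p r)) := by
  rw [iterate_frobenius_teichmuller, map_pow, polar, dif_pos h, nsmul_eq_mul, ← mul_assoc,
    ← Nat.cast_pow, ← Nat.cast_mul, Nat.mul_factorial_pred (pow_pos hp.out.pos _).ne']
  exact Acris.factorial_mul_gamma _ ⟨teichmuller p r, teichmuller_mem_thetaKer _ h⟩

/-- The element `p^{-N} F^N(w)` of `A_cris(C)`, for a Witt vector `w` whose first `N` coordinates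
lie in `Ker ν_0`; it is given by the series defining `f̄`, applied to `V^{-N} w`. -/
def divFrob (N : ℕ) (w : WittVector p (Perfection C p)) : Acris C p :=
  algebraMap (WittVector p (Perfection C p)) (Acris C p) (WittVector.mk p fun i => w.coeff (i + N))
    + ∑ i ∈ Finset.range N, polar (i + 1) (w.coeff (N - 1 - i))

lemma divFrob_succ (N : ℕ) (w : WittVector p (Perfection C p)) :
    divFrob (N + 1) w = polar (N + 1) (w.coeff 0) + divFrob N (wtl w) := by
  rw [divFrob, divFrob, Finset.sum_range_succ, Nat.add_sub_cancel, Nat.sub_self]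
  have : ∑ i ∈ Finset.range N, polar (i + 1) (w.coeff (N - i)) =
      ∑ i ∈ Finset.range N, polar (i + 1) ((wtl w).coeff (N - 1 - i)) :=
    Finset.sum_congr rfl fun i hi => by
      rw [Finset.mem_range] at hi
      rw [wtl_coeff]
      congr 2
      omega
  rw [this, add_comm (Finset.sum _ _), ← add_assoc, add_comm (algebraMap _ _ _), add_assoc]
  rfl

lemma pow_mul_divFrob (N : ℕ) (w : WittVector p (Perfection C p))
    (hw : ∀ j < N, Perfection.coeff C p 0 (w.coeff j) = 0) :
    (p : Acris C p) ^ N * divFrob N w =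
      algebraMap (WittVector p (Perfection C p)) (Acris C p) (WittVector.frobenius^[N] w) := by
  induction N generalizing w with
  | zero => simp [divFrob, WittVector.mk]
  | succ N ih =>
    rw [divFrob_succ, mul_add, pow_mul_polar _ _ (hw 0 (by omega)), pow_succ', mul_assoc,
      ih _ fun j hj => hw (j + 1) (by omega)]
    conv_rhs => rw [eq_cons w, iterate_map_add, Function.iterate_succ_apply _ _ (verschiebung _),
      frobenius_verschiebung, mul_comm, ← nsmul_eq_mul, iterate_map_nsmul, nsmul_eq_mul]
    rw [map_add, map_mul, map_natCast]

lemma coeff_pow_p_pow (k : ℕ) (r : Perfection C p) :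
    Perfection.coeff C p k (r ^ p ^ k) = Perfection.coeff C p 0 r := by
  have := Perfection.coeffMonoidHom_pow_p_pow r 0 k
  rw [zero_add] at this
  exact this

lemma iterate_frobenius_frobInv (k : ℕ) (w : WittVector p (Perfection C p)) :
    WittVector.frobenius^[k] (frobInv w k) = w := by
  induction k with
  | zero => rfl
  | succ k ih => rw [Function.iterate_succ_apply, frob_frobInv, ih]

lemma frobInv_coeff_pow (k i : ℕ) (w : WittVector p (Perfection C p)) :
    (frobInv w k).coeff i ^ p ^ k = w.coeff i := by
  conv_rhs => rw [← iterate_frobenius_frobInv k w]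
  rw [iterate_frobenius_coeff]

lemma coeff_frobInv_coeff (k i : ℕ) (w : WittVector p (Perfection C p)) :
    Perfection.coeff C p 0 ((frobInv w k).coeff i) = Perfection.coeff C p k (w.coeff i) := by
  rw [← frobInv_coeff_pow k i w, coeff_pow_p_pow]

lemma pow_dvd_algebraMap_iterate_frobenius (l k : ℕ) (w : WittVector p (Perfection C p))
    (hw : ∀ i < l + k, Perfection.coeff C p k (w.coeff i) = 0) :
    (p : Acris C p) ^ (l + k) ∣ algebraMap (WittVector p (Perfection C p)) (Acris C p)
      (WittVector.frobenius^[l] w) := by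
  rw [← iterate_frobenius_frobInv k w, ← Function.iterate_add_apply, ← pow_mul_divFrob (l + k) _
    fun i hi => by rw [coeff_frobInv_coeff, hw i hi]]
  exact dvd_mul_right _ _

lemma coeff_sub_coeff_eq_zero {l k : ℕ} {w w' : WittVector p (Perfection C p)}
    (h : ∀ i < l, Perfection.coeff C p k (w.coeff i) = Perfection.coeff C p k (w'.coeff i)) :
    ∀ i < l, Perfection.coeff C p k ((w - w').coeff i) = 0 := by
  intro i hi
  have h1 := (le_coeff_eq_iff_le_sub_coeff_eq_zero (x := WittVector.map (Perfection.coeff C p k) w)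
    (y := WittVector.map (Perfection.coeff C p k) w') (n := l)).mp
    (fun i hi => by rw [WittVector.map_coeff, WittVector.map_coeff, h i hi]) i hi
  rwa [← map_sub, WittVector.map_coeff] at h1

lemma pow_dvd_algebraMap_sub {k : ℕ} {w w' : WittVector p (Perfection C p)}
    (h : ∀ i < k, Perfection.coeff C p k (w.coeff i) = Perfection.coeff C p k (w'.coeff i)) :
    (p : Acris C p) ^ k ∣ algebraMap (WittVector p (Perfection C p)) (Acris C p) w
      - algebraMap (WittVector p (Perfection C p)) (Acris C p) w' := by
  rw [← map_sub]
  have := pow_dvd_algebraMap_iterate_frobenius 0 k (w - w')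
    (coeff_sub_coeff_eq_zero (by rwa [zero_add]))
  rwa [zero_add] at this

lemma pow_dvd_polar_sub [IsAddTorsionFree (Acris C p)] (l : ℕ) {k : ℕ}
    {r r' : Perfection C p} (hr : Perfection.coeff C p 0 r = 0)
    (h : Perfection.coeff C p k r = Perfection.coeff C p k r') :
    (p : Acris C p) ^ k ∣ polar l r - polar l r' := by
  have hr' : Perfection.coeff C p 0 r' = 0 := by
    have e : ∀ s : Perfection C p,
        Perfection.coeff C p k s ^ p ^ k = Perfection.coeff C p 0 s :=
      fun s => by rw [← map_pow, coeff_pow_p_pow]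
    rw [← e, ← h, e, hr]
  refine (pow_add_dvd_pow_mul_iff hp.out.ne_zero (N := l)).mp ?_
  rw [mul_sub, pow_mul_polar l r hr, pow_mul_polar l r' hr', ← map_sub, ← iterate_map_sub]
  refine pow_dvd_algebraMap_iterate_frobenius l k _ (coeff_sub_coeff_eq_zero fun i _ => ?_)
  cases i with
  | zero => simpa using h
  | succ i => rw [teichmuller_coeff_pos p r _ i.succ_pos, teichmuller_coeff_pos p r' _ i.succ_pos]

end frobeniusPowers

section fbar

lemma hasSum_polarTerm (x : BarM C p) : ∃ a, HasSum (polarTerm x) a ∧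
    ∀ N, (p : Acris C p) ^ N ∣ a - ∑ i ∈ Finset.range N, polarTerm x i :=
  Acris.exists_hasSum fun i => by rw [polarTerm_eq_polar]; exact pow_dvd_polar i _

lemma summable_polarTerm (x : BarM C p) : Summable (polarTerm x) :=
  (hasSum_polarTerm x).imp fun _ h => h.1

lemma pow_dvd_tsum_polarTerm_sub (x : BarM C p) (N : ℕ) :
    (p : Acris C p) ^ N ∣ ∑' i, polarTerm x i - ∑ i ∈ Finset.range N, polarTerm x i := by
  obtain ⟨a, h1, h2⟩ := hasSum_polarTerm x
  rw [h1.tsum_eq]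
  exact h2 N

lemma NilLim.coeff_eq_zero {s : ℕ → WittVector p (Perfection C p)} {x : ℤ → Perfection C p}
    (h : NilLim s x) (N j : ℕ) (hj : j < N) : Perfection.coeff C p 0 ((s N).coeff j) = 0 := by
  obtain ⟨⟨I, -, h2, h3⟩, -⟩ := h
  exact h2 (h3 N j hj)

/-- The relation `u = lim_N p^{-N} F^N(s_N)` in `A_cris(C)`, stated without division by powers of
`p`. -/
def IsDivFrobLim (s : ℕ → WittVector p (Perfection C p)) (u : Acris C p) : Prop :=
  ∀ M : ℕ, ∀ᶠ N in atTop, (p : Acris C p) ^ (N + M) ∣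
    p ^ N * u - algebraMap _ (Acris C p) (WittVector.frobenius^[N] (s N))

lemma dvd_frob {k : ℕ} {u : Acris C p} (h : (p : Acris C p) ^ k ∣ u) :
    (p : Acris C p) ^ k ∣ Acris.frob u := by
  have := map_dvd Acris.frob h
  rwa [map_pow, map_natCast] at this

namespace IsDivFrobLim

variable {s t : ℕ → WittVector p (Perfection C p)} {u v : Acris C p}

lemma unique [IsAddTorsionFree (Acris C p)] (hu : IsDivFrobLim s u) (hv : IsDivFrobLim s v) :
    u = v := eq_of_forall_pow_dvd_sub (p : Acris C p) fun M => by
  obtain ⟨N, h1, h2⟩ := ((hu M).and (hv M)).exists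
  refine (pow_add_dvd_pow_mul_iff hp.out.ne_zero (N := N)).mp ?_
  convert dvd_sub h1 h2 using 1
  ring

lemma add (hu : IsDivFrobLim s u) (hv : IsDivFrobLim t v) :
    IsDivFrobLim (fun N => s N + t N) (u + v) := fun M => by
  filter_upwards [hu M, hv M] with N h1 h2
  convert dvd_add h1 h2 using 1
  rw [iterate_map_add, map_add]
  ring

lemma smul (a : WittVector p (Perfection C p)) (hu : IsDivFrobLim s u) :
    IsDivFrobLim (fun N => frobInv a N * s N) (a • u) := fun M => by
  filter_upwards [hu M] with N h
  convert h.mul_left (algebraMap _ _ a) using 1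
  rw [iterate_map_mul, map_mul, iterate_frobenius_frobInv, Algebra.smul_def]
  ring

lemma frob (hu : IsDivFrobLim s u) :
    IsDivFrobLim (fun N => WittVector.frobenius (s N)) (Acris.frob u) := fun M => by
  filter_upwards [hu M] with N h
  convert dvd_frob h using 1
  rw [map_sub, map_mul, map_pow, map_natCast, Acris.frob_algebraMap_witt,
    ← Function.iterate_succ_apply' WittVector.frobenius, Function.iterate_succ_apply]

lemma p_mul (hu : IsDivFrobLim s u) :
    IsDivFrobLim (fun N => WittVector.frobenius (s (N + 1))) (p * u) := fun M => by
  filter_upwards [(tendsto_add_atTop_nat 1).eventually (hu M)] with N h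
  convert (pow_dvd_pow _ (by omega : N + M ≤ N + 1 + M)).trans h using 1
  rw [Function.iterate_succ_apply, pow_succ, mul_assoc]

end IsDivFrobLim

section torsionFree

variable [IsAddTorsionFree (Acris C p)]

lemma pow_dvd_fbar_sub_divFrob {w : WittVector p (Perfection C p)} {x : BarM C p} {M N : ℕ}
    (hMN : M ≤ N) (h : ∀ m ∈ Finset.Icc (-(M : ℤ)) M,
      Perfection.coeff C p M (w.coeff (m + N).toNat) = Perfection.coeff C p M (x.1 m)) :
    (p : Acris C p) ^ M ∣ fbar x - divFrob N w := by
  have polar_part (i : ℕ) (hi : i < N) :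
      (p : Acris C p) ^ M ∣ polarTerm x i - polar (i + 1) (w.coeff (N - 1 - i)) := by
    rw [polarTerm_eq_polar]
    rcases lt_or_ge i M with hiM | hiM
    · refine pow_dvd_polar_sub _ (x.2.1 _ (by omega)) ?_
      rw [← h _ (by rw [Finset.mem_Icc]; omega)]
      congr 2
      omega
    · exact (pow_dvd_pow _ hiM).trans (dvd_sub (pow_dvd_polar i _) (pow_dvd_polar i _))
  rw [fbar, divFrob, add_sub_add_comm]
  refine dvd_add (pow_dvd_algebraMap_sub fun i hi => ?_) ?_
  · rw [coeff_mk, coeff_mk, ← h i (by rw [Finset.mem_Icc]; omega)]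
    congr 2
  · rw [← sub_add_sub_cancel _ (∑ i ∈ Finset.range N, polarTerm x i), ← Finset.sum_sub_distrib]
    exact dvd_add ((pow_dvd_pow _ hMN).trans (pow_dvd_tsum_polarTerm_sub x N))
      (Finset.dvd_sum fun i hi => polar_part i (Finset.mem_range.mp hi))

lemma isDivFrobLim_fbar {s : ℕ → WittVector p (Perfection C p)} {x : BarM C p}
    (hs : NilLim s x.1) : IsDivFrobLim s (fbar x) := fun M => by
  have hcoeff : ∀ᶠ N : ℕ in atTop, ∀ m ∈ Finset.Icc (-(M : ℤ)) M,
      Perfection.coeff C p M ((s N).coeff (m + N).toNat) = Perfection.coeff C p M (x.1 m) := by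
    rw [Filter.eventually_all_finset]
    exact fun m _ => hs.2 M m
  filter_upwards [hcoeff, eventually_ge_atTop M] with N h hN
  rw [← pow_mul_divFrob N _ (hs.coeff_eq_zero N), ← mul_sub,
    pow_add_dvd_pow_mul_iff hp.out.ne_zero]
  exact pow_dvd_fbar_sub_divFrob hN h

lemma fbar_add (x y : BarM C p) : fbar (x + y) = fbar x + fbar y :=
  (isDivFrobLim_fbar (BarM.spec_add (nilLim_trunc x) (nilLim_trunc y))).unique
    ((isDivFrobLim_fbar (nilLim_trunc x)).add (isDivFrobLim_fbar (nilLim_trunc y)))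

lemma fbar_smul (a : WittVector p (Perfection C p)) (x : BarM C p) :
    fbar (a • x) = a • fbar x :=
  (isDivFrobLim_fbar (BarM.spec_smul a (nilLim_trunc x))).unique
    ((isDivFrobLim_fbar (nilLim_trunc x)).smul a)

end torsionFree

lemma trunc_frob (x : BarM C p) (N : ℕ) :
    trunc (BarM.frob x).1 N = WittVector.frobenius (trunc x.1 N) := by
  ext1 i
  rw [coeff_frobenius_charP]
  rfl

/-- The operator `V` on `M̄(C)`, `∑ V^m [x_m] ↦ ∑ V^{m+1} [x_m]`. -/
def BarM.ver (x : BarM C p) : BarM C p :=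
  ⟨fun m => x.1 (m - 1), fun m hm => x.2.1 _ (by omega), x.2.2.mono (Ideal.span_mono (by
    rintro _ ⟨m, hm, rfl⟩
    rw [Set.mem_Iio] at hm
    exact ⟨m - 1, by rw [Set.mem_Iio]; omega, rfl⟩))⟩

lemma BarM.iterate_ver_apply (M : ℕ) (x : BarM C p) (m : ℤ) :
    (BarM.ver^[M] x).1 m = x.1 (m - M) := by
  induction M generalizing m with
  | zero => rw [Function.iterate_zero_apply, Nat.cast_zero, sub_zero]
  | succ M ih =>
    rw [Function.iterate_succ_apply']
    change (BarM.ver^[M] x).1 (m - 1) = _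
    rw [ih, Nat.cast_succ, sub_sub, add_comm (1 : ℤ)]

lemma trunc_ver (x : BarM C p) (N : ℕ) : trunc (BarM.ver x).1 N = trunc x.1 (N + 1) := by
  ext1 i
  simp only [trunc, BarM.ver, coeff_mk]
  push_cast
  ring_nf

section torsionFree

variable [IsAddTorsionFree (Acris C p)]

lemma fbar_frob (x : BarM C p) : fbar (BarM.frob x) = Acris.frob (fbar x) := by
  refine (isDivFrobLim_fbar (nilLim_trunc (BarM.frob x))).unique ?_
  rw [funext (trunc_frob x)]
  exact (isDivFrobLim_fbar (nilLim_trunc x)).frob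

lemma p_mul_fbar (x : BarM C p) : p * fbar x = Acris.frob (fbar (BarM.ver x)) := by
  refine (isDivFrobLim_fbar (nilLim_trunc x)).p_mul.unique ?_
  simpa only [trunc_ver] using (isDivFrobLim_fbar (nilLim_trunc (BarM.ver x))).frob

lemma pow_mul_fbar (m : ℕ) (x : BarM C p) :
    (p : Acris C p) ^ m * fbar x = Acris.frob^[m] (fbar (BarM.ver^[m] x)) := by
  induction m generalizing x with
  | zero => simp
  | succ m ih =>
    rw [pow_succ, mul_assoc, p_mul_fbar, Function.iterate_succ_apply', ← map_natCast Acris.frob,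
      ← map_pow, ← map_mul, ih, Function.iterate_succ_apply]

variable (C p) in
/-- The map `f̄`, corestricted to `A'_cris(C)`, as a homomorphism of `W(C^♭)`-modules. -/
def fbarHom : BarM C p →ₗ[WittVector p (Perfection C p)] Acris.prime C p where
  toFun x := ⟨fbar x, fun m => ⟨_, pow_mul_fbar m x⟩⟩
  map_add' x y := Subtype.ext (fbar_add x y)
  map_smul' a x := Subtype.ext (fbar_smul a x)

end torsionFree

end fbar

end general

noncomputable section exponents

variable {p : ℕ}

lemma PExp.ext {a b : PExp p} (h : (a : ℚ≥0) = b) : a = b := Subtype.ext h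

lemma PExp.coe_nsmul (k : ℕ) (a : PExp p) : ((k • a : PExp p) : ℚ≥0) = k * a := by
  rw [AddSubmonoidClass.coe_nsmul, nsmul_eq_mul]

lemma PExp.coe_add (a b : PExp p) : ((a + b : PExp p) : ℚ≥0) = a + b := rfl

/-- The integral part of an exponent in `ℤ_+[1/p]`. -/
def PExp.floor (a : PExp p) : ℕ := ⌊(a : ℚ≥0)⌋₊

/-- The fractional part of an exponent in `ℤ_+[1/p]`. -/
def PExp.fract (a : PExp p) : PExp p :=
  ⟨a - ⌊(a : ℚ≥0)⌋₊, by
    obtain ⟨j, m, h⟩ := a.2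
    obtain ⟨c, hc⟩ := exists_add_of_le (Nat.floor_le (zero_le (a := (a : ℚ≥0))))
    generalize ⌊(a : ℚ≥0)⌋₊ = f at hc ⊢
    rw [hc, add_tsub_cancel_left]
    rw [hc] at h
    refine ⟨j, m - f * p ^ j, ?_⟩
    have : f * p ^ j ≤ m := by
      rw [← Nat.cast_le (α := ℚ≥0), ← h, add_mul]
      push_cast
      exact le_self_add
    rw [Nat.cast_tsub, ← h]
    push_cast
    rw [add_mul, add_tsub_cancel_left]⟩

lemma PExp.floor_add_fract (a : PExp p) : PExp.floor a • PExp.one p + PExp.fract a = a := by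
  refine PExp.ext ?_
  rw [PExp.coe_add, PExp.coe_nsmul]
  change (⌊(a : ℚ≥0)⌋₊ : ℚ≥0) * 1 + ((a : ℚ≥0) - ⌊(a : ℚ≥0)⌋₊) = a
  rw [mul_one, add_tsub_cancel_of_le (Nat.floor_le zero_le)]

lemma PExp.floor_add_nsmul (a : PExp p) (k : ℕ) :
    PExp.floor (a + k • PExp.one p) = PExp.floor a + k := by
  rw [PExp.floor, PExp.coe_add, PExp.coe_nsmul]
  change ⌊(a : ℚ≥0) + k * 1⌋₊ = _
  rw [mul_one, Nat.floor_add_natCast zero_le]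
  rfl

lemma PExp.fract_add_nsmul (a : PExp p) (k : ℕ) :
    PExp.fract (a + k • PExp.one p) = PExp.fract a := by
  have h := PExp.floor_add_fract (a + k • PExp.one p)
  rw [PExp.floor_add_nsmul] at h
  conv_rhs at h => rw [← PExp.floor_add_fract a]
  rw [add_nsmul, add_right_comm _ (k • PExp.one p), add_right_comm _ _ (k • PExp.one p)] at h
  refine PExp.ext ?_
  have hcoe := congrArg (Subtype.val (p := fun q => q ∈ PExp p)) h
  simp only [PExp.coe_add] at hcoe
  rw [add_right_comm] at hcoe
  exact add_left_cancel (add_right_cancel hcoe)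

/-- The monoid of exponents `ℤ_+[1/p]^n`. -/
abbrev Expo (p n : ℕ) : Type := Fin n → PExp p

namespace Expo

variable {n : ℕ}

lemma ext {α β : Expo p n} (h : ∀ i, (α i : ℚ≥0) = β i) : α = β :=
  funext fun i => PExp.ext (h i)

/-- The exponent of the monomial `∏ x_i ^ k_i`. -/
def ofNat (k : Fin n → ℕ) : Expo p n := fun i => k i • PExp.one p

/-- The coordinatewise integral part of an exponent. -/
def floor (α : Expo p n) : Fin n → ℕ := fun i => PExp.floor (α i)

/-- The coordinatewise fractional part of an exponent. -/
def fract (α : Expo p n) : Expo p n := fun i => PExp.fract (α i)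

lemma floor_add_fract (α : Expo p n) : ofNat α.floor + α.fract = α :=
  funext fun i => PExp.floor_add_fract (α i)

lemma floor_add_ofNat (α : Expo p n) (k : Fin n → ℕ) : (α + ofNat k).floor = α.floor + k :=
  funext fun i => PExp.floor_add_nsmul (α i) (k i)

lemma fract_add_ofNat (α : Expo p n) (k : Fin n → ℕ) : (α + ofNat k).fract = α.fract :=
  funext fun i => PExp.fract_add_nsmul (α i) (k i)

lemma ofNat_add (k l : Fin n → ℕ) : (ofNat (k + l) : Expo p n) = ofNat k + ofNat l :=
  funext fun i => add_nsmul _ (k i) (l i)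

lemma ofNat_eq_sum (k : Fin n → ℕ) :
    (ofNat k : Expo p n) = ∑ i, k i • (Pi.single i (PExp.one p) : Expo p n) := by
  funext j
  simp only [Finset.sum_apply, Pi.smul_apply]
  rw [Finset.sum_eq_single j]
  · simp [ofNat]
  · intro i _ hij; rw [Pi.single_eq_of_ne hij.symm, smul_zero]
  · simp

/-- The total degree of an exponent. -/
def deg : Expo p n →+ ℚ≥0 where
  toFun α := ∑ i, (α i : ℚ≥0)
  map_zero' := by simp
  map_add' α β := by rw [← Finset.sum_add_distrib]; rfl

lemma coe_le_deg (α : Expo p n) (i : Fin n) : (α i : ℚ≥0) ≤ deg α :=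
  Finset.single_le_sum (f := fun i => (α i : ℚ≥0)) (fun _ _ => zero_le) (Finset.mem_univ i)

lemma exists_le_coe_of_le_deg {α : Expo p n} {c : ℚ≥0} (hc : n * c < deg α) :
    ∃ i, c ≤ (α i : ℚ≥0) := by
  by_contra! h
  have : deg α ≤ ∑ _i : Fin n, c := Finset.sum_le_sum fun i _ => (h i).le
  rw [Finset.sum_const, Finset.card_univ, Fintype.card_fin, nsmul_eq_mul] at this
  exact absurd hc this.not_gt

lemma exists_add_single {α : Expo p n} {i : Fin n} (h : 1 ≤ (α i : ℚ≥0)) :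
    ∃ β : Expo p n, α = β + Pi.single i (PExp.one p) := by
  have h1 : 1 ≤ α.floor i := by
    change 1 ≤ ⌊(α i : ℚ≥0)⌋₊
    exact (Nat.one_le_floor_iff _).mpr h
  refine ⟨α.fract + ofNat (α.floor - Pi.single i 1), ?_⟩
  have h2 : (Pi.single i (PExp.one p) : Expo p n) = ofNat (Pi.single i 1) := by
    funext j
    rcases eq_or_ne j i with rfl | hj
    · simp [ofNat]
    · simp [ofNat, hj]
  rw [h2, add_assoc, ← ofNat_add]
  conv_lhs => rw [← floor_add_fract α, add_comm]
  congr 2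
  funext j
  rcases eq_or_ne j i with rfl | hj
  · simp only [Pi.add_apply, Pi.sub_apply, Pi.single_eq_same]; omega
  · simp [hj]

end Expo

variable [hp : Fact p.Prime]

lemma natCast_p_pow_ne_zero (k : ℕ) : (p : ℚ≥0) ^ k ≠ 0 :=
  pow_ne_zero _ (Nat.cast_ne_zero.mpr hp.out.ne_zero)

/-- Division by `p ^ k` on `ℤ_+[1/p]`. -/
def PExp.div (k : ℕ) : PExp p →+ PExp p where
  toFun a := ⟨a / p ^ k, by
    obtain ⟨j, m, h⟩ := a.2
    refine ⟨k + j, m, ?_⟩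
    rw [pow_add, ← mul_assoc, div_mul_cancel₀ _ (natCast_p_pow_ne_zero k), h]⟩
  map_zero' := PExp.ext (zero_div _)
  map_add' a b := PExp.ext (add_div _ _ _)

namespace Expo

variable {n : ℕ}

/-- Division by `p ^ k` on exponents. -/
def div (k : ℕ) : Expo p n →+ Expo p n where
  toFun α i := PExp.div k (α i)
  map_zero' := funext fun _ => map_zero _
  map_add' _ _ := funext fun _ => map_add _ _ _

lemma coe_div (k : ℕ) (α : Expo p n) (i : Fin n) : (div k α i : ℚ≥0) = α i / p ^ k := rfl

lemma nsmul_div (k : ℕ) (α : Expo p n) : p ^ k • div k α = α := ext fun i => by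
  rw [Pi.smul_apply, PExp.coe_nsmul, coe_div, Nat.cast_pow,
    mul_div_cancel₀ _ (natCast_p_pow_ne_zero k)]

lemma div_nsmul (k : ℕ) (α : Expo p n) : div k (p ^ k • α) = α := ext fun i => by
  rw [coe_div, Pi.smul_apply, PExp.coe_nsmul, Nat.cast_pow,
    mul_div_cancel_left₀ _ (natCast_p_pow_ne_zero k)]

lemma div_zero' (α : Expo p n) : div 0 α = α := ext fun i => by
  rw [coe_div, pow_zero, div_one]

lemma div_div (k l : ℕ) (α : Expo p n) : div k (div l α) = div (l + k) α := ext fun i => by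
  rw [coe_div, coe_div, coe_div, _root_.div_div, pow_add]

lemma nsmul_div_succ (k : ℕ) (α : Expo p n) : p • div (k + 1) α = div k α := by
  refine ext fun i => ?_
  rw [Pi.smul_apply, PExp.coe_nsmul, coe_div, coe_div, pow_succ', ← mul_div_assoc]
  exact mul_div_mul_left _ _ (Nat.cast_ne_zero.mpr hp.out.ne_zero)

lemma deg_div (k : ℕ) (α : Expo p n) : deg (div k α) = deg α / p ^ k := by
  change ∑ i, (α i : ℚ≥0) / p ^ k = (∑ i, (α i : ℚ≥0)) / p ^ k
  rw [Finset.sum_div]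

end Expo

end exponents

noncomputable section tilt

variable {B : Type*} [CommRing B] {p n : ℕ}

variable (B p n) in
/-- The ring `C = B[x_1^{p^{-∞}}, …, x_n^{p^{-∞}}] / (x_1, …, x_n)`. It is a separate definition so
that unification does not unfold its ring structure. -/
def KeyQuot : Type _ := KeyRing B p n

instance : CommRing (KeyQuot B p n) := inferInstanceAs (CommRing (KeyRing B p n))

variable (B p n) in
/-- The projection to `C`. -/
def keyMk : PerfPoly B p n →+* KeyQuot B p n :=
  Ideal.Quotient.mk (Ideal.span (Set.range (PerfPoly.X B p n)))

lemma keyMk_surjective : Function.Surjective (keyMk B p n) := Ideal.Quotient.mk_surjective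

lemma keyMk_eq_zero_iff {y : PerfPoly B p n} :
    keyMk B p n y = 0 ↔ y ∈ Ideal.span (Set.range (PerfPoly.X B p n)) :=
  Ideal.Quotient.eq_zero_iff_mem

variable [hp : Fact p.Prime] [CharP B p]

instance : CharP (KeyQuot B p n) p := inferInstanceAs (CharP (KeyRing B p n) p)

variable (B p n) in
/-- The tilt `C^♭` of `C = B[x_1^{p^{-∞}}, …, x_n^{p^{-∞}}] / (x_1, …, x_n)`. -/
abbrev KeyTilt : Type _ := Perfection (KeyQuot B p n) p

variable [PerfectRing B p]

/-- The `p ^ k`-th root on the perfect ring `B`. -/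
def rootB (k : ℕ) : B →+* B := ((frobeniusEquiv B p).symm : B →+* B) ^ k

lemma rootB_zero (b : B) : rootB (p := p) 0 b = b := rfl

lemma rootB_succ_pow (k : ℕ) (b : B) : rootB (p := p) (k + 1) b ^ p = rootB (p := p) k b := by
  rw [rootB, pow_succ', RingHom.mul_def, RingHom.comp_apply]
  exact frobeniusEquiv_symm_pow_p _ _ _

lemma rootB_pow (k : ℕ) (b : B) : rootB (p := p) k b ^ p ^ k = b := by
  induction k with
  | zero => rw [pow_zero, pow_one, rootB_zero]
  | succ k ih => rw [pow_succ', pow_mul, rootB_succ_pow, ih]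

/-- The element `b x^α` of `C^♭`. -/
def mono (b : B) (α : Expo p n) : KeyTilt B p n :=
  ⟨fun k => keyMk B p n (AddMonoidAlgebra.single (Expo.div k α) (rootB (p := p) k b)),
    fun k => by
      rw [← map_pow, AddMonoidAlgebra.single_pow, Expo.nsmul_div_succ, rootB_succ_pow]⟩

lemma coeff_mono (k : ℕ) (b : B) (α : Expo p n) :
    Perfection.coeff _ p k (mono b α) =
      keyMk B p n (AddMonoidAlgebra.single (Expo.div k α) (rootB (p := p) k b)) := rfl

lemma mono_add_left (b b' : B) (α : Expo p n) : mono (b + b') α = mono b α + mono b' α :=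
  Perfection.ext fun k => by
    rw [map_add, coeff_mono, coeff_mono, coeff_mono, ← map_add, ← AddMonoidAlgebra.single_add,
      map_add]

lemma mono_zero_left (α : Expo p n) : mono (0 : B) α = 0 :=
  Perfection.ext fun k => by
    rw [coeff_mono, map_zero, AddMonoidAlgebra.single_zero, map_zero, map_zero]

lemma mono_mul (b b' : B) (α α' : Expo p n) : mono b α * mono b' α' = mono (b * b') (α + α') :=
  Perfection.ext fun k => by
    rw [map_mul, coeff_mono, coeff_mono, coeff_mono, ← map_mul, AddMonoidAlgebra.single_mul_single,
      map_add, map_mul]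

lemma mono_one : mono (1 : B) (0 : Expo p n) = 1 := Perfection.ext fun k => by
  rw [coeff_mono, map_zero, map_one, map_one]; rfl

lemma mono_pow (b : B) (α : Expo p n) (m : ℕ) : mono b α ^ m = mono (b ^ m) (m • α) := by
  induction m with
  | zero => rw [pow_zero, pow_zero, zero_nsmul, mono_one]
  | succ m ih => rw [pow_succ, ih, mono_mul, pow_succ, succ_nsmul]

variable (B p n) in
/-- The embedding of the constants in `C^♭`. -/
def constHom : B →+* KeyTilt B p n where
  toFun b := mono b 0
  map_one' := mono_one
  map_mul' b b' := by rw [mono_mul, add_zero]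
  map_zero' := mono_zero_left 0
  map_add' b b' := mono_add_left b b' 0

variable (B p n) in
/-- The homomorphism `B[x_1^{p^{-∞}}, …, x_n^{p^{-∞}}] → C^♭`. -/
def polyHom : PerfPoly B p n →+* KeyTilt B p n :=
  AddMonoidAlgebra.liftNCRingHom (constHom B p n)
    { toFun := fun α => mono 1 α.toAdd
      map_one' := mono_one
      map_mul' := fun α β => by rw [mono_mul, one_mul, toAdd_mul] } fun _ _ => by
      unfold Commute SemiconjBy; exact mul_comm (constHom B p n _) _

lemma polyHom_single (α : Expo p n) (b : B) :
    polyHom B p n (AddMonoidAlgebra.single α b) = mono b α := by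
  rw [polyHom, AddMonoidAlgebra.liftNCRingHom_single]
  change mono b 0 * mono 1 α = _
  rw [mono_mul, mul_one, zero_add]

lemma polyHom_eq_sum (y : PerfPoly B p n) :
    polyHom B p n y = ∑ α ∈ y.coeff.support, mono (y.coeff α) α := by
  conv_lhs => rw [← AddMonoidAlgebra.sum_coeff_single y, Finsupp.sum, map_sum]
  exact Finset.sum_congr rfl fun α _ => polyHom_single _ _

lemma coeff_zero_polyHom (y : PerfPoly B p n) :
    Perfection.coeff _ p 0 (polyHom B p n y) = keyMk B p n y := by
  induction y using AddMonoidAlgebra.induction_linear with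
  | zero => rw [map_zero, map_zero, map_zero]
  | add x y hx hy => rw [map_add, map_add, map_add, hx, hy]
  | single α b => rw [polyHom_single, coeff_mono, Expo.div_zero', rootB_zero]

lemma exists_coeff_polyHom_eq (k : ℕ) (r : KeyTilt B p n) :
    ∃ y, Perfection.coeff _ p k (polyHom B p n (y ^ p ^ k)) = Perfection.coeff _ p k r := by
  obtain ⟨y, hy⟩ := keyMk_surjective (Perfection.coeff _ p k r)
  exact ⟨y, by rw [map_pow, coeff_pow_p_pow, coeff_zero_polyHom, hy]⟩

variable (B p n) in
/-- The element `x_i` of `C^♭`. -/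
def tiltX (i : Fin n) : KeyTilt B p n := mono 1 (Pi.single i (PExp.one p))

lemma coeff_zero_tiltX (i : Fin n) : Perfection.coeff _ p 0 (tiltX B p n i) = 0 := by
  rw [tiltX, coeff_mono, Expo.div_zero', rootB_zero, keyMk_eq_zero_iff]
  exact Ideal.subset_span ⟨i, rfl⟩

lemma coeff_mono_eq_zero {k : ℕ} {α : Expo p n} {i : Fin n} (h : (p : ℚ≥0) ^ k ≤ α i) (b : B) :
    Perfection.coeff _ p k (mono b α) = 0 := by
  obtain ⟨β, hβ⟩ := Expo.exists_add_single (α := Expo.div k α) (i := i) (by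
    rw [Expo.coe_div, one_le_div (pow_pos (Nat.cast_pos.mpr hp.out.pos) _)]; exact h)
  have h1 : (AddMonoidAlgebra.single (Pi.single i (PExp.one p) : Expo p n) (1 : B)) ∈
      Ideal.span (Set.range (PerfPoly.X B p n)) := Ideal.subset_span ⟨i, rfl⟩
  rw [coeff_mono, hβ, ← mul_one (rootB k b), ← AddMonoidAlgebra.single_mul_single, map_mul,
    keyMk_eq_zero_iff.mpr h1, mul_zero]

lemma polyHom_mem_span {y : PerfPoly B p n}
    (hy : y ∈ Ideal.span (Set.range (PerfPoly.X B p n))) :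
    polyHom B p n y ∈ Ideal.span (Set.range (tiltX B p n)) := by
  have := Ideal.mem_map_of_mem (polyHom B p n) hy
  rw [Ideal.map_span, ← Set.range_comp] at this
  convert this using 3
  funext i
  exact (polyHom_single _ _).symm

lemma exists_coeff_eq_coeff_sum_range {C : Type*} [CommRing C] [CharP C p] (t : ℕ → Perfection C p)
    (ht : ∀ j k, j < k → Perfection.coeff C p j (t k) = 0) :
    ∃ s : Perfection C p, ∀ j m, j < m → Perfection.coeff C p j s =
      Perfection.coeff C p j (∑ k ∈ Finset.range m, t k) := by
  have h : ∀ j m, j < m → Perfection.coeff C p j (∑ k ∈ Finset.range m, t k) =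
      Perfection.coeff C p j (∑ k ∈ Finset.range (j + 1), t k) := by
    intro j m hm
    induction m, Nat.succ_le_of_lt hm using Nat.le_induction with
    | base => rfl
    | succ m hm' ih =>
      rw [Finset.sum_range_succ, map_add, ih (Nat.lt_of_succ_le hm'), ht j m (by omega), add_zero]
  refine ⟨⟨fun j => Perfection.coeff C p j (∑ k ∈ Finset.range (j + 1), t k), fun j => ?_⟩,
    fun j m hm => (h j m hm).symm⟩
  rw [Perfection.coeff_pow_p', h j _ (by omega)]

lemma coeff_zero_eq_zero_of_coeff {C : Type*} [CommRing C] [CharP C p] {k : ℕ} {r : Perfection C p}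
    (h : Perfection.coeff C p k r = 0) : Perfection.coeff C p 0 r = 0 := by
  rw [← coeff_pow_p_pow k, map_pow, h, zero_pow (pow_pos hp.out.pos _).ne']

lemma exists_eq_sum_add_pow (r : KeyTilt B p n) (hr : Perfection.coeff _ p 0 r = 0) :
    ∃ (a : Fin n → KeyTilt B p n) (s : KeyTilt B p n), Perfection.coeff _ p 0 s = 0 ∧
      r = ∑ i, tiltX B p n i * a i + s ^ p := by
  obtain ⟨y, hy⟩ := exists_coeff_polyHom_eq 1 r
  rw [pow_one] at hy
  have h1 : Perfection.coeff _ p 1 (r - polyHom B p n (y ^ p)) = 0 := by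
    rw [map_sub, hy, sub_self]
  have h2 := coeff_zero_eq_zero_of_coeff h1
  rw [map_sub, hr, zero_sub, neg_eq_zero, coeff_zero_polyHom, keyMk_eq_zero_iff] at h2
  obtain ⟨a, ha⟩ := Submodule.mem_span_range_iff_exists_fun _ |>.mp (polyHom_mem_span h2)
  have hs : Perfection.pthRoot _ p (r - polyHom B p n (y ^ p)) ^ p = r - polyHom B p n (y ^ p) :=
    congrArg (fun f => f (r - polyHom B p n (y ^ p)))
      (Perfection.frobenius_pthRoot (R := KeyQuot B p n) (p := p))
  refine ⟨a, Perfection.pthRoot _ p (r - polyHom B p n (y ^ p)), ?_, ?_⟩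
  · rw [← h1, ← hs, Perfection.coeff_pow_p, hs]
  · rw [hs, ← add_sub_assoc, eq_sub_iff_add_eq, ← ha, add_comm r]
    congr 1
    exact Finset.sum_congr rfl fun i _ => mul_comm (a i) _

lemma exists_eq_sum_pow_add_pow {r : KeyTilt B p n} (hr : Perfection.coeff _ p 0 r = 0) :
    ∃ (a : ℕ → Fin n → KeyTilt B p n) (s : ℕ → KeyTilt B p n),
      (∀ m, Perfection.coeff _ p 0 (s m) = 0) ∧
      ∀ m, r = ∑ k ∈ Finset.range m, ∑ i, (tiltX B p n i * a k i) ^ p ^ k + s m ^ p ^ m := by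
  choose! a s hs h using exists_eq_sum_add_pow (B := B) (p := p) (n := n)
  have hs' (k : ℕ) : Perfection.coeff _ p 0 (s^[k] r) = 0 := by
    induction k with
    | zero => exact hr
    | succ k ih => rw [Function.iterate_succ_apply']; exact hs _ ih
  refine ⟨fun k => a (s^[k] r), fun k => s^[k] r, hs', fun m => ?_⟩
  beta_reduce
  induction m with
  | zero => simp
  | succ m ih =>
    rw [Finset.sum_range_succ, add_assoc, Function.iterate_succ_apply']
    conv_lhs => rw [ih, h _ (hs' m), add_pow_char_pow, sum_pow_char_pow, ← pow_mul, ← pow_succ']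

lemma coeff_tiltX_pow_mul {j k : ℕ} (hjk : j < k) (i : Fin n) (c : KeyTilt B p n) :
    Perfection.coeff _ p j (tiltX B p n i ^ (p ^ k - 1) * c) = 0 := by
  have h : p ^ j ≤ p ^ k - 1 := Nat.le_sub_one_of_lt (Nat.pow_lt_pow_right hp.out.one_lt hjk)
  rw [← Nat.add_sub_cancel' h, pow_add, mul_assoc, map_mul, coeff_pow_p_pow, coeff_zero_tiltX,
    zero_mul]

lemma mem_span_tiltX_of_coeff_eq_zero {r : KeyTilt B p n} (hr : Perfection.coeff _ p 0 r = 0) :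
    r ∈ Ideal.span (Set.range (tiltX B p n)) := by
  obtain ⟨a, s, hs, h⟩ := exists_eq_sum_pow_add_pow hr
  choose b hb using fun i => exists_coeff_eq_coeff_sum_range (p := p)
    (fun k => tiltX B p n i ^ (p ^ k - 1) * a k i ^ p ^ k)
    fun j k hjk => coeff_tiltX_pow_mul hjk i _
  have hrb : r = ∑ i, b i * tiltX B p n i := Perfection.ext fun j => by
    conv_lhs => rw [h (j + 1), Finset.sum_comm, map_add]
    rw [pow_succ', pow_mul, coeff_pow_p_pow, map_pow, hs, zero_pow hp.out.ne_zero,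
      add_zero, map_sum, map_sum]
    refine Finset.sum_congr rfl fun i _ => ?_
    rw [mul_comm, map_mul, hb i j (j + 1) (by omega), ← map_mul, Finset.mul_sum]
    congr 1
    refine Finset.sum_congr rfl fun k _ => ?_
    rw [mul_pow, ← mul_assoc, mul_pow_sub_one (pow_pos hp.out.pos _).ne']
  rw [hrb]
  exact Ideal.sum_mem _ fun i _ => Ideal.mul_mem_left _ _ (Ideal.subset_span ⟨i, rfl⟩)

lemma topNilpotent_span_tiltX : TopNilpotent (Ideal.span (Set.range (tiltX B p n))) := by
  intro k
  refine Ideal.exists_pow_le_of_le_radical_of_fg (Ideal.span_le.mpr ?_)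
    ⟨(Set.finite_range (tiltX B p n)).toFinset, by simp⟩
  rintro _ ⟨i, rfl⟩
  exact ⟨p ^ k, by rw [RingHom.mem_ker, coeff_pow_p_pow, coeff_zero_tiltX]⟩

variable (B p n) in
/-- The Teichmüller lift `[x_i]`, as an element of the kernel of `W(C^♭) → C`. -/
def teichX (i : Fin n) : thetaKer (KeyQuot B p n) p :=
  ⟨teichmuller p (tiltX B p n i), teichmuller_mem_thetaKer _ (coeff_zero_tiltX i)⟩

lemma p_mem_thetaKer {C : Type*} [CommRing C] [CharP C p] :
    (p : WittVector p (Perfection C p)) ∈ thetaKer C p := by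
  rw [thetaKer, RingHom.mem_ker, map_natCast, CharP.cast_eq_zero]

lemma p_dvd_of_coeff_zero {R : Type*} [CommRing R] [CharP R p] [PerfectRing R p]
    {w : WittVector p R} (h : w.coeff 0 = 0) : (p : WittVector p R) ∣ w := by
  rw [← Ideal.mem_span_singleton]
  exact (mem_span_p_iff_coeff_zero_eq_zero w).mpr h

lemma p_dvd_sub_of_coeff_zero_eq {R : Type*} [CommRing R] [CharP R p] [PerfectRing R p]
    {v w : WittVector p R} (h : v.coeff 0 = w.coeff 0) : (p : WittVector p R) ∣ v - w := by
  refine p_dvd_of_coeff_zero ?_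
  have := add_coeff_zero' (v - w) w
  rw [sub_add_cancel, h] at this
  exact right_eq_add.mp this

lemma coeff_zero_sum {R ι : Type*} [CommRing R] (s : Finset ι) (w : ι → WittVector p R) :
    (∑ i ∈ s, w i).coeff 0 = ∑ i ∈ s, (w i).coeff 0 :=
  map_sum (constantCoeff (p := p) (R := R)) w s

lemma exists_eq_sum_teichX (w : thetaKer (KeyQuot B p n) p) :
    ∃ (a : Fin n → WittVector p (KeyTilt B p n)) (c : WittVector p (KeyTilt B p n)),
      w = ∑ i, a i • teichX B p n i + c • ⟨(p : WittVector p (KeyTilt B p n)), p_mem_thetaKer⟩ := by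
  have hw : Perfection.coeff _ p 0 ((w : WittVector p (KeyTilt B p n)).coeff 0) = 0 := w.2
  obtain ⟨a, ha⟩ := Submodule.mem_span_range_iff_exists_fun _ |>.mp
    (mem_span_tiltX_of_coeff_eq_zero hw)
  obtain ⟨c, hc⟩ := p_dvd_sub_of_coeff_zero_eq (p := p) (v := (w : WittVector p (KeyTilt B p n)))
    (w := ∑ i, teichmuller p (a i) * teichmuller p (tiltX B p n i)) (by
      rw [coeff_zero_sum, ← ha]
      exact Finset.sum_congr rfl fun i _ => by
        rw [mul_coeff_zero, teichmuller_coeff_zero, teichmuller_coeff_zero, smul_eq_mul])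
  refine ⟨fun i => teichmuller p (a i), c, Subtype.ext ?_⟩
  rw [Submodule.coe_add, Submodule.coe_sum, Submodule.coe_smul]
  simp only [Submodule.coe_smul, smul_eq_mul]
  rw [mul_comm c, ← hc]
  exact (add_sub_cancel _ _).symm

end tilt

section thetaLift
variable {p : ℕ} [hp : Fact p.Prime]

lemma exists_ringHom_teichmuller_eq {C T : Type*} [CommRing C] [CharP C p] [CommRing T]
    [Fact ¬IsUnit (p : T)] [IsAdicComplete (Ideal.span {(p : T)}) T] (f : C →+* ModP T p) :
    ∃ g : WittVector p (Perfection C p) →+* T, ∀ (r : Perfection C p) (y : ℕ → T),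
      (∀ k, y k ^ p ^ k = y 0) →
      (∀ k, Ideal.Quotient.mk (Ideal.span {(p : T)}) (y k) = f (Perfection.coeff C p (k + 1) r)) →
        g (teichmuller p r) = y 0 := by
  let h : Perfection C p →+* PreTilt T p := (Perfection.map p f).comp (Perfection.pthRoot C p)
  refine ⟨(fontaineTheta T p).comp (WittVector.map h), fun r y h1 h2 => ?_⟩
  rw [RingHom.comp_apply, map_teichmuller, fontaineTheta_teichmuller]
  exact Perfection.teichmuller_spec fun k => ⟨y k, h2 k, by rw [h1 k]⟩

lemma ringHom_ext_teichmuller {R T : Type*} [CommRing R] [CharP R p] [PerfectRing R p] [CommRing T]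
    [IsHausdorff (Ideal.span {(p : T)}) T] (f g : WittVector p R →+* T)
    (h : ∀ r, f (teichmuller p r) = g (teichmuller p r)) : f = g := by
  ext1 w
  refine eq_of_forall_pow_dvd_sub (p : T) fun m => ?_
  have := WittVector.eq_of_apply_teichmuller_eq
    ((Ideal.Quotient.mk (Ideal.span {(p : T) ^ m})).comp f)
    ((Ideal.Quotient.mk (Ideal.span {(p : T) ^ m})).comp g)
    ⟨m, by
      rw [← map_natCast (Ideal.Quotient.mk (Ideal.span {(p : T) ^ m})), ← map_pow,
        Ideal.Quotient.eq_zero_iff_mem]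
      exact Ideal.mem_span_singleton_self _⟩
    fun r => by rw [RingHom.comp_apply, RingHom.comp_apply, h]
  have := congrArg (fun f => f w) this
  exact Ideal.mem_span_singleton.mp (Ideal.Quotient.eq.mp this)

end thetaLift

section torsionFreeDP
open scoped Nat
variable {S : Type*} [CommRing S]

/-- The element `x` has divided powers `x ^ m / m!`; they are unique if `S` is torsion free. -/
def HasDP (x : S) : Prop := ∀ m : ℕ, (m ! : S) ∣ x ^ m

lemma HasDP.add {x y : S} (hx : HasDP x) (hy : HasDP y) : HasDP (x + y) := fun m => by
  rw [add_pow]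
  refine Finset.dvd_sum fun i hi => ?_
  have hi' : i ≤ m := Nat.lt_succ_iff.mp (Finset.mem_range.mp hi)
  rw [← Nat.choose_mul_factorial_mul_factorial hi', mul_comm (x ^ i * _), mul_assoc]
  push_cast
  exact mul_dvd_mul_left _ (mul_dvd_mul (hx i) (hy _))

lemma HasDP.mul_left {x : S} (a : S) (hx : HasDP x) : HasDP (a * x) := fun m => by
  rw [mul_pow]; exact (hx m).mul_left _

lemma HasDP.zero : HasDP (0 : S) := fun m => by cases m <;> simp

lemma HasDP.sum {ι : Type*} {s : Finset ι} {x : ι → S} (h : ∀ i ∈ s, HasDP (x i)) :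
    HasDP (∑ i ∈ s, x i) :=
  Finset.sum_induction _ HasDP (fun _ _ => HasDP.add) HasDP.zero h

lemma HasDP.map {S' : Type*} [CommRing S'] (f : S →+* S') {x : S} (hx : HasDP x) :
    HasDP (f x) := fun m => by
  have := map_dvd f (hx m)
  rwa [map_natCast, map_pow] at this

lemma PDHull.exists_lift_of_hasDP {p : ℕ} {A : Type*} [CommRing A] {I : Ideal A}
    [IsAddTorsionFree S] (g : A →+* S) (hg : ∀ x ∈ I, HasDP (g x)) :
    ∃ f : PDHull p I →+* S, ∀ a, f (algebraMap A _ a) = g a := by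
  choose d hd using fun (m : ℕ) (x : I) => hg x x.2 m
  have cancel {k : ℕ} (hk : k ≠ 0) {x y : S} (h : (k : S) * x = k * y) : x = y :=
    isLeftRegular_natCast hk h
  have hfac := Nat.factorial_ne_zero
  obtain ⟨f, hf, -⟩ := PDHull.exists_lift (p := p) g d
    (fun x => cancel (hfac 0) (by rw [← hd]; simp))
    (fun x => cancel (hfac 1) (by rw [← hd]; simp))
    (fun m a x => cancel (hfac m) (by
      rw [← hd, mul_left_comm, ← hd, ← mul_pow, ← map_mul]; rfl))
    (fun m k x => cancel (mul_ne_zero (hfac m) (hfac k)) (by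
      have h := hd (m + k) x
      rw [pow_add, hd, hd, ← Nat.add_choose_mul_factorial_mul_factorial] at h
      push_cast at h ⊢
      rw [nsmul_eq_mul, Nat.choose_symm_add]
      linear_combination h))
    (fun m x y => cancel (hfac m) (by
      rw [← hd, Submodule.coe_add, map_add, (Commute.all _ _).add_pow', Finset.mul_sum]
      refine Finset.sum_congr rfl fun k hk => ?_
      rw [Finset.HasAntidiagonal.mem_antidiagonal] at hk
      rw [nsmul_eq_mul, hd, hd, ← hk, Nat.choose_symm_add,
        ← Nat.add_choose_mul_factorial_mul_factorial]
      push_cast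
      ring))
    (fun x hx m a ha => cancel (hfac m) (by
      rw [← hd, hx, map_natCast, ← map_natCast g (m !), ← map_mul, ha, map_pow, map_natCast]))
  exact ⟨f, hf⟩

end torsionFreeDP

noncomputable section dpPoly
open scoped Nat

namespace Expo
variable {p n : ℕ}

/-- The number `⌊α⌋!`, the product of the factorials of the integral parts. -/
def fac (α : Expo p n) : ℕ := ∏ i, (floor α i)!

lemma fac_ne_zero (α : Expo p n) : fac α ≠ 0 :=
  Finset.prod_ne_zero_iff.mpr fun _ _ => Nat.factorial_ne_zero _

lemma floor_zero : floor (0 : Expo p n) = 0 := funext fun i => by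
  change ⌊((0 : PExp p) : ℚ≥0)⌋₊ = 0
  simp

lemma fac_zero : fac (0 : Expo p n) = 1 := by
  rw [fac, floor_zero]
  simp

lemma floor_add_le (α β : Expo p n) (i : Fin n) : floor α i + floor β i ≤ floor (α + β) i := by
  refine Nat.le_floor ?_
  push_cast
  exact add_le_add (Nat.floor_le zero_le) (Nat.floor_le zero_le)

lemma fac_mul_fac_dvd (α β : Expo p n) : fac α * fac β ∣ fac (α + β) := by
  rw [fac, fac, fac, ← Finset.prod_mul_distrib]
  exact Finset.prod_dvd_prod_of_dvd _ _ fun i _ =>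
    (Nat.factorial_mul_factorial_dvd_factorial_add _ _).trans
      (Nat.factorial_dvd_factorial (floor_add_le α β i))

lemma floor_ofNat (k : Fin n → ℕ) : floor (ofNat k : Expo p n) = k := by
  have := floor_add_ofNat (0 : Expo p n) k
  rwa [zero_add, floor_zero, zero_add] at this

end Expo

variable (B : Type*) [CommRing B] (p : ℕ) [hp : Fact p.Prime] (n : ℕ)

/-- The total ring of fractions of `W(B)`. -/
def WFrac : Type _ := FractionRing (WittVector p B)

instance : CommRing (WFrac B p) := inferInstanceAs (CommRing (FractionRing (WittVector p B)))

instance : Algebra (WittVector p B) (WFrac B p) :=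
  inferInstanceAs (Algebra _ (FractionRing (WittVector p B)))

instance : IsFractionRing (WittVector p B) (WFrac B p) :=
  inferInstanceAs (IsFractionRing _ (FractionRing (WittVector p B)))

variable {B p n}

lemma wFrac_algebraMap_injective : Function.Injective (algebraMap (WittVector p B) (WFrac B p)) :=
  IsFractionRing.injective _ _

variable (B p n) in
/-- The divided power polynomial ring `⨁ W(B) x^α / ⌊α⌋!` over the exponents `α ∈ ℤ_+[1/p]^n`. It is
realised among the polynomials over the total ring of fractions of `W(B)`. -/
def DPPoly : Subring (AddMonoidAlgebra (WFrac B p) (Expo p n)) where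
  carrier := {f | ∀ α,
    (Expo.fac α : WFrac B p) * f.coeff α ∈ (algebraMap (WittVector p B) (WFrac B p)).range}
  zero_mem' α := by simp
  one_mem' α := by
    classical
    rw [AddMonoidAlgebra.one_def, AddMonoidAlgebra.coeff_single, Finsupp.single_apply, mul_ite,
      mul_one, mul_zero]
    split_ifs
    exacts [natCast_mem _ _, zero_mem _]
  add_mem' {f g} hf hg α := by
    rw [AddMonoidAlgebra.coeff_add, Finsupp.add_apply, mul_add]
    exact add_mem (hf α) (hg α)
  neg_mem' {f} hf α := by
    rw [AddMonoidAlgebra.coeff_neg, Finsupp.neg_apply, mul_neg]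
    exact neg_mem (hf α)
  mul_mem' {f g} hf hg γ := by
    classical
    simp only [AddMonoidAlgebra.coeff_mul, Finsupp.sum, Finset.mul_sum, mul_ite, mul_zero]
    refine sum_mem fun α _ => sum_mem fun β _ => ?_
    split_ifs with h
    · have hfac : (Expo.fac γ : WFrac B p) * (f.coeff α * g.coeff β) =
          (Expo.fac γ / (Expo.fac α * Expo.fac β) : ℕ) *
            (Expo.fac α * f.coeff α * (Expo.fac β * g.coeff β)) := by
        subst h
        conv_lhs => rw [← Nat.div_mul_cancel (Expo.fac_mul_fac_dvd α β)]
        push_cast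
        ring
      exact hfac ▸ mul_mem (natCast_mem _ _) (mul_mem (hf α) (hg β))
    · exact zero_mem _

namespace DPPoly

lemma single_mem (α : Expo p n) {c : WFrac B p} {a : WittVector p B}
    (h : algebraMap _ _ a = Expo.fac α * c) :
    AddMonoidAlgebra.single α c ∈ DPPoly B p n := fun β => by
  classical
  rw [AddMonoidAlgebra.coeff_single, Finsupp.single_apply]
  split_ifs with hβ
  · exact ⟨a, by rw [← hβ, h]⟩
  · rw [mul_zero]; exact zero_mem _

/-- The monomial `x^α`. -/
def xMono (α : Expo p n) : DPPoly B p n :=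
  ⟨AddMonoidAlgebra.single α 1, single_mem α (a := Expo.fac α) (by simp)⟩

lemma xMono_add (α β : Expo p n) : xMono (B := B) (α + β) = xMono α * xMono β := by
  refine Subtype.ext ?_
  rw [Subring.coe_mul]
  simp only [xMono, AddMonoidAlgebra.single_mul_single, one_mul]

lemma xMono_zero : xMono (B := B) (0 : Expo p n) = 1 := rfl

lemma xMono_nsmul (m : ℕ) (α : Expo p n) : xMono (B := B) (m • α) = xMono α ^ m := by
  induction m with
  | zero => rw [zero_nsmul, pow_zero, xMono_zero]
  | succ m ih => rw [succ_nsmul, xMono_add, ih, pow_succ]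

lemma natCast_mul_coeff (k : ℕ) (f : DPPoly B p n) (α : Expo p n) :
    ((k * f : DPPoly B p n) : AddMonoidAlgebra (WFrac B p) (Expo p n)).coeff α =
      k * (f : AddMonoidAlgebra (WFrac B p) (Expo p n)).coeff α := by
  rw [← nsmul_eq_mul, AddSubmonoidClass.coe_nsmul, AddMonoidAlgebra.coeff_smul_apply, nsmul_eq_mul]

lemma ext_coeff {f g : DPPoly B p n} (h : ∀ α,
    (f : AddMonoidAlgebra (WFrac B p) (Expo p n)).coeff α =
      (g : AddMonoidAlgebra (WFrac B p) (Expo p n)).coeff α) : f = g :=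
  Subtype.ext (AddMonoidAlgebra.coeff_injective (Finsupp.ext h))

variable (B p n) in
/-- The embedding of the constants `W(B)` in the divided power polynomial ring. -/
def const : WittVector p B →+* DPPoly B p n where
  toFun a := ⟨AddMonoidAlgebra.single 0 (algebraMap _ _ a), single_mem 0 (a := a) (by
    rw [Expo.fac_zero, Nat.cast_one, one_mul])⟩
  map_one' := Subtype.ext (by simp only [map_one]; rfl)
  map_mul' a b := Subtype.ext (by
    rw [Subring.coe_mul]
    simp only [map_mul, AddMonoidAlgebra.single_mul_single, add_zero])
  map_zero' := Subtype.ext (by simp only [map_zero, AddMonoidAlgebra.single_zero]; rfl)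
  map_add' a b := Subtype.ext (by
    rw [Subring.coe_add]
    simp only [map_add, AddMonoidAlgebra.single_add])

end DPPoly

variable [CharP B p] [PerfectRing B p]

lemma isUnit_wFrac_natCast {k : ℕ} (hk : k ≠ 0) : IsUnit (k : WFrac B p) := by
  have h : (k : WittVector p B) ∈ nonZeroDivisors (WittVector p B) :=
    mem_nonZeroDivisors_iff_left.mpr fun x hx =>
      isLeftRegular_natCast hk (hx.trans (mul_zero _).symm)
  have := IsLocalization.map_units (WFrac B p) ⟨_, h⟩
  rwa [map_natCast] at this

namespace DPPoly

/-- The divided monomial `x^α / ⌊α⌋!`. -/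
def dpMono (α : Expo p n) : DPPoly B p n :=
  ⟨AddMonoidAlgebra.single α (Ring.inverse (Expo.fac α : WFrac B p)), single_mem α (a := 1) (by
    rw [map_one, Ring.mul_inverse_cancel _ (isUnit_wFrac_natCast (Expo.fac_ne_zero α))])⟩

lemma fac_mul_dpMono (α : Expo p n) : (Expo.fac α : DPPoly B p n) * dpMono α = xMono α := by
  classical
  refine ext_coeff fun β => ?_
  rw [natCast_mul_coeff]
  simp only [xMono, dpMono, AddMonoidAlgebra.coeff_single, Finsupp.single_apply]
  split_ifs
  · exact Ring.mul_inverse_cancel _ (isUnit_wFrac_natCast (Expo.fac_ne_zero α))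
  · exact mul_zero _

lemma const_mul_dpMono_coeff (a : WittVector p B) (α β : Expo p n) [Decidable (α = β)] :
    ((const B p n a * dpMono α : DPPoly B p n) : AddMonoidAlgebra (WFrac B p) (Expo p n)).coeff β =
      if α = β then algebraMap _ _ a * Ring.inverse (Expo.fac α : WFrac B p) else 0 := by
  rw [Subring.coe_mul]
  simp only [const, dpMono, RingHom.coe_mk, MonoidHom.coe_mk, OneHom.coe_mk]
  rw [AddMonoidAlgebra.single_mul_single, zero_add, AddMonoidAlgebra.coeff_single,
    Finsupp.single_apply]

instance : IsAddTorsionFree (DPPoly B p n) :=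
  isAddTorsionFree_of_natCast_mul_eq_zero fun k f hk h => ext_coeff fun α => by
    have hα := natCast_mul_coeff k f α
    rw [h] at hα
    exact (isUnit_wFrac_natCast hk).mul_right_eq_zero.mp hα.symm

lemma pow_dvd_of_pow_dvd_sum {m : ℕ} {s : Finset (Expo p n)} {a : Expo p n → WittVector p B}
    (h : (p : DPPoly B p n) ^ m ∣ ∑ α ∈ s, const B p n (a α) * dpMono α) :
    ∀ α ∈ s, (p : WittVector p B) ^ m ∣ a α := by
  classical
  intro α hα
  obtain ⟨t, ht⟩ := h
  obtain ⟨b, hb⟩ := t.2 α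
  refine ⟨b, wFrac_algebraMap_injective ?_⟩
  have hcoeff := congrArg (fun f : DPPoly B p n => (Expo.fac α : WFrac B p) *
    (f : AddMonoidAlgebra (WFrac B p) (Expo p n)).coeff α) ht
  beta_reduce at hcoeff
  rw [AddSubmonoidClass.coe_finsetSum, AddMonoidAlgebra.coeff_sum,
    Finsupp.finsetSum_apply] at hcoeff
  simp only [const_mul_dpMono_coeff] at hcoeff
  rw [Finset.sum_ite_eq' s α, if_pos hα, mul_left_comm,
    Ring.mul_inverse_cancel _ (isUnit_wFrac_natCast (Expo.fac_ne_zero α)), mul_one,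
    ← Nat.cast_pow, natCast_mul_coeff, mul_left_comm, ← hb] at hcoeff
  rw [hcoeff, map_mul, map_pow, map_natCast, Nat.cast_pow]

lemma not_isUnit : ¬ IsUnit (p : DPPoly B p n) := fun h => by
  have hdvd : (p : WittVector p B) ^ 1 ∣ 1 :=
    pow_dvd_of_pow_dvd_sum (s := {(0 : Expo p n)}) (a := fun _ => 1)
      (by rw [pow_one]; exact h.dvd) 0 (Finset.mem_singleton_self _)
  rw [pow_one, ← Ideal.mem_span_singleton, mem_span_p_iff_coeff_zero_eq_zero,
    one_coeff_zero] at hdvd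
  have : Nontrivial B := CharP.nontrivial_of_char_ne_one hp.out.ne_one
  exact one_ne_zero hdvd

end DPPoly

variable (B p n) in
/-- The ring `W(C^♭)`. -/
abbrev KeyWitt : Type _ := WittVector p (KeyTilt B p n)

variable (B p n) in
/-- The PD hull of `W(C^♭) → C`. -/
abbrev KeyHull : Type _ := PDHull p (thetaKer (KeyQuot B p n) p)

variable (B p n) in
/-- The structure map of the PD hull of `W(C^♭) → C`. -/
abbrev hullMap : KeyWitt B p n →+* KeyHull B p n := algebraMap _ _

variable (B p n) in
/-- The embedding of `W(B)` in `W(C^♭)`. -/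
def constW : WittVector p B →+* KeyWitt B p n :=
  WittVector.map (S := KeyTilt B p n) (constHom B p n)

lemma constW_teichmuller (b : B) :
    constW B p n (teichmuller p b) = teichmuller p (mono b (0 : Expo p n)) := by
  rw [constW, map_teichmuller]
  rfl

variable (B p n) in
/-- The `p`-adic completion of the divided power polynomial ring. -/
abbrev DPSeries : Type _ := AdicCompletion (Ideal.span {(p : DPPoly B p n)}) (DPPoly B p n)

namespace DPSeries

instance : IsAdicComplete (Ideal.span {(p : DPSeries B p n)}) (DPSeries B p n) :=
  isAdicComplete_adicCompletion

instance : IsAddTorsionFree (DPSeries B p n) := isAddTorsionFree_adicCompletion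

instance : Fact ¬IsUnit (p : DPSeries B p n) := ⟨fun h => DPPoly.not_isUnit (by
  have hdvd := pow_dvd_of_pow_dvd_algebraMap (m := 1) (d := (1 : DPPoly B p n))
    (by rw [pow_one]; exact h.dvd)
  exact isUnit_of_dvd_one (by rwa [pow_one] at hdvd))⟩

/-- The projection from the divided power polynomial ring to its reduction modulo `p`. -/
def toModP : DPPoly B p n →+* ModP (DPSeries B p n) p :=
  (Ideal.Quotient.mk _).comp (algebraMap (DPPoly B p n) (DPSeries B p n))

variable (B p n) in
/-- The inclusion of the constants `B = W(B) / p` in `DPSeries B p n / p`. -/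
def constModP : B →+* ModP (DPSeries B p n) p where
  toFun b := toModP (DPPoly.const B p n (teichmuller p b))
  map_one' := by rw [map_one, map_one, map_one]
  map_mul' a b := by rw [map_mul, map_mul, map_mul]
  map_zero' := by rw [teichmuller_zero, map_zero, map_zero]
  map_add' a b := by
    obtain ⟨c, hc⟩ := p_dvd_sub_of_coeff_zero_eq (p := p) (v := teichmuller p (a + b))
      (w := teichmuller p a + teichmuller p b) (by
        rw [add_coeff_zero', teichmuller_coeff_zero, teichmuller_coeff_zero,
          teichmuller_coeff_zero])
    rw [← map_add, ← map_add, ← sub_eq_zero, ← map_sub, ← map_sub, hc, map_mul, map_mul,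
      map_natCast, map_natCast, CharP.cast_eq_zero (ModP (DPSeries B p n) p) p, zero_mul]

variable (B p n) in
/-- The inclusion of the polynomials in the `x_i^{p^{-∞}}` in `DPSeries B p n / p`. -/
def polyModP : PerfPoly B p n →+* ModP (DPSeries B p n) p :=
  AddMonoidAlgebra.liftNCRingHom (constModP B p n)
    { toFun := fun α => toModP (DPPoly.xMono α.toAdd)
      map_one' := by rw [toAdd_one, DPPoly.xMono_zero, map_one]
      map_mul' := fun α β => by rw [toAdd_mul, DPPoly.xMono_add, map_mul] } fun _ _ => by
    unfold Commute SemiconjBy; exact mul_comm _ _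

lemma polyModP_single (α : Expo p n) (b : B) : polyModP B p n (AddMonoidAlgebra.single α b) =
    toModP (DPPoly.const B p n (teichmuller p b) * DPPoly.xMono α) := by
  rw [polyModP, AddMonoidAlgebra.liftNCRingHom_single, map_mul]
  rfl

lemma xMono_single_pow (i : Fin n) (m : ℕ) :
    (DPPoly.xMono (Pi.single i (PExp.one p)) : DPPoly B p n) ^ m =
      (m ! : DPPoly B p n) * DPPoly.dpMono (m • Pi.single i (PExp.one p)) := by
  rw [← DPPoly.xMono_nsmul, ← DPPoly.fac_mul_dpMono]
  congr 2
  have h : m • Pi.single i (PExp.one p) = (Expo.ofNat (Pi.single i m) : Expo p n) := by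
    funext j
    rcases eq_or_ne j i with rfl | hj
    · simp [Expo.ofNat]
    · simp [Expo.ofNat, hj]
  rw [h, Expo.fac, Expo.floor_ofNat, Finset.prod_eq_single i]
  · rw [Pi.single_eq_same]
  · intro j _ hj; rw [Pi.single_eq_of_ne hj, Nat.factorial_zero]
  · simp

variable (B p n) in
/-- The `p`-th power map `C → DPSeries B p n / p`; it is defined on `C` because
`x_i ^ p = p! (x_i ^ p / p!)` is divisible by `p`. -/
def keyModP : KeyQuot B p n →+* ModP (DPSeries B p n) p :=
  Ideal.Quotient.lift (Ideal.span (Set.range (PerfPoly.X B p n)))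
    ((frobenius _ p).comp (polyModP B p n)) fun a ha => by
    rw [← RingHom.mem_ker]
    refine (Ideal.span_le.mpr ?_ : _ ≤ RingHom.ker ((frobenius _ p).comp (polyModP B p n))) ha
    rintro _ ⟨i, rfl⟩
    rw [SetLike.mem_coe, RingHom.mem_ker, RingHom.comp_apply, frobenius_def, PerfPoly.X,
      polyModP_single, ← map_pow, map_one, map_one, one_mul, xMono_single_pow, map_mul,
      map_natCast]
    have : ((p ! : ℕ) : ModP (DPSeries B p n) p) = 0 :=
      (CharP.cast_eq_zero_iff _ p _).mpr (Nat.dvd_factorial hp.out.pos le_rfl)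
    rw [this, zero_mul]

lemma keyModP_mk (y : PerfPoly B p n) :
    keyModP B p n (keyMk B p n y) = polyModP B p n y ^ p := rfl

variable (B p n) in
lemma exists_wittHom : ∃ g : WittVector p (KeyTilt B p n) →+* DPSeries B p n,
    ∀ (b : B) (α : Expo p n), g (teichmuller p (mono b α)) =
      algebraMap (DPPoly B p n) _ (DPPoly.const B p n (teichmuller p b) * DPPoly.xMono α) := by
  obtain ⟨g, hg⟩ := exists_ringHom_teichmuller_eq (keyModP B p n)
  have h : ∀ (b : B) (α : Expo p n) (j k : ℕ),
      (DPPoly.const B p n (teichmuller p (rootB (p := p) (k + j) b)) *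
        DPPoly.xMono (Expo.div (k + j) α)) ^ p ^ j =
      DPPoly.const B p n (teichmuller p (rootB (p := p) k b)) *
        DPPoly.xMono (Expo.div k α) := fun b α j k => by
    rw [mul_pow, ← map_pow, ← map_pow, ← DPPoly.xMono_nsmul, ← Expo.div_div, Expo.nsmul_div,
      rootB, pow_add, ← rootB, ← rootB, RingHom.mul_def, RingHom.comp_apply, ← map_pow, rootB_pow]
  refine ⟨g, fun b α => ?_⟩
  rw [hg (mono b α) (fun k => algebraMap _ _
    (DPPoly.const B p n (teichmuller p (rootB (p := p) k b)) * DPPoly.xMono (Expo.div k α)))]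
  · rw [rootB_zero, Expo.div_zero']
  · intro k
    have := h b α k 0
    rw [zero_add] at this
    rw [← map_pow, this]
  · intro k
    have := h b α 1 k
    rw [pow_one] at this
    rw [coeff_mono, keyModP_mk, polyModP_single, ← map_pow, this]
    rfl

lemma hasDP_natCast_p {S : Type*} [CommRing S] [IsAdicComplete (Ideal.span {(p : S)}) S] :
    HasDP (p : S) := fun m => by
  obtain ⟨c, hc⟩ := exists_factorial_mul_eq_pow (p := p) (S := S) m
  exact ⟨c, hc.symm⟩

lemma hasDP_of_mem_thetaKer {S : Type*} [CommRing S]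
    [IsAdicComplete (Ideal.span {(p : S)}) S] {g : KeyWitt B p n →+* S}
    (hg : ∀ i, HasDP (g (teichX B p n i))) : ∀ w ∈ thetaKer (KeyQuot B p n) p, HasDP (g w) := by
  intro w hw
  obtain ⟨a, c, h⟩ := exists_eq_sum_teichX ⟨w, hw⟩
  replace h := congrArg Subtype.val h
  rw [Submodule.coe_add, Submodule.coe_sum, Submodule.coe_smul] at h
  simp only [Submodule.coe_smul, smul_eq_mul] at h
  rw [h, map_add, map_sum, map_mul, map_natCast]
  refine HasDP.add (HasDP.sum fun i _ => ?_) (hasDP_natCast_p.mul_left _)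
  rw [map_mul]
  exact (hg i).mul_left _

variable (B p n) in
lemma exists_hullHom : ∃ f : KeyHull B p n →+* DPSeries B p n,
    (∀ α : Expo p n, f (hullMap B p n (teichmuller p (mono (1 : B) α))) =
      algebraMap (DPPoly B p n) _ (DPPoly.xMono α)) ∧
    ∀ a : WittVector p B, f (hullMap B p n (constW B p n a)) =
      algebraMap (DPPoly B p n) _ (DPPoly.const B p n a) := by
  obtain ⟨g, hg⟩ := exists_wittHom B p n
  have hX (i : Fin n) : HasDP (g (teichX B p n i)) := by
    change HasDP (g (teichmuller p (mono 1 _)))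
    rw [hg, map_one, map_one, one_mul]
    exact HasDP.map _ fun m => ⟨_, xMono_single_pow i m⟩
  obtain ⟨f, hf⟩ := PDHull.exists_lift_of_hasDP (p := p) g (hasDP_of_mem_thetaKer hX)
  refine ⟨f, fun α => by rw [hf, hg, map_one, map_one, one_mul], fun a => ?_⟩
  have := ringHom_ext_teichmuller (p := p) (g.comp (constW B p n))
    ((algebraMap (DPPoly B p n) (DPSeries B p n)).comp (DPPoly.const B p n)) fun b => by
      rw [RingHom.comp_apply, constW_teichmuller, hg, DPPoly.xMono_zero, mul_one,
        RingHom.comp_apply]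
  rw [hf]
  exact congrArg (fun f => f a) this

end DPSeries

end dpPoly

noncomputable section hullBasis
open scoped Nat

variable {B : Type*} [CommRing B] {p : ℕ} [hp : Fact p.Prime] [CharP B p] [PerfectRing B p]
  {n : ℕ}

lemma mono_one_sum {ι : Type*} (s : Finset ι) (α : ι → Expo p n) :
    mono (1 : B) (∑ i ∈ s, α i) = ∏ i ∈ s, mono 1 (α i) := by
  classical
  induction s using Finset.induction_on with
  | empty => rw [Finset.sum_empty, Finset.prod_empty, mono_one]
  | insert i s hi ih =>
    rw [Finset.sum_insert hi, Finset.prod_insert hi, ← ih, mono_mul, one_mul]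

lemma mono_ofNat (k : Fin n → ℕ) :
    mono (1 : B) (Expo.ofNat k : Expo p n) = ∏ i, tiltX B p n i ^ k i := by
  rw [Expo.ofNat_eq_sum, mono_one_sum]
  exact Finset.prod_congr rfl fun i _ => by rw [tiltX, mono_pow, one_pow]

/-- The element `[x^α] ∏ γ_{k_i}([x_i])` of the PD hull. -/
def hullElt (α : Expo p n) (k : Fin n → ℕ) : KeyHull B p n :=
  hullMap B p n (teichmuller p (mono 1 α)) * ∏ i, PDHull.gamma p _ (k i) (teichX B p n i)

lemma hullElt_zero (α : Expo p n) :
    hullElt α 0 = hullMap B p n (teichmuller p (mono 1 α)) := by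
  rw [hullElt, Finset.prod_eq_one, mul_one]
  exact fun i _ => PDHull.gamma_zero _

lemma hullElt_mul (α β : Expo p n) (k l : Fin n → ℕ) :
    hullElt (B := B) α k * hullElt β l =
      ((∏ i, (k i + l i).choose (k i) : ℕ) : KeyHull B p n) * hullElt (α + β) (k + l) := by
  rw [hullElt, hullElt, hullElt, mul_mul_mul_comm, ← Finset.prod_mul_distrib, ← map_mul, ← map_mul,
    mono_mul, one_mul, mul_left_comm, Nat.cast_prod, ← Finset.prod_mul_distrib]
  refine congrArg _ (Finset.prod_congr rfl fun i _ => ?_)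
  rw [PDHull.gamma_mul, nsmul_eq_mul, Pi.add_apply]

lemma hullElt_ofNat (k : Fin n → ℕ) :
    hullElt (B := B) (Expo.ofNat k : Expo p n) 0 =
      ((∏ i, (k i)! : ℕ) : KeyHull B p n) * hullElt 0 k := by
  rw [hullElt_zero, hullElt, mono_one, map_one, map_one, one_mul, mono_ofNat, map_prod, map_prod,
    Nat.cast_prod, ← Finset.prod_mul_distrib]
  refine Finset.prod_congr rfl fun i _ => ?_
  rw [map_pow, map_pow, PDHull.factorial_mul_gamma]
  rfl

/-- The element `x^α / ⌊α⌋! = [x^{α - ⌊α⌋}] ∏ γ_{⌊α_i⌋}([x_i])` of the PD hull; these form a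
basis over `W(B)` up to `p`-adic completion. -/
def hullMono (α : Expo p n) : KeyHull B p n := hullElt α.fract α.floor

lemma exists_hullElt_eq (α : Expo p n) (k : Fin n → ℕ) :
    ∃ N : ℕ, hullElt (B := B) α k = (N : KeyHull B p n) * hullMono (α + Expo.ofNat k) := by
  have hsplit : hullElt (B := B) α k = hullElt (Expo.ofNat α.floor) 0 * hullElt α.fract k := by
    rw [hullElt_mul, Expo.floor_add_fract, zero_add, Finset.prod_eq_one, Nat.cast_one, one_mul]
    intro i _
    exact Nat.choose_zero_right _
  rw [hsplit, hullElt_ofNat, mul_assoc, hullElt_mul, ← mul_assoc, zero_add, ← Nat.cast_mul,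
    hullMono, Expo.fract_add_ofNat, Expo.floor_add_ofNat]
  exact ⟨_, rfl⟩

lemma exists_hullMono_mul (α β : Expo p n) :
    ∃ N : ℕ, hullMono (B := B) α * hullMono β = (N : KeyHull B p n) * hullMono (α + β) := by
  obtain ⟨N, hN⟩ := exists_hullElt_eq (B := B) (α.fract + β.fract) (α.floor + β.floor)
  have h : α.fract + β.fract + Expo.ofNat (α.floor + β.floor) = α + β := by
    conv_rhs => rw [← Expo.floor_add_fract α, ← Expo.floor_add_fract β]
    rw [Expo.ofNat_add]
    abel
  rw [h] at hN
  rw [hullMono, hullMono, hullElt_mul, hN, ← mul_assoc, ← Nat.cast_mul]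
  exact ⟨_, rfl⟩

lemma fac_mul_hullMono (α : Expo p n) : (Expo.fac α : KeyHull B p n) * hullMono α =
    hullMap B p n (teichmuller p (mono 1 α)) := by
  have hsplit := hullElt_mul (B := B) (Expo.ofNat α.floor) α.fract 0 0
  rw [Expo.floor_add_fract, zero_add, hullElt_zero α, Finset.prod_eq_one (by simp), Nat.cast_one,
    one_mul] at hsplit
  have hmono := hullElt_mul (B := B) 0 α.fract α.floor 0
  rw [zero_add, add_zero, Finset.prod_eq_one (fun i _ => by
    rw [Pi.zero_apply, add_zero, Nat.choose_self]), Nat.cast_one, one_mul] at hmono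
  rw [← hsplit, hullElt_ofNat, mul_assoc, hmono]
  rfl

variable (B p n) in
/-- The finite linear combinations `∑ a_α x^α / ⌊α⌋!` in the PD hull, with `a_α ∈ W(B)`. -/
def comb : (Expo p n →₀ WittVector p B) →+ KeyHull B p n :=
  Finsupp.liftAddHom fun α => (AddMonoidHom.mulRight (hullMono α)).comp
    ((hullMap B p n).comp (constW B p n)).toAddMonoidHom

lemma comb_single (α : Expo p n) (c : WittVector p B) :
    comb B p n (Finsupp.single α c) = hullMap B p n (constW B p n c) * hullMono α :=
  Finsupp.liftAddHom_apply_single _ _ _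

lemma comb_apply (f : Expo p n →₀ WittVector p B) :
    comb B p n f = ∑ α ∈ f.support, hullMap B p n (constW B p n (f α)) * hullMono α := rfl

lemma comb_single_mul (α : Expo p n) (c : WittVector p B) (k : ℕ) :
    comb B p n (Finsupp.single α (k * c)) =
      hullMap B p n (constW B p n c) * ((k : KeyHull B p n) * hullMono α) := by
  rw [comb_single, map_mul, map_mul, map_natCast, map_natCast, mul_comm (k : KeyHull B p n),
    mul_assoc]

lemma pow_dvd_of_pow_dvd_comb {m : ℕ} {f : Expo p n →₀ WittVector p B}
    (h : (p : KeyHull B p n) ^ m ∣ comb B p n f) (α : Expo p n) :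
    (p : WittVector p B) ^ m ∣ f α := by
  obtain ⟨π, hπ_mono, hπ_const⟩ := DPSeries.exists_hullHom B p n
  have hπ_hullMono (α : Expo p n) :
      π (hullMono α) = algebraMap (DPPoly B p n) _ (DPPoly.dpMono α) := by
    refine isLeftRegular_natCast (Expo.fac_ne_zero α) ?_
    beta_reduce
    rw [← map_natCast π, ← map_mul, fac_mul_hullMono, hπ_mono, ← DPPoly.fac_mul_dpMono,
      map_mul, map_natCast, map_natCast]
  have hdvd := map_dvd π h
  rw [comb_apply, map_sum, map_pow, map_natCast] at hdvd
  simp only [map_mul, hπ_const, hπ_hullMono] at hdvd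
  simp only [← map_mul, ← map_sum] at hdvd
  by_cases hα : α ∈ f.support
  · exact DPPoly.pow_dvd_of_pow_dvd_sum (pow_dvd_of_pow_dvd_algebraMap hdvd) α hα
  · rw [Finsupp.notMem_support_iff.mp hα]
    exact dvd_zero _

lemma teichmuller_mono (b : B) (α : Expo p n) : teichmuller p (mono b α) =
    constW B p n (teichmuller p b) * teichmuller p (mono 1 α) := by
  rw [constW_teichmuller, ← map_mul, mono_mul, mul_one, zero_add]

lemma hullMap_teichmuller_mono (b : B) (α : Expo p n) :
    hullMap B p n (teichmuller p (mono b α)) =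
      comb B p n (Finsupp.single α (Expo.fac α * teichmuller p b)) := by
  rw [comb_single_mul, fac_mul_hullMono, teichmuller_mono, map_mul]

lemma p_dvd_teichmuller_polyHom_sub (y : PerfPoly B p n) :
    (p : KeyWitt B p n) ∣ teichmuller p (polyHom B p n y) -
      ∑ α ∈ y.coeff.support, teichmuller p (mono (y.coeff α) α) := by
  refine p_dvd_sub_of_coeff_zero_eq ?_
  rw [coeff_zero_sum, teichmuller_coeff_zero, polyHom_eq_sum]
  exact Finset.sum_congr rfl fun _ _ => (teichmuller_coeff_zero _ _).symm

lemma p_dvd_hullMap_sub {w : KeyWitt B p n} {y : PerfPoly B p n}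
    (h : Perfection.coeff _ p 1 (w.coeff 0) = Perfection.coeff _ p 1 (polyHom B p n y)) :
    (p : KeyHull B p n) ∣ hullMap B p n w -
      comb B p n (y.coeff.sum fun α b => Finsupp.single α (Expo.fac α * teichmuller p b)) := by
  have hw : (p : KeyHull B p n) ^ 1 ∣
      hullMap B p n w - hullMap B p n (teichmuller p (polyHom B p n y)) := by
    have := pow_dvd_algebraMap_sub (k := 1) (w := w) (w' := teichmuller p (polyHom B p n y))
      (fun i hi => by rw [Nat.lt_one_iff.mp hi, teichmuller_coeff_zero, h])
    rw [Acris.algebraMap_witt, Acris.algebraMap_witt, ← map_sub] at this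
    exact pow_dvd_of_pow_dvd_algebraMap this
  have hy := map_dvd (hullMap B p n) (p_dvd_teichmuller_polyHom_sub y)
  rw [map_natCast, map_sub, map_sum] at hy
  simp only [hullMap_teichmuller_mono] at hy
  rw [Finsupp.sum, map_sum, ← sub_add_sub_cancel]
  exact dvd_add (pow_one (p : KeyHull B p n) ▸ hw) hy

lemma exists_comb_eq_mul (f g : Expo p n →₀ WittVector p B) :
    ∃ h, comb B p n h = comb B p n f * comb B p n g := by
  choose N hN using exists_hullMono_mul (B := B) (p := p) (n := n)
  refine ⟨∑ α ∈ f.support, ∑ β ∈ g.support, Finsupp.single (α + β) (N α β * (f α * g β)), ?_⟩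
  rw [comb_apply f, comb_apply g, Finset.sum_mul_sum, map_sum]
  refine Finset.sum_congr rfl fun α _ => ?_
  rw [map_sum]
  refine Finset.sum_congr rfl fun β _ => ?_
  rw [comb_single_mul, ← hN, map_mul, map_mul]
  exact mul_mul_mul_comm _ _ _ _

variable (B p n) in
/-- The elements of the PD hull that are congruent modulo `p` to finite linear combinations. -/
def combModP : Subring (KeyHull B p n) where
  carrier := {d | ∃ f, (p : KeyHull B p n) ∣ d - comb B p n f}
  zero_mem' := ⟨0, by simp⟩
  one_mem' := ⟨Finsupp.single 0 (Expo.fac (0 : Expo p n) * 1), by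
    rw [comb_single_mul, fac_mul_hullMono, mono_one, map_one, map_one, map_one, map_one, mul_one,
      sub_self]
    exact dvd_zero _⟩
  add_mem' := by
    rintro d d' ⟨f, hf⟩ ⟨f', hf'⟩
    exact ⟨f + f', by rw [map_add, add_sub_add_comm]; exact dvd_add hf hf'⟩
  neg_mem' := by
    rintro d ⟨f, hf⟩
    exact ⟨-f, by rw [map_neg, ← neg_sub']; exact hf.neg_right⟩
  mul_mem' := by
    rintro d d' ⟨f, hf⟩ ⟨f', hf'⟩
    obtain ⟨g, hg⟩ := exists_comb_eq_mul f f'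
    refine ⟨g, ?_⟩
    have hsplit : d * d' - comb B p n f * comb B p n f' =
        (d - comb B p n f) * d' + comb B p n f * (d' - comb B p n f') := by ring
    rw [hg, hsplit]
    exact dvd_add (hf.mul_right _) (hf'.mul_left _)

lemma hullMap_mem_combModP (w : KeyWitt B p n) : hullMap B p n w ∈ combModP B p n := by
  obtain ⟨y, hy⟩ := exists_coeff_polyHom_eq 1 (w.coeff 0)
  exact Exists.intro _ (p_dvd_hullMap_sub hy.symm)

lemma hullMono_mem_combModP (α : Expo p n) : hullMono α ∈ combModP B p n :=
  ⟨Finsupp.single α 1, by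
    rw [comb_single, map_one, map_one, one_mul, sub_self]; exact dvd_zero _⟩

variable (B p n) in
/-- The elements of `ker (W(C^♭) → C)` all of whose divided powers are congruent modulo `p` to
finite linear combinations. -/
def combModPDP : Submodule (KeyWitt B p n) (thetaKer (KeyQuot B p n) p) where
  carrier := {x | ∀ k, PDHull.gamma p _ k x ∈ combModP B p n}
  zero_mem' k := by
    rw [← zero_smul (KeyWitt B p n) 0, PDHull.gamma_smul]
    cases k with
    | zero => rw [PDHull.gamma_zero, mul_one]; exact hullMap_mem_combModP _
    | succ k => rw [zero_pow k.succ_ne_zero, map_zero, zero_mul]; exact zero_mem _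
  add_mem' {x y} hx hy k := by
    rw [PDHull.gamma_add]
    exact sum_mem fun j _ => mul_mem (hx _) (hy _)
  smul_mem' a x hx k := by
    rw [PDHull.gamma_smul]
    exact mul_mem (hullMap_mem_combModP _) (hx k)

lemma teichX_mem_combModPDP (i : Fin n) : teichX B p n i ∈ combModPDP B p n := fun k => by
  obtain ⟨N, hN⟩ := exists_hullElt_eq (B := B) (0 : Expo p n) (Pi.single i k)
  have hγ : hullElt (B := B) (0 : Expo p n) (Pi.single i k) =
      PDHull.gamma p _ k (teichX B p n i) := by
    rw [hullElt, mono_one, map_one, map_one, one_mul, Finset.prod_eq_single i]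
    · rw [Pi.single_eq_same]
    · intro j _ hj; rw [Pi.single_eq_of_ne hj, PDHull.gamma_zero]
    · simp
  rw [← hγ, hN]
  exact mul_mem (natCast_mem _ N) (hullMono_mem_combModP _)

lemma p_mem_combModPDP :
    (⟨_, p_mem_thetaKer⟩ : thetaKer (KeyQuot B p n) p) ∈ combModPDP B p n := fun k => by
  obtain ⟨e, he⟩ := exists_factorial_mul_eq_pow (p := p) (S := KeyWitt B p n) k
  rw [PDHull.gamma_natCast _ rfl k e he]
  exact hullMap_mem_combModP _

lemma gamma_mem_combModP (k : ℕ) (x : thetaKer (KeyQuot B p n) p) :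
    PDHull.gamma p _ k x ∈ combModP B p n := by
  obtain ⟨a, c, h⟩ := exists_eq_sum_teichX x
  suffices x ∈ combModPDP B p n from this k
  rw [h]
  exact add_mem (sum_mem fun i _ => Submodule.smul_mem _ _ (teichX_mem_combModPDP i))
    (Submodule.smul_mem _ _ p_mem_combModPDP)

lemma mem_combModP (d : KeyHull B p n) : d ∈ combModP B p n := by
  induction d using PDHull.induction_on with
  | algebraMap a => exact hullMap_mem_combModP a
  | add x y hx hy => exact add_mem hx hy
  | gamma x k y hx => exact mul_mem hx (gamma_mem_combModP k y)

lemma exists_comb_pow (m : ℕ) (d : KeyHull B p n) :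
    ∃ f, (p : KeyHull B p n) ^ m ∣ d - comb B p n f := by
  induction m generalizing d with
  | zero => exact ⟨0, by simp⟩
  | succ m ih =>
    obtain ⟨f, d', hf⟩ := mem_combModP d
    obtain ⟨f', hf'⟩ := ih d'
    refine ⟨f + p • f', ?_⟩
    rw [map_add, map_nsmul, ← sub_sub, hf, nsmul_eq_mul, ← mul_sub, pow_succ']
    exact mul_dvd_mul_left _ hf'

end hullBasis

noncomputable section expansions

variable {B : Type*} [CommRing B] {p : ℕ} [hp : Fact p.Prime] {n : ℕ}

/-- The quotient `⌊pα⌋! / ⌊α⌋!`. -/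
def facQuot (α : Expo p n) : ℕ := Expo.fac (p • α) / Expo.fac α

lemma facQuot_mul_fac (α : Expo p n) : facQuot α * Expo.fac α = Expo.fac (p • α) := by
  refine Nat.div_mul_cancel ?_
  have h := Expo.fac_mul_fac_dvd α ((p - 1) • α)
  rw [← succ_nsmul', Nat.sub_add_cancel hp.out.one_le] at h
  exact (dvd_mul_right _ _).trans h

lemma facQuot_ne_zero (α : Expo p n) : facQuot α ≠ 0 := fun h =>
  Expo.fac_ne_zero (p • α) (by rw [← facQuot_mul_fac, h, zero_mul])

variable (B p n) in
/-- The effect of the Frobenius of `A_cris(C)` on the coefficients of finite linear combinations. -/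
def frobFin : (Expo p n →₀ WittVector p B) →+ (Expo p n →₀ WittVector p B) :=
  Finsupp.liftAddHom fun α => (Finsupp.singleAddHom (p • α)).comp
    ((AddMonoidHom.mulLeft (facQuot α : WittVector p B)).comp
      (WittVector.frobenius (p := p) (R := B)).toAddMonoidHom)

lemma frobFin_single (α : Expo p n) (c : WittVector p B) : frobFin B p n (Finsupp.single α c) =
    Finsupp.single (p • α) (facQuot α * WittVector.frobenius c) :=
  Finsupp.liftAddHom_apply_single _ _ _

lemma Expo.nsmul_eq_iff (α β : Expo p n) : p • α = β ↔ α = Expo.div 1 β := by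
  constructor
  · rintro rfl
    have := Expo.div_nsmul 1 α
    rw [pow_one] at this
    exact this.symm
  · rintro rfl
    have := Expo.nsmul_div 1 β
    rwa [pow_one] at this

lemma frobFin_apply (f : Expo p n →₀ WittVector p B) (β : Expo p n) : frobFin B p n f β =
    facQuot (Expo.div 1 β) * WittVector.frobenius (f (Expo.div 1 β)) := by
  induction f using Finsupp.induction_linear with
  | zero => rw [map_zero, Finsupp.zero_apply, Finsupp.zero_apply, map_zero, mul_zero]
  | add f g hf hg =>
    rw [map_add, Finsupp.add_apply, Finsupp.add_apply, map_add, hf, hg, mul_add]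
  | single α c =>
    rw [frobFin_single]
    by_cases h : α = Expo.div 1 β
    · rw [h, (Expo.nsmul_eq_iff _ _).mpr rfl, Finsupp.single_eq_same, Finsupp.single_eq_same]
    · rw [Finsupp.single_eq_of_ne' h, Finsupp.single_eq_of_ne' (mt (Expo.nsmul_eq_iff _ _).mp h),
        map_zero, mul_zero]

variable [CharP B p]

variable (B p n) in
/-- The ring `A_cris(C)`. -/
abbrev KeyAcris : Type _ := Acris (KeyQuot B p n) p

variable (B p n) in
/-- The structure map `W(C^♭) → A_cris(C)`. -/
abbrev acrisMap : KeyWitt B p n →+* KeyAcris B p n := algebraMap _ _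

variable (B p n) in
/-- The map from the PD hull to `A_cris(C)`. -/
abbrev hullAcris : KeyHull B p n →+* KeyAcris B p n := algebraMap _ _

lemma hullAcris_hullMap (w : KeyWitt B p n) :
    hullAcris B p n (hullMap B p n w) = acrisMap B p n w := rfl

lemma frob_acrisMap (w : KeyWitt B p n) :
    Acris.frob (acrisMap B p n w) = acrisMap B p n (WittVector.frobenius w) :=
  Acris.frob_algebraMap_witt w

lemma frob_iterate_acrisMap (k : ℕ) (w : KeyWitt B p n) :
    Acris.frob^[k] (acrisMap B p n w) = acrisMap B p n (WittVector.frobenius^[k] w) := by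
  induction k with
  | zero => rfl
  | succ k ih => rw [Function.iterate_succ_apply', Function.iterate_succ_apply', ih, frob_acrisMap]

lemma pow_dvd_acrisMap_teichmuller_sub {M : ℕ} {r t : KeyTilt B p n}
    (h : Perfection.coeff _ p M r = Perfection.coeff _ p M t) :
    (p : KeyAcris B p n) ^ M ∣
      acrisMap B p n (teichmuller p r) - acrisMap B p n (teichmuller p t) :=
  pow_dvd_algebraMap_sub fun i _ => by
    rcases Nat.eq_zero_or_pos i with rfl | hi
    · rw [teichmuller_coeff_zero, teichmuller_coeff_zero, h]
    · rw [teichmuller_coeff_pos _ _ _ hi, teichmuller_coeff_pos _ _ _ hi]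

variable [PerfectRing B p]

/-- The element `x^α / ⌊α⌋!` of `A_cris(C)`. -/
def acrisMono (α : Expo p n) : KeyAcris B p n := hullAcris B p n (hullMono α)

lemma fac_mul_acrisMono (α : Expo p n) : (Expo.fac α : KeyAcris B p n) * acrisMono α =
    acrisMap B p n (teichmuller p (mono 1 α)) := by
  rw [acrisMono, ← hullAcris_hullMap, ← fac_mul_hullMono, map_mul, map_natCast]

variable (B p n) in
/-- The finite linear combinations `∑ a_α x^α / ⌊α⌋!` in `A_cris(C)`, with `a_α ∈ W(B)`. -/
def combA : (Expo p n →₀ WittVector p B) →+ KeyAcris B p n :=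
  (hullAcris B p n).toAddMonoidHom.comp (comb B p n)

lemma combA_eq (f : Expo p n →₀ WittVector p B) :
    combA B p n f = hullAcris B p n (comb B p n f) := rfl

lemma combA_single (α : Expo p n) (c : WittVector p B) :
    combA B p n (Finsupp.single α c) = acrisMap B p n (constW B p n c) * acrisMono α := by
  rw [combA_eq, comb_single, map_mul]; rfl

lemma combA_apply (f : Expo p n →₀ WittVector p B) :
    combA B p n f = ∑ α ∈ f.support, acrisMap B p n (constW B p n (f α)) * acrisMono α := by
  rw [combA_eq, comb_apply, map_sum]
  exact Finset.sum_congr rfl fun α _ => map_mul _ _ _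

lemma pow_dvd_of_pow_dvd_combA {m : ℕ} {f : Expo p n →₀ WittVector p B}
    (h : (p : KeyAcris B p n) ^ m ∣ combA B p n f) (α : Expo p n) :
    (p : WittVector p B) ^ m ∣ f α :=
  pow_dvd_of_pow_dvd_comb (pow_dvd_of_pow_dvd_algebraMap h) α

lemma pow_dvd_combA {m : ℕ} {f : Expo p n →₀ WittVector p B}
    (h : ∀ α, (p : WittVector p B) ^ m ∣ f α) : (p : KeyAcris B p n) ^ m ∣ combA B p n f := by
  rw [combA_apply]
  refine Finset.dvd_sum fun α _ => Dvd.dvd.mul_right ?_ _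
  have := map_dvd ((acrisMap B p n).comp (constW B p n)) (h α)
  rwa [map_pow, map_natCast] at this

/-- The element `u` of `A_cris(C)` has the expansion `∑ a_α x^α / ⌊α⌋!` with `a_α ∈ W(B)`: it is
a `p`-adic limit of finite linear combinations whose coefficients converge to `a`, uniformly
in `α`. -/
def Expands (a : Expo p n → WittVector p B) (u : KeyAcris B p n) : Prop :=
  ∀ m : ℕ, ∃ f : Expo p n →₀ WittVector p B, (p : KeyAcris B p n) ^ m ∣ u - combA B p n f ∧
    ∀ α, (p : WittVector p B) ^ m ∣ a α - f α

lemma exists_pow_dvd_sub_combA (m : ℕ) (u : KeyAcris B p n) :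
    ∃ f, (p : KeyAcris B p n) ^ m ∣ u - combA B p n f := by
  obtain ⟨d, hd⟩ := exists_pow_dvd_sub_algebraMap m u
  obtain ⟨f, hf⟩ := exists_comb_pow m d
  have := map_dvd (hullAcris B p n) hf
  rw [map_pow, map_natCast, map_sub, ← combA_eq] at this
  exact ⟨f, sub_add_sub_cancel u _ (combA B p n f) ▸ dvd_add hd this⟩

lemma exists_expands (u : KeyAcris B p n) : ∃ a, Expands a u := by
  choose f hf using fun m => exists_pow_dvd_sub_combA m u
  have hlim (α : Expo p n) : ∃ c, ∀ m, (p : WittVector p B) ^ m ∣ c - f m α :=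
    exists_forall_pow_dvd_sub fun m => by
      rw [← Finsupp.sub_apply]
      refine pow_dvd_of_pow_dvd_combA ?_ α
      rw [map_sub, ← sub_sub_sub_cancel_left _ _ u]
      exact dvd_sub (hf m) ((pow_dvd_pow _ (Nat.le_succ m)).trans (hf (m + 1)))
  choose a ha using hlim
  exact ⟨a, fun m => ⟨f m, hf m, fun α => ha α m⟩⟩

namespace Expands

variable {a b : Expo p n → WittVector p B} {u v : KeyAcris B p n}

lemma add (ha : Expands a u) (hb : Expands b v) : Expands (a + b) (u + v) := fun m => by
  obtain ⟨f, hfu, hfa⟩ := ha m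
  obtain ⟨g, hgv, hgb⟩ := hb m
  refine ⟨f + g, ?_, fun α => ?_⟩
  · rw [map_add, add_sub_add_comm]; exact dvd_add hfu hgv
  · rw [Pi.add_apply, Finsupp.add_apply, add_sub_add_comm]; exact dvd_add (hfa α) (hgb α)

lemma neg (ha : Expands a u) : Expands (-a) (-u) := fun m => by
  obtain ⟨f, hfu, hfa⟩ := ha m
  refine ⟨-f, ?_, fun α => ?_⟩
  · rw [map_neg, ← neg_sub']; exact hfu.neg_right
  · rw [Pi.neg_apply, Finsupp.neg_apply, ← neg_sub']; exact (hfa α).neg_right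

lemma sub (ha : Expands a u) (hb : Expands b v) : Expands (a - b) (u - v) := by
  rw [sub_eq_add_neg, sub_eq_add_neg]; exact ha.add hb.neg

lemma natCast_mul (ha : Expands a u) (k : ℕ) :
    Expands (fun α => (k : WittVector p B) * a α) ((k : KeyAcris B p n) * u) := fun m => by
  obtain ⟨f, hfu, hfa⟩ := ha m
  refine ⟨k • f, ?_, fun α => ?_⟩
  · rw [map_nsmul, nsmul_eq_mul, ← mul_sub]; exact hfu.mul_left _
  · rw [Finsupp.smul_apply, nsmul_eq_mul, ← mul_sub]; exact (hfa α).mul_left _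

lemma combA (f : Expo p n →₀ WittVector p B) : Expands f (combA B p n f) := fun m =>
  ⟨f, by rw [sub_self]; exact dvd_zero _, fun α => by rw [sub_self]; exact dvd_zero _⟩

lemma pow_dvd (ha : Expands a u) {m : ℕ} (h : (p : KeyAcris B p n) ^ m ∣ u) (α : Expo p n) :
    (p : WittVector p B) ^ m ∣ a α := by
  obtain ⟨f, hfu, hfa⟩ := ha m
  exact (dvd_iff_dvd_of_dvd_sub (hfa α)).mpr
    (pow_dvd_of_pow_dvd_combA ((dvd_iff_dvd_of_dvd_sub hfu).mp h) α)

lemma pow_dvd_of_forall (ha : Expands a u) {m : ℕ} (h : ∀ α, (p : WittVector p B) ^ m ∣ a α) :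
    (p : KeyAcris B p n) ^ m ∣ u := by
  obtain ⟨f, hfu, hfa⟩ := ha m
  exact (dvd_iff_dvd_of_dvd_sub hfu).mpr
    (pow_dvd_combA fun α => (dvd_iff_dvd_of_dvd_sub (hfa α)).mp (h α))

lemma eq_zero (ha : Expands a 0) (α : Expo p n) : a α = 0 :=
  eq_zero_of_forall_pow_dvd (p : WittVector p B) fun _ => ha.pow_dvd (dvd_zero _) α

lemma eq_zero_of_forall (ha : Expands a u) (h : ∀ α, a α = 0) : u = 0 :=
  eq_zero_of_forall_pow_dvd (p : KeyAcris B p n) fun _ => ha.pow_dvd_of_forall fun α => by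
    rw [h α]; exact dvd_zero _

lemma unique (ha : Expands a u) (hb : Expands b u) : a = b := by
  have := ha.sub hb
  rw [sub_self] at this
  exact funext fun α => sub_eq_zero.mp (this.eq_zero α)

end Expands

instance : IsAddTorsionFree (KeyAcris B p n) :=
  isAddTorsionFree_of_natCast_mul_eq_zero fun k u hk h => by
    obtain ⟨a, ha⟩ := exists_expands u
    have hka := ha.natCast_mul k
    rw [h] at hka
    exact ha.eq_zero_of_forall fun α =>
      isLeftRegular_natCast hk ((hka.eq_zero α).trans (mul_zero _).symm)

section frobenius

lemma frobenius_constW (c : WittVector p B) :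
    WittVector.frobenius (constW B p n c) = constW B p n (WittVector.frobenius c) := by
  ext1 i
  rw [coeff_frobenius_charP, constW, WittVector.map_coeff, WittVector.map_coeff,
    coeff_frobenius_charP, map_pow]

lemma frob_acrisMono (α : Expo p n) : Acris.frob (acrisMono (B := B) α) =
    (facQuot α : KeyAcris B p n) * acrisMono (p • α) := by
  refine isLeftRegular_natCast (Expo.fac_ne_zero α) ?_
  beta_reduce
  rw [← map_natCast Acris.frob, ← map_mul, fac_mul_acrisMono, frob_acrisMap, frob_teich, mono_pow,
    one_pow, ← mul_assoc, map_natCast, ← Nat.cast_mul, mul_comm (Expo.fac α), facQuot_mul_fac,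
    fac_mul_acrisMono]

lemma frob_combA (f : Expo p n →₀ WittVector p B) :
    Acris.frob (combA B p n f) = combA B p n (frobFin B p n f) := by
  induction f using Finsupp.induction_linear with
  | zero => rw [map_zero, map_zero, map_zero, map_zero]
  | add f g hf hg => rw [map_add, map_add, map_add, map_add, hf, hg]
  | single α c =>
    rw [frobFin_single, combA_single, combA_single, map_mul, frob_acrisMap, frobenius_constW,
      frob_acrisMono, map_mul, map_mul, map_natCast, map_natCast]
    ring

namespace Expands

variable {a : Expo p n → WittVector p B} {u : KeyAcris B p n}

lemma frob (ha : Expands a u) :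
    Expands (fun β => (facQuot (Expo.div 1 β) : WittVector p B) *
      WittVector.frobenius (a (Expo.div 1 β))) (Acris.frob u) := fun m => by
  obtain ⟨f, hfu, hfa⟩ := ha m
  refine ⟨frobFin B p n f, ?_, fun β => ?_⟩
  · rw [← frob_combA, ← map_sub]
    exact dvd_frob hfu
  · rw [frobFin_apply, ← mul_sub, ← map_sub]
    have := map_dvd (WittVector.frobenius (p := p) (R := B)) (hfa (Expo.div 1 β))
    rw [map_pow, map_natCast] at this
    exact this.mul_left _

lemma frob_iterate (ha : Expands a u) (L : ℕ) : ∃ b, Expands b (Acris.frob^[L] u) ∧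
    ∀ β, (Expo.fac (Expo.div L β) : WittVector p B) * b β =
      Expo.fac β * WittVector.frobenius^[L] (a (Expo.div L β)) := by
  induction L with
  | zero => exact ⟨a, ha, fun β => by rw [Expo.div_zero']; rfl⟩
  | succ L ih =>
    obtain ⟨b, hb, hba⟩ := ih
    refine ⟨_, by rw [Function.iterate_succ_apply']; exact hb.frob, fun β => ?_⟩
    have hfrob := congrArg WittVector.frobenius (hba (Expo.div 1 β))
    rw [map_mul, map_mul, map_natCast, map_natCast, Expo.div_div, add_comm 1 L,
      ← Function.iterate_succ_apply' (WittVector.frobenius (p := p) (R := B))] at hfrob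
    rw [mul_left_comm, hfrob, ← mul_assoc, ← Nat.cast_mul, facQuot_mul_fac,
      (Expo.nsmul_eq_iff _ _).mpr rfl]

end Expands

lemma frob_injective : Function.Injective (Acris.frob (C := KeyQuot B p n) (p := p)) := by
  rw [injective_iff_map_eq_zero]
  intro u hu
  obtain ⟨a, ha⟩ := exists_expands u
  have hFa := ha.frob
  rw [hu] at hFa
  refine ha.eq_zero_of_forall fun α => ?_
  have hα := isLeftRegular_natCast (facQuot_ne_zero _)
    ((hFa.eq_zero (p • α)).trans (mul_zero _).symm)
  rw [← (Expo.nsmul_eq_iff α (p • α)).mp rfl] at hα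
  exact (WittVector.frobenius_bijective p B).1 (hα.trans (map_zero _).symm)

end frobenius

end expansions

noncomputable section degrees

variable {B : Type*} [CommRing B] {p n : ℕ}

lemma coeff_mul_eq_zero_of_deg_lt {c d : ℚ≥0} {y z : PerfPoly B p n}
    (hy : ∀ α : Expo p n, Expo.deg α < c → y.coeff α = 0)
    (hz : ∀ α : Expo p n, Expo.deg α < d → z.coeff α = 0) (γ : Expo p n)
    (h : Expo.deg γ < c + d) : (y * z).coeff γ = 0 := by
  classical
  rw [AddMonoidAlgebra.coeff_mul]
  refine Finset.sum_eq_zero fun α _ => Finset.sum_eq_zero fun β _ => ?_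
  change (if α + β = γ then y.coeff α * z.coeff β else 0) = 0
  split_ifs with hαβ
  · by_cases hα : Expo.deg α < c
    · rw [hy α hα, zero_mul]
    · rw [hz β, mul_zero]
      by_contra hβ
      rw [← hαβ, map_add] at h
      exact absurd h (not_lt.mpr (add_le_add (not_lt.mp hα) (not_lt.mp hβ)))
  · rfl

variable (B p n) in
/-- The polynomials all of whose monomials have degree at least `d`. -/
def polyDeg (d : ℚ≥0) : Ideal (PerfPoly B p n) where
  carrier := {y | ∀ α : Expo p n, Expo.deg α < d → y.coeff α = 0}
  zero_mem' _ _ := rfl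
  add_mem' {y z} hy hz α hα := by
    rw [AddMonoidAlgebra.coeff_add, Finsupp.add_apply, hy α hα, hz α hα, add_zero]
  smul_mem' y z hz α hα := coeff_mul_eq_zero_of_deg_lt (c := 0)
    (fun α hα => absurd hα not_lt_zero) hz α (by rwa [zero_add])

lemma mul_mem_polyDeg {c d : ℚ≥0} {y z : PerfPoly B p n} (hy : y ∈ polyDeg B p n c)
    (hz : z ∈ polyDeg B p n d) : y * z ∈ polyDeg B p n (c + d) :=
  coeff_mul_eq_zero_of_deg_lt hy hz

lemma pow_mem_polyDeg {d : ℚ≥0} {y : PerfPoly B p n} (hy : y ∈ polyDeg B p n d) (m : ℕ) :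
    y ^ m ∈ polyDeg B p n (m * d) := by
  induction m with
  | zero => intro α hα; rw [Nat.cast_zero, zero_mul] at hα; exact absurd hα not_lt_zero
  | succ m ih => rw [pow_succ, Nat.cast_succ, add_mul, one_mul]; exact mul_mem_polyDeg ih hy

lemma single_mem_polyDeg {d : ℚ≥0} {α : Expo p n} (h : d ≤ Expo.deg α) (b : B) :
    AddMonoidAlgebra.single α b ∈ polyDeg B p n d := fun β hβ => by
  rw [AddMonoidAlgebra.coeff_single, Finsupp.single_eq_of_ne']
  rintro rfl
  exact absurd hβ (not_lt.mpr h)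

lemma span_X_le_polyDeg : Ideal.span (Set.range (PerfPoly.X B p n)) ≤ polyDeg B p n 1 := by
  rw [Ideal.span_le]
  rintro _ ⟨i, rfl⟩
  refine single_mem_polyDeg (le_trans (le_of_eq ?_) (Expo.coe_le_deg _ i)) 1
  rw [Pi.single_eq_same]
  rfl

variable [hp : Fact p.Prime] [CharP B p] [PerfectRing B p]

/-- The element `r` of `C^♭` is a limit of sums of monomials of degree at least `d`. -/
def TiltDeg (d : ℚ≥0) (r : KeyTilt B p n) : Prop :=
  ∀ k, ∃ y ∈ polyDeg B p n d, Perfection.coeff _ p k r = Perfection.coeff _ p k (polyHom B p n y)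

lemma tiltDeg_one {r : KeyTilt B p n} (hr : Perfection.coeff _ p 0 r = 0) : TiltDeg 1 r := by
  intro k
  obtain ⟨y, hy⟩ := exists_coeff_polyHom_eq k r
  refine ⟨y ^ p ^ k, span_X_le_polyDeg ?_, hy.symm⟩
  have hzero := coeff_zero_eq_zero_of_coeff (k := k) (r := r - polyHom B p n (y ^ p ^ k))
    (by rw [map_sub, hy, sub_self])
  rw [map_sub, hr, zero_sub, neg_eq_zero, coeff_zero_polyHom] at hzero
  exact keyMk_eq_zero_iff.mp hzero

lemma TiltDeg.mono {c d : ℚ≥0} (hcd : c ≤ d) {r : KeyTilt B p n} (hr : TiltDeg d r) :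
    TiltDeg c r := fun k => (hr k).imp fun _ h => ⟨fun α hα => h.1 α (hα.trans_le hcd), h.2⟩

lemma eq_zero_of_forall_tiltDeg {r : KeyTilt B p n} (h : ∀ m : ℕ, TiltDeg (m : ℚ≥0) r) : r = 0 := by
  refine Perfection.ext fun k => ?_
  obtain ⟨y, hy, hk⟩ := h (n * p ^ k + 1) k
  rw [hk, polyHom_eq_sum, map_sum, map_zero]
  refine Finset.sum_eq_zero fun α _ => ?_
  by_cases hα : Expo.deg α < ((n * p ^ k + 1 : ℕ) : ℚ≥0)
  · rw [hy α hα, mono_zero_left, map_zero]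
  · obtain ⟨i, hi⟩ := Expo.exists_le_coe_of_le_deg (α := α) (c := (p : ℚ≥0) ^ k)
      (lt_of_lt_of_le (by push_cast; exact lt_add_one _) (not_lt.mp hα))
    exact coeff_mono_eq_zero hi _

/-- All the monomials in the expansion of the element `u` of `A_cris(C)` have degree at
least `d`. -/
def AcrisDeg (d : ℚ≥0) (u : KeyAcris B p n) : Prop :=
  ∀ a, Expands a u → ∀ α : Expo p n, Expo.deg α < d → a α = 0

lemma Expands.acrisDeg {a : Expo p n → WittVector p B} {u : KeyAcris B p n} (ha : Expands a u)
    {d : ℚ≥0} (h : ∀ α : Expo p n, Expo.deg α < d → a α = 0) : AcrisDeg d u := fun b hb => by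
  rw [hb.unique ha]; exact h

namespace AcrisDeg

variable {c d : ℚ≥0} {u v : KeyAcris B p n}

lemma mono (hcd : c ≤ d) (hu : AcrisDeg d u) : AcrisDeg c u :=
  fun a ha α hα => hu a ha α (hα.trans_le hcd)

lemma add (hu : AcrisDeg d u) (hv : AcrisDeg d v) : AcrisDeg d (u + v) := by
  obtain ⟨a, ha⟩ := exists_expands u
  obtain ⟨b, hb⟩ := exists_expands v
  exact (ha.add hb).acrisDeg fun α hα => by
    rw [Pi.add_apply, hu a ha α hα, hv b hb α hα, add_zero]

lemma neg (hu : AcrisDeg d u) : AcrisDeg d (-u) := by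
  obtain ⟨a, ha⟩ := exists_expands u
  exact ha.neg.acrisDeg fun α hα => by rw [Pi.neg_apply, hu a ha α hα, neg_zero]

lemma sub (hu : AcrisDeg d u) (hv : AcrisDeg d v) : AcrisDeg d (u - v) := by
  rw [sub_eq_add_neg]; exact hu.add hv.neg

lemma zero : AcrisDeg d (0 : KeyAcris B p n) := fun _ ha α _ => ha.eq_zero α

lemma sum {ι : Type*} {s : Finset ι} {f : ι → KeyAcris B p n} (h : ∀ i ∈ s, AcrisDeg d (f i)) :
    AcrisDeg d (∑ i ∈ s, f i) :=
  Finset.sum_induction _ _ (fun _ _ => add) zero h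

lemma of_forall_pow_dvd (h : ∀ m : ℕ, ∃ v, AcrisDeg d v ∧ (p : KeyAcris B p n) ^ m ∣ u - v) :
    AcrisDeg d u := fun a ha α hα => by
  refine eq_zero_of_forall_pow_dvd (p : WittVector p B) fun m => ?_
  obtain ⟨v, hv, hm⟩ := h m
  obtain ⟨b, hb⟩ := exists_expands v
  have := (ha.sub hb).pow_dvd hm α
  rwa [Pi.sub_apply, hv b hb α hα, sub_zero] at this

lemma of_natCast_mul {k : ℕ} (hk : k ≠ 0) (h : AcrisDeg d ((k : KeyAcris B p n) * u)) :
    AcrisDeg d u := fun _ ha α hα =>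
  isLeftRegular_natCast hk ((h _ (ha.natCast_mul k) α hα).trans (mul_zero _).symm)

lemma of_pow_mul {k : ℕ} (h : AcrisDeg d ((p : KeyAcris B p n) ^ k * u)) : AcrisDeg d u := by
  rw [← Nat.cast_pow] at h
  exact h.of_natCast_mul (pow_ne_zero _ hp.out.ne_zero)

lemma natCast_mul (k : ℕ) (h : AcrisDeg d u) : AcrisDeg d ((k : KeyAcris B p n) * u) := by
  obtain ⟨a, ha⟩ := exists_expands u
  exact (ha.natCast_mul k).acrisDeg fun α hα => by rw [h a ha α hα, mul_zero]

lemma frob (hu : AcrisDeg d u) : AcrisDeg (p * d) (Acris.frob u) := by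
  obtain ⟨a, ha⟩ := exists_expands u
  refine ha.frob.acrisDeg fun β hβ => ?_
  rw [hu a ha, map_zero, mul_zero]
  rw [Expo.deg_div, pow_one]
  exact (div_lt_iff₀' (Nat.cast_pos.mpr hp.out.pos)).mpr hβ

lemma of_frob (h : AcrisDeg (p * d) (Acris.frob u)) : AcrisDeg d u := fun a ha α hα => by
  have hpα : Expo.deg (p • α) < p * d := by
    rw [map_nsmul, nsmul_eq_mul]
    exact mul_lt_mul_of_pos_left hα (Nat.cast_pos.mpr hp.out.pos)
  have hfrob := isLeftRegular_natCast (facQuot_ne_zero _)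
    ((h _ ha.frob _ hpα).trans (mul_zero _).symm)
  rw [← (Expo.nsmul_eq_iff α (p • α)).mp rfl] at hfrob
  exact (WittVector.frobenius_bijective p B).1 (hfrob.trans (map_zero _).symm)

lemma frob_iterate (hu : AcrisDeg d u) (k : ℕ) : AcrisDeg (p ^ k * d) (Acris.frob^[k] u) := by
  induction k with
  | zero => rwa [pow_zero, one_mul]
  | succ k ih => rw [Function.iterate_succ_apply', pow_succ', mul_assoc]; exact ih.frob

lemma of_frob_iterate {k : ℕ} (h : AcrisDeg (p ^ k * d) (Acris.frob^[k] u)) : AcrisDeg d u := by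
  induction k with
  | zero => rwa [pow_zero, one_mul] at h
  | succ k ih =>
    rw [Function.iterate_succ_apply', pow_succ', mul_assoc] at h
    exact ih h.of_frob

end AcrisDeg

variable (B p n) in
/-- The subgroup of `W(C^♭)` generated by the `a [x^α]`, `a ∈ W(B)`, `α` of degree at
least `d`. -/
def wittDeg (d : ℚ≥0) : AddSubgroup (KeyWitt B p n) :=
  AddSubgroup.closure {w | ∃ (c : WittVector p B) (α : Expo p n), d ≤ Expo.deg α ∧
    w = constW B p n c * teichmuller p (mono 1 α)}

lemma teichmuller_mono_mem_wittDeg {d : ℚ≥0} {α : Expo p n} (h : d ≤ Expo.deg α) (b : B) :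
    teichmuller p (mono b α) ∈ wittDeg B p n d :=
  AddSubgroup.subset_closure ⟨_, α, h, teichmuller_mono b α⟩

lemma mul_mem_wittDeg {c d : ℚ≥0} {v w : KeyWitt B p n} (hv : v ∈ wittDeg B p n c)
    (hw : w ∈ wittDeg B p n d) : v * w ∈ wittDeg B p n (c + d) := by
  induction hv using AddSubgroup.closure_induction with
  | zero => rw [zero_mul]; exact zero_mem _
  | add v v' _ _ h h' => rw [add_mul]; exact add_mem h h'
  | neg v _ h => rw [neg_mul]; exact neg_mem h
  | mem v hv =>
    obtain ⟨b, α, hα, rfl⟩ := hv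
    induction hw using AddSubgroup.closure_induction with
    | zero => rw [mul_zero]; exact zero_mem _
    | add v v' _ _ h h' => rw [mul_add]; exact add_mem h h'
    | neg v _ h => rw [mul_neg]; exact neg_mem h
    | mem w hw =>
      obtain ⟨b', β, hβ, rfl⟩ := hw
      refine AddSubgroup.subset_closure ⟨b * b', α + β, ?_, ?_⟩
      · rw [map_add]; exact add_le_add hα hβ
      · rw [mul_mul_mul_comm, ← map_mul, ← map_mul, mono_mul, one_mul]

lemma pow_mem_wittDeg {d : ℚ≥0} {w : KeyWitt B p n} (hw : w ∈ wittDeg B p n d) (m : ℕ) :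
    w ^ m ∈ wittDeg B p n (m * d) := by
  induction m with
  | zero =>
    rw [pow_zero, Nat.cast_zero, zero_mul, ← map_one (teichmuller p), ← mono_one]
    exact teichmuller_mono_mem_wittDeg zero_le _
  | succ m ih => rw [pow_succ, Nat.cast_succ, add_mul, one_mul]; exact mul_mem_wittDeg ih hw

lemma acrisDeg_of_mem_wittDeg {d : ℚ≥0} {w : KeyWitt B p n} (hw : w ∈ wittDeg B p n d) :
    AcrisDeg d (acrisMap B p n w) := by
  induction hw using AddSubgroup.closure_induction with
  | zero => rw [map_zero]; exact AcrisDeg.zero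
  | add v w _ _ hv hw => rw [map_add]; exact hv.add hw
  | neg v _ hv => rw [map_neg]; exact hv.neg
  | mem w hw =>
    obtain ⟨c, α, hα, rfl⟩ := hw
    rw [map_mul, ← fac_mul_acrisMono, mul_left_comm, ← combA_single]
    refine AcrisDeg.natCast_mul _ ((Expands.combA _).acrisDeg fun β hβ => ?_)
    rw [Finsupp.single_eq_of_ne']
    rintro rfl
    exact absurd hβ (not_lt.mpr hα)

lemma exists_mem_wittDeg_pow_dvd_teichmuller_sub {d : ℚ≥0} {y : PerfPoly B p n}
    (hy : y ∈ polyDeg B p n d) (M : ℕ) : ∃ w ∈ wittDeg B p n d,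
      (p : KeyWitt B p n) ^ M ∣ teichmuller p (polyHom B p n y) - w := by
  let root (α : Expo p n) : KeyTilt B p n := mono (rootB (p := p) M (y.coeff α)) (Expo.div M α)
  have hpow : polyHom B p n y = (∑ α ∈ y.coeff.support, root α) ^ p ^ M := by
    rw [sum_pow_char_pow, polyHom_eq_sum]
    refine Finset.sum_congr rfl fun α _ => ?_
    rw [mono_pow, rootB_pow, Expo.nsmul_div]
  have hsum : ∑ α ∈ y.coeff.support, teichmuller p (root α) ∈ wittDeg B p n (d / p ^ M) := by
    refine sum_mem fun α hα => teichmuller_mono_mem_wittDeg ?_ _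
    rw [Expo.deg_div]
    have : d ≤ Expo.deg α := not_lt.mp fun h => Finsupp.mem_support_iff.mp hα (hy α h)
    gcongr
  have hmem := pow_mem_wittDeg hsum (p ^ M)
  rw [Nat.cast_pow, mul_div_cancel₀ _ (natCast_p_pow_ne_zero M)] at hmem
  refine ⟨_, hmem, (pow_dvd_pow _ (Nat.le_succ M)).trans ?_⟩
  rw [hpow, map_pow]
  refine dvd_sub_pow_of_dvd_sub (p_dvd_sub_of_coeff_zero_eq ?_) M
  rw [coeff_zero_sum, teichmuller_coeff_zero]
  exact Finset.sum_congr rfl fun _ _ => (teichmuller_coeff_zero _ _).symm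

lemma acrisDeg_teichmuller {d : ℚ≥0} {r : KeyTilt B p n} (hr : TiltDeg d r) :
    AcrisDeg d (acrisMap B p n (teichmuller p r)) := by
  refine AcrisDeg.of_forall_pow_dvd fun M => ?_
  obtain ⟨y, hy, hry⟩ := hr M
  obtain ⟨w, hw, hyw⟩ := exists_mem_wittDeg_pow_dvd_teichmuller_sub hy M
  refine ⟨_, acrisDeg_of_mem_wittDeg hw, ?_⟩
  rw [← sub_add_sub_cancel]
  refine dvd_add (pow_dvd_acrisMap_teichmuller_sub hry) ?_
  have := map_dvd (acrisMap B p n) hyw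
  rwa [map_pow, map_natCast, map_sub] at this

lemma acrisDeg_polar (l : ℕ) {r : KeyTilt B p n} (hr : Perfection.coeff _ p 0 r = 0) :
    AcrisDeg 1 (polar l r) := by
  refine AcrisDeg.of_pow_mul (k := l) ?_
  rw [pow_mul_polar l r hr]
  have hfrob := (acrisDeg_teichmuller (tiltDeg_one hr)).frob_iterate l
  rw [frob_iterate_acrisMap, mul_one] at hfrob
  exact hfrob.mono (one_le_pow₀ (Nat.one_le_cast.mpr hp.out.one_le))

lemma exists_one_le_of_dvd_fac {α : Expo p n} (h : p ∣ Expo.fac α) : ∃ i, 1 ≤ (α i : ℚ≥0) := by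
  obtain ⟨i, -, hi⟩ := (hp.out.prime.dvd_finsetProd_iff _).mp h
  refine ⟨i, (Nat.one_le_floor_iff _).mp ?_⟩
  exact hp.out.one_le.trans ((hp.out.dvd_factorial).mp hi)

lemma exists_one_le_of_acrisDeg {d : ℚ≥0} {w : KeyWitt B p n}
    (hw : AcrisDeg d (acrisMap B p n w)) {y : PerfPoly B p n}
    (hy : Perfection.coeff _ p 1 (w.coeff 0) = Perfection.coeff _ p 1 (polyHom B p n y))
    {α : Expo p n} (hα : Expo.deg α < d) (hne : y.coeff α ≠ 0) : ∃ i, 1 ≤ (α i : ℚ≥0) := by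
  classical
  refine exists_one_le_of_dvd_fac ?_
  by_contra hfac
  obtain ⟨a, ha⟩ := exists_expands (acrisMap B p n w)
  have hdvd := map_dvd (hullAcris B p n) (p_dvd_hullMap_sub hy)
  rw [map_natCast, map_sub, hullAcris_hullMap, ← combA_eq] at hdvd
  have hcoeff := (ha.sub (Expands.combA _)).pow_dvd (m := 1) (by rwa [pow_one]) α
  rw [Pi.sub_apply, hw a ha α hα, zero_sub, dvd_neg, pow_one, Finsupp.sum_apply, Finsupp.sum,
    Finset.sum_eq_single α (fun β _ hβ => Finsupp.single_eq_of_ne' hβ)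
      (fun h => absurd (Finsupp.mem_support_iff.mpr hne) h), Finsupp.single_eq_same,
    (isUnit_natCast_of_coprime (hp.out.coprime_iff_not_dvd.mpr hfac).symm).dvd_mul_left,
    ← Ideal.mem_span_singleton, mem_span_p_iff_coeff_zero_eq_zero,
    teichmuller_coeff_zero] at hcoeff
  exact hne hcoeff

lemma exists_mem_polyDeg_of_acrisDeg {d : ℚ≥0} {w : KeyWitt B p n}
    (hw : AcrisDeg d (acrisMap B p n w)) : ∃ y ∈ polyDeg B p n d,
      Perfection.coeff _ p 0 (polyHom B p n y) = Perfection.coeff _ p 0 (w.coeff 0) := by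
  classical
  obtain ⟨z, hz⟩ := exists_coeff_polyHom_eq 1 (w.coeff 0)
  generalize z ^ p ^ 1 = y at hz
  refine ⟨∑ α ∈ y.coeff.support.filter fun α => ∀ i, ¬ 1 ≤ (α i : ℚ≥0),
    AddMonoidAlgebra.single α (y.coeff α), ?_, ?_⟩
  · refine Ideal.sum_mem _ fun α hα => single_mem_polyDeg (not_lt.mp fun h => ?_) _
    rw [Finset.mem_filter, Finsupp.mem_support_iff] at hα
    obtain ⟨i, hi⟩ := exists_one_le_of_acrisDeg hw hz.symm h hα.1
    exact hα.2 i hi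
  · rw [← coeff_pow_p_pow 1 (w.coeff 0), map_pow, ← hz, ← map_pow, coeff_pow_p_pow,
      polyHom_eq_sum y, map_sum, map_sum, map_sum, Finset.sum_filter_of_ne]
    · exact Finset.sum_congr rfl fun α _ => by rw [polyHom_single]
    · intro α _ hne i hi
      refine hne ?_
      rw [polyHom_single]
      exact coeff_mono_eq_zero (i := i) (by rwa [pow_zero]) _

lemma tiltDeg_coeff_zero {d : ℚ≥0} {w : KeyWitt B p n} (hw : AcrisDeg d (acrisMap B p n w)) :
    TiltDeg d (w.coeff 0) := by
  intro k
  have hroot : AcrisDeg (d / p ^ k) (acrisMap B p n (frobInv w k)) := by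
    refine AcrisDeg.of_frob_iterate (k := k) ?_
    rwa [frob_iterate_acrisMap, iterate_frobenius_frobInv,
      mul_div_cancel₀ _ (natCast_p_pow_ne_zero k)]
  obtain ⟨y, hy, hyw⟩ := exists_mem_polyDeg_of_acrisDeg hroot
  have hpow := pow_mem_polyDeg hy (p ^ k)
  rw [Nat.cast_pow, mul_div_cancel₀ _ (natCast_p_pow_ne_zero k)] at hpow
  exact ⟨y ^ p ^ k, hpow, by rw [map_pow, coeff_pow_p_pow, hyw, coeff_frobInv_coeff]⟩

lemma tiltDeg_coeff {d : ℚ≥0} {w : KeyWitt B p n} (hw : AcrisDeg d (acrisMap B p n w)) (j : ℕ) :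
    TiltDeg (p ^ j * d) (w.coeff j) := by
  induction j generalizing d w with
  | zero => rw [pow_zero, one_mul]; exact tiltDeg_coeff_zero hw
  | succ j ih =>
    have htail : acrisMap B p n w - acrisMap B p n (teichmuller p (w.coeff 0)) =
        acrisMap B p n (verschiebung (wtl w)) := by
      conv_lhs => rw [eq_cons w]
      rw [cons_coeff_zero, ← map_sub, add_sub_cancel_left]
    have hfrob := (hw.sub (acrisDeg_teichmuller (tiltDeg_coeff_zero hw))).frob
    rw [htail, frob_acrisMap, frobenius_verschiebung, mul_comm (wtl w), map_mul,
      map_natCast] at hfrob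
    rw [pow_succ, mul_assoc]
    exact ih (hfrob.of_natCast_mul hp.out.ne_zero)

lemma acrisDeg_trunc_of_fbar_eq_zero {x : BarM (KeyQuot B p n) p} (hx : fbar x = 0) (M : ℕ) :
    AcrisDeg 1 (acrisMap B p n (trunc x.1 M)) := by
  have hver : fbar (BarM.ver^[M] x) = 0 := by
    refine frob_injective.iterate M ?_
    rw [← pow_mul_fbar, hx, mul_zero, iterate_map_zero]
  have htrunc : acrisMap B p n (trunc x.1 M) = -∑' i, polarTerm (BarM.ver^[M] x) i := by
    rw [eq_neg_iff_add_eq_zero, ← hver, fbar]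
    congr 2
    ext1 i
    rw [trunc, coeff_mk, coeff_mk, BarM.iterate_ver_apply]
  rw [htrunc]
  refine AcrisDeg.neg (AcrisDeg.of_forall_pow_dvd fun N =>
    ⟨_, AcrisDeg.sum fun i _ => ?_, pow_dvd_tsum_polarTerm_sub _ N⟩)
  rw [polarTerm_eq_polar]
  exact acrisDeg_polar _ ((BarM.ver^[M] x).2.1 _ (by lia))

lemma eq_zero_of_fbar_eq_zero {x : BarM (KeyQuot B p n) p} (hx : fbar x = 0) (m : ℤ) :
    x.1 m = 0 := by
  refine eq_zero_of_forall_tiltDeg fun d => ?_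
  have hdeg := tiltDeg_coeff (acrisDeg_trunc_of_fbar_eq_zero hx (d + m.natAbs))
    (m + (d + m.natAbs)).toNat
  have hindex : (((m + (d + m.natAbs)).toNat : ℕ) : ℤ) - ((d + m.natAbs : ℕ) : ℤ) = m := by lia
  rw [trunc, coeff_mk, mul_one, hindex] at hdeg
  refine hdeg.mono ?_
  rw [← Nat.cast_pow, Nat.cast_le]
  have hle : d ≤ (m + (d + m.natAbs)).toNat := by lia
  exact hle.trans (Nat.lt_pow_self hp.out.one_lt).le

end degrees

noncomputable section surjectivity
open Filter

section coordinates

variable {p : ℕ} [hp : Fact p.Prime] {R : Type*} [CommRing R]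

/-- The Witt vector `∑_{L ≤ N} V^{N - L} w_L`, which represents the truncation at `V^{-N}` of
`∑_L V^{-L} w_L`. -/
def layerSum (w : ℕ → WittVector p R) : ℕ → WittVector p R
  | 0 => w 0
  | N + 1 => verschiebung (layerSum w N) + w (N + 1)

lemma layerSum_succ (w : ℕ → WittVector p R) (N : ℕ) :
    layerSum w (N + 1) = verschiebung (layerSum w N) + w (N + 1) := rfl

variable [CharP R p]

lemma coeff_eq_zero_of_pow_dvd {m : ℕ} {w : WittVector p R} (h : (p : WittVector p R) ^ m ∣ w)
    {i : ℕ} (hi : i < m) : w.coeff i = 0 := by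
  obtain ⟨t, rfl⟩ := h
  induction m generalizing i t with
  | zero => exact absurd hi (Nat.not_lt_zero i)
  | succ m ih =>
    rw [pow_succ', mul_assoc, mul_comm]
    cases i with
    | zero => exact mul_charP_coeff_zero _
    | succ i => rw [mul_charP_coeff_succ, ih (by lia) t, zero_pow hp.out.ne_zero]

lemma coeff_eq_of_pow_dvd_sub {m : ℕ} {w z : WittVector p R}
    (h : (p : WittVector p R) ^ m ∣ w - z) {i : ℕ} (hi : i < m) : w.coeff i = z.coeff i :=
  (le_coeff_eq_iff_le_sub_coeff_eq_zero (n := m)).mpr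
    (fun _ hj => coeff_eq_zero_of_pow_dvd h hj) i hi

variable {I : Ideal R}

lemma add_coeff_mem_pow {j : ℕ} {c d : WittVector p R}
    (hc : ∀ i ≤ j, c.coeff i ∈ I ^ (1 + (p - 1) * i))
    (hd : ∀ i ≤ j, d.coeff i ∈ I ^ (1 + (p - 1) * i)) :
    (c + d).coeff j ∈ I ^ (1 + (p - 1) * j) := by
  have hI (i : ℕ) : I ^ (1 + (p - 1) * i) ≤ I := Ideal.pow_le_self (by lia)
  have hq (i : ℕ) (hi : i ≤ j) : qfun p j j i = 1 + (p - 1) * i := by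
    rw [qfun, Nat.sub_self, Nat.sub_zero, min_eq_left hi]
  have h := add_filt I (fun q => I ^ q) (fun q => by rw [← pow_succ'])
    (fun _ _ h => Ideal.pow_le_pow_right h) j (qfun p j j) j c 0 d 0 (qfun_adm j j)
    (fun i _ hi => ⟨hI i (hc i hi), by rw [zero_coeff]; exact I.zero_mem, hI i (hd i hi),
      by rw [zero_coeff]; exact I.zero_mem⟩)
    (fun i hi => by rw [zero_coeff, sub_zero, sub_zero, hq i hi]; exact ⟨hc i hi, hd i hi⟩)
  rwa [add_zero, zero_coeff, sub_zero, hq j le_rfl] at h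

lemma add_coeff_sub_coeff_mem_pow {L j : ℕ} (hLj : L ≤ j) {c d : WittVector p R}
    (hc : ∀ i < L, c.coeff i ∈ I) (hd : ∀ i, d.coeff i ∈ I ^ (1 + (p - 1) * i)) :
    (c + d).coeff j - c.coeff j ∈ I ^ L := by
  have h := add_filt I (fun q => I ^ q) (fun q => by rw [← pow_succ'])
    (fun _ _ h => Ideal.pow_le_pow_right h) j (qfun p L L) L c c d 0 (qfun_adm L L)
    (fun i hi _ => ⟨hc i hi, hc i hi, Ideal.pow_le_self (by lia) (hd i),
      by rw [zero_coeff]; exact I.zero_mem⟩)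
    (fun i _ => by
      rw [sub_self, zero_coeff, sub_zero]
      exact ⟨Ideal.zero_mem _, Ideal.pow_le_pow_right
        (Nat.add_le_add_left (Nat.mul_le_mul_left _ (by lia)) _) (hd i)⟩)
  rw [add_zero] at h
  exact Ideal.pow_le_pow_right (le_qfun le_rfl hLj) h

lemma coeff_mem_pow_of_mem_span_teichmuller {w : WittVector p R}
    (hw : w ∈ Ideal.span (teichmuller p '' (I : Set R))) (j : ℕ) :
    w.coeff j ∈ I ^ (1 + (p - 1) * j) := by
  induction hw using Submodule.closure_induction generalizing j with
  | zero => rw [zero_coeff]; exact Ideal.zero_mem _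
  | add v w _ _ hv hw => exact add_coeff_mem_pow (fun i _ => hv i) fun i _ => hw i
  | smul_mem c v hv =>
    obtain ⟨t, ht, rfl⟩ := hv
    rw [smul_eq_mul, mul_comm c, teich_mul_coeff]
    refine Ideal.mul_mem_right _ _ (Ideal.pow_le_pow_right ?_ (Ideal.pow_mem_pow ht (p ^ j)))
    have := one_add_mul_le_pow_of_sq_nonneg (R := ℕ) (a := p - 1) (Nat.zero_le _)
      (Nat.zero_le _) (Nat.zero_le _) j
    rwa [Nat.add_sub_cancel' hp.out.one_le, mul_comm, Nat.cast_id] at this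

lemma layerSum_coeff_mem {w : ℕ → WittVector p R} (hw : ∀ N j, (w (N + 1)).coeff j ∈ I)
    (N j : ℕ) (hj : j < N) : (layerSum w N).coeff j ∈ I := by
  induction N generalizing j with
  | zero => exact absurd hj (Nat.not_lt_zero j)
  | succ N ih =>
    rw [layerSum_succ]
    refine add_coeff_mem I j _ _ (fun i hi => ?_) fun i _ => hw N i
    cases i with
    | zero => rw [verschiebung_coeff_zero]; exact I.zero_mem
    | succ i => rw [verschiebung_coeff_succ]; exact ih i (by lia)

lemma exists_nilLim_layerSum {C : Type*} [CommRing C] [CharP C p] {I : Ideal (Perfection C p)}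
    (hI : TopNilpotent I) (hI0 : I ≤ RingHom.ker (Perfection.coeff C p 0))
    {w : ℕ → WittVector p (Perfection C p)}
    (hw : ∀ N j, (w (N + 1)).coeff j ∈ I ^ (1 + (p - 1) * j)) :
    ∃ x, NilLim (layerSum w) x := by
  have hmem := layerSum_coeff_mem fun N j => Ideal.pow_le_self (by lia) (hw N j)
  obtain ⟨x, hx⟩ := exists_isLim (s := layerSum w) fun k m => by
    obtain ⟨r, hr⟩ := hI k
    filter_upwards [eventually_gt_atTop (m.natAbs + r)] with N hN
    obtain ⟨N, rfl⟩ : ∃ N', N = N' + 1 := ⟨N - 1, by lia⟩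
    have hver : ∀ i < N + 1, (verschiebung (layerSum w N)).coeff i ∈ I := fun i hi => by
      cases i with
      | zero => rw [verschiebung_coeff_zero]; exact I.zero_mem
      | succ i => rw [verschiebung_coeff_succ]; exact hmem N i (by lia)
    have hdiff := hr (add_coeff_sub_coeff_mem_pow (L := r) (j := (m + (N + 1 : ℕ)).toNat)
      (by lia) (fun i hi => hver i (by lia)) (hw N))
    rwa [RingHom.mem_ker, map_sub, sub_eq_zero, ← layerSum_succ] at hdiff
  exact ⟨x, ⟨I, hI, hI0, hmem⟩, hx⟩

end coordinates

section exponents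

variable {p : ℕ} (n : ℕ)

variable (p) in
/-- The exponents `α` with all `α_i < p^N`. -/
def box (N : ℕ) : Set (Expo p n) := {α | ∀ i, (α i : ℚ≥0) < p ^ N}

variable (p) in
/-- The exponents `α` with all `α_i < p^{L+1}` and, for `L ≠ 0`, some `α_i ≥ p^L`. The part of
`f̄^{-1}(u)` coming from the exponents in this layer of `u` lies in `V^{-L} W(C^♭)`. -/
def layer : ℕ → Set (Expo p n)
  | 0 => box p n 1
  | L + 1 => box p n (L + 2) \ box p n (L + 1)

variable {n}

lemma layer_subset_box (L : ℕ) : layer p n L ⊆ box p n (L + 1) := by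
  cases L with
  | zero => exact subset_rfl
  | succ L => exact Set.sdiff_subset

variable [hp : Fact p.Prime]

lemma box_subset_box_succ (N : ℕ) : box p n N ⊆ box p n (N + 1) := fun _ h i =>
  (h i).trans_le (pow_le_pow_right₀ (Nat.one_le_cast.mpr hp.out.one_le) N.le_succ)

lemma indicator_box_add_indicator_layer {M : Type*} [AddZeroClass M] (a : Expo p n → M) (N : ℕ) :
    (box p n (N + 1)).indicator a + (layer p n (N + 1)).indicator a =
      (box p n (N + 2)).indicator a := by
  refine (Set.indicator_union_of_disjoint Set.disjoint_sdiff_right a).symm.trans ?_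
  rw [Set.union_sdiff_cancel (box_subset_box_succ (N + 1))]

lemma eventually_mem_box (α : Expo p n) : ∀ᶠ N in atTop, α ∈ box p n (N + 1) := by
  simp only [box, Set.mem_ofPred_eq, Filter.eventually_all]
  intro i
  filter_upwards [eventually_ge_atTop ⌈(α i : ℚ≥0)⌉₊] with N hN
  refine (Nat.le_ceil _).trans_lt ?_
  rw [← Nat.cast_pow, Nat.cast_lt]
  exact (hN.trans N.le_succ).trans_lt (Nat.lt_pow_self hp.out.one_lt)

lemma Expo.div_injective (L : ℕ) : Function.Injective (Expo.div (p := p) (n := n) L) :=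
  Function.LeftInverse.injective (Expo.nsmul_div L)

lemma coprime_fac_div_of_mem_layer {L : ℕ} {α : Expo p n} (h : α ∈ layer p n L) :
    (Expo.fac (Expo.div L α)).Coprime p := by
  refine Nat.Coprime.prod_left fun i _ => (hp.out.coprime_iff_not_dvd.mpr fun hdvd => ?_).symm
  rw [hp.out.dvd_factorial] at hdvd
  refine hdvd.not_gt ((Nat.floor_lt zero_le).mpr ?_)
  rw [Expo.coe_div, div_lt_iff₀ (pow_pos (Nat.cast_pos.mpr hp.out.pos) L), ← pow_succ']
  exact layer_subset_box L h i

lemma exists_one_le_div_of_mem_layer {L : ℕ} (hL : L ≠ 0) {α : Expo p n} (h : α ∈ layer p n L) :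
    ∃ i, 1 ≤ (Expo.div L α i : ℚ≥0) := by
  obtain ⟨L, rfl⟩ := Nat.exists_eq_succ_of_ne_zero hL
  obtain ⟨i, hi⟩ := not_forall.mp h.2
  exact ⟨i, (one_le_div (pow_pos (Nat.cast_pos.mpr hp.out.pos) _)).mpr (not_lt.mp hi)⟩

end exponents

variable {B : Type*} [CommRing B] {p : ℕ} [hp : Fact p.Prime] [CharP B p] [PerfectRing B p]
  {n : ℕ}

variable (B p n) in
/-- The Witt vector `∑ a_α [x^α] / ⌊α⌋!`. The inverse is `0` where `⌊α⌋!` is divisible by `p`, so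
this is the intended element only if `a_α = 0` for these `α`. -/
def wittComb : (Expo p n →₀ WittVector p B) →+ KeyWitt B p n :=
  Finsupp.liftAddHom fun α => (AddMonoidHom.mulRight (teichmuller p (mono 1 α))).comp
    ((constW B p n).toAddMonoidHom.comp
      (AddMonoidHom.mulRight (Ring.inverse (Expo.fac α : WittVector p B))))

lemma wittComb_apply (f : Expo p n →₀ WittVector p B) : wittComb B p n f =
    ∑ α ∈ f.support, constW B p n (f α * Ring.inverse (Expo.fac α : WittVector p B)) *
      teichmuller p (mono 1 α) := rfl

lemma acrisMap_wittComb {f : Expo p n →₀ WittVector p B}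
    (hf : ∀ α ∈ f.support, (Expo.fac α).Coprime p) :
    acrisMap B p n (wittComb B p n f) = combA B p n f := by
  rw [wittComb_apply, combA_apply, map_sum]
  refine Finset.sum_congr rfl fun α hα => ?_
  rw [map_mul, ← fac_mul_acrisMono, ← mul_assoc, ← map_natCast (acrisMap B p n),
    ← map_natCast (constW B p n), ← map_mul, ← map_mul, mul_assoc,
    Ring.inverse_mul_cancel _ (isUnit_natCast_of_coprime (hf α hα)), mul_one]

lemma pow_dvd_wittComb {m : ℕ} {f : Expo p n →₀ WittVector p B}
    (h : ∀ α, (p : WittVector p B) ^ m ∣ f α) : (p : KeyWitt B p n) ^ m ∣ wittComb B p n f := by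
  rw [wittComb_apply]
  refine Finset.dvd_sum fun α _ => Dvd.dvd.mul_right ?_ _
  have := map_dvd (constW B p n)
    ((h α).mul_right (Ring.inverse (Expo.fac α : WittVector p B)))
  rwa [map_pow, map_natCast] at this

lemma wittComb_mem {T : Ideal (KeyWitt B p n)} {f : Expo p n →₀ WittVector p B}
    (h : ∀ α ∈ f.support, teichmuller p (mono 1 α) ∈ T) : wittComb B p n f ∈ T := by
  rw [wittComb_apply]
  exact Ideal.sum_mem _ fun α hα => T.mul_mem_left _ (h α hα)

lemma Expands.exists_finsupp_indicator {b : Expo p n → WittVector p B} {v : KeyAcris B p n}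
    (hb : Expands b v) (S : Set (Expo p n)) (m : ℕ) : ∃ f : Expo p n →₀ WittVector p B,
      (∀ α ∈ f.support, α ∈ S) ∧ ∀ α, (p : WittVector p B) ^ m ∣ S.indicator b α - f α := by
  classical
  obtain ⟨f, -, hf⟩ := hb m
  refine ⟨f.filter (· ∈ S), fun α hα => ?_, fun α => ?_⟩
  · rw [Finsupp.support_filter, Finset.mem_filter] at hα
    exact hα.2
  · by_cases h : α ∈ S
    · rw [Set.indicator_of_mem h, Finsupp.filter_apply_pos _ _ h]
      exact hf α
    · rw [Set.indicator_of_notMem h, Finsupp.filter_apply_neg _ _ h, sub_zero]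
      exact dvd_zero _

lemma exists_acrisMap_expands_indicator {b : Expo p n → WittVector p B} {v : KeyAcris B p n}
    (hb : Expands b v) {S : Set (Expo p n)} (hS : ∀ α ∈ S, (Expo.fac α).Coprime p) :
    ∃ w : KeyWitt B p n, Expands (S.indicator b) (acrisMap B p n w) ∧
      ∀ T : Ideal (KeyWitt B p n), (∀ α ∈ S, teichmuller p (mono 1 α) ∈ T) →
        ∀ m : ℕ, ∃ z ∈ T, (p : KeyWitt B p n) ^ m ∣ w - z := by
  choose f hfS hf using hb.exists_finsupp_indicator S
  obtain ⟨w, hw⟩ := exists_forall_pow_dvd_sub (ϖ := (p : KeyWitt B p n))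
    (f := fun m => wittComb B p n (f m)) fun m => by
      rw [← map_sub]
      refine pow_dvd_wittComb fun α => ?_
      rw [Finsupp.sub_apply, ← sub_sub_sub_cancel_left _ _ (S.indicator b α)]
      exact dvd_sub (hf m α) ((pow_dvd_pow _ m.le_succ).trans (hf (m + 1) α))
  refine ⟨w, fun m => ⟨f m, ?_, hf m⟩, fun T hT m =>
    ⟨_, wittComb_mem fun α hα => hT α (hfS m α hα), hw m⟩⟩
  have := map_dvd (acrisMap B p n) (hw m)
  rwa [map_pow, map_natCast, map_sub, acrisMap_wittComb fun α hα => hS α (hfS m α hα)] at this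

lemma Expands.exists_eq_natCast_pow_mul {a : Expo p n → WittVector p B} {u : KeyAcris B p n}
    {m : ℕ} (h : Expands (fun α => (p : WittVector p B) ^ m * a α) u) :
    ∃ v, u = (p : KeyAcris B p n) ^ m * v ∧ Expands a v := by
  obtain ⟨v, rfl⟩ := h.pow_dvd_of_forall fun α => dvd_mul_right _ (a α)
  obtain ⟨b, hb⟩ := exists_expands v
  have hmul := hb.natCast_mul (p ^ m)
  rw [Nat.cast_pow, Nat.cast_pow] at hmul
  refine ⟨v, rfl, ?_⟩
  convert hb using 1
  funext α
  refine isLeftRegular_natCast (pow_ne_zero m hp.out.ne_zero) ?_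
  beta_reduce
  rw [Nat.cast_pow]
  exact congrFun (h.unique hmul) α

lemma mono_mem_span_tiltX {α : Expo p n} {i : Fin n} (h : 1 ≤ (α i : ℚ≥0)) :
    mono (1 : B) α ∈ Ideal.span (Set.range (tiltX B p n)) := by
  obtain ⟨β, rfl⟩ := Expo.exists_add_single h
  rw [← mul_one (1 : B), ← mono_mul]
  exact Ideal.mul_mem_left _ _ (Ideal.subset_span ⟨i, rfl⟩)

lemma exists_acrisMap_eq_pow_mul_layer {a : Expo p n → WittVector p B} {u : KeyAcris B p n}
    (ha : Expands a u) (hu : u ∈ Acris.prime (KeyQuot B p n) p) (L : ℕ) :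
    ∃ (w : KeyWitt B p n) (v : KeyAcris B p n),
      acrisMap B p n (WittVector.frobenius^[L] w) = (p : KeyAcris B p n) ^ L * v ∧
      Expands ((layer p n L).indicator a) v ∧
      (L ≠ 0 → ∀ j, w.coeff j ∈ Ideal.span (Set.range (tiltX B p n)) ^ (1 + (p - 1) * j)) := by
  obtain ⟨v, hv⟩ := hu L
  obtain ⟨b, hb⟩ := exists_expands v
  obtain ⟨b', hb', hbb'⟩ := hb.frob_iterate L
  obtain ⟨w, hw, hwT⟩ := exists_acrisMap_expands_indicator hb (S := Expo.div L '' layer p n L)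
    (Set.forall_mem_image.mpr fun _ => coprime_fac_div_of_mem_layer)
  obtain ⟨c, hc, hcw⟩ := hw.frob_iterate L
  have hpa := ha.natCast_mul (p ^ L)
  rw [Nat.cast_pow, Nat.cast_pow, hv] at hpa
  have hcoeff : c = fun β => (p : WittVector p B) ^ L * (layer p n L).indicator a β := by
    funext β
    refine isLeftRegular_natCast (Expo.fac_ne_zero (Expo.div L β)) ?_
    beta_reduce
    rw [hcw β, Set.indicator_image (Expo.div_injective L)]
    by_cases h : β ∈ layer p n L
    · rw [Set.indicator_of_mem h, Set.indicator_of_mem h, Function.comp_apply, ← hbb' β,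
        hb'.unique hpa]
    · rw [Set.indicator_of_notMem h, Set.indicator_of_notMem h, iterate_map_zero, mul_zero,
        mul_zero, mul_zero]
  obtain ⟨v', hv', hexp⟩ := (hcoeff ▸ hc).exists_eq_natCast_pow_mul
  refine ⟨w, v', (frob_iterate_acrisMap L w).symm.trans hv', hexp, fun hL j => ?_⟩
  obtain ⟨z, hz, hwz⟩ := hwT
    (Ideal.span (teichmuller p '' (Ideal.span (Set.range (tiltX B p n)) : Set (KeyTilt B p n))))
    (Set.forall_mem_image.mpr fun α hα => Ideal.subset_span <| Set.mem_image_of_mem _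
      (mono_mem_span_tiltX (exists_one_le_div_of_mem_layer hL hα).choose_spec)) (j + 1)
  rw [coeff_eq_of_pow_dvd_sub hwz (Nat.lt_succ_self j)]
  exact coeff_mem_pow_of_mem_span_teichmuller hz j

lemma exists_acrisMap_layerSum_eq {a : Expo p n → WittVector p B} {w : ℕ → KeyWitt B p n}
    {v : ℕ → KeyAcris B p n} (hwv : ∀ L, acrisMap B p n (WittVector.frobenius^[L] (w L)) =
      (p : KeyAcris B p n) ^ L * v L) (hv : ∀ L, Expands ((layer p n L).indicator a) (v L))
    (N : ℕ) : ∃ U, acrisMap B p n (WittVector.frobenius^[N] (layerSum w N)) =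
      (p : KeyAcris B p n) ^ N * U ∧ Expands ((box p n (N + 1)).indicator a) U := by
  induction N with
  | zero => exact ⟨v 0, hwv 0, hv 0⟩
  | succ N ih =>
    obtain ⟨U, hU, hexp⟩ := ih
    refine ⟨U + v (N + 1), ?_, indicator_box_add_indicator_layer a N ▸ hexp.add (hv (N + 1))⟩
    have hp : WittVector.frobenius^[N] (p : KeyWitt B p n) = p := by
      rw [← RingHom.coe_pow, map_natCast]
    rw [layerSum_succ, iterate_map_add, map_add, hwv, mul_add, Function.iterate_succ_apply,
      frobenius_verschiebung, iterate_map_mul, map_mul, hU, hp, map_natCast, pow_succ]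
    ring

lemma Expands.eventually_pow_dvd_sub {a : Expo p n → WittVector p B} {u : KeyAcris B p n}
    (ha : Expands a u) {U : ℕ → KeyAcris B p n}
    (hU : ∀ N, Expands ((box p n (N + 1)).indicator a) (U N)) (M : ℕ) :
    ∀ᶠ N in atTop, (p : KeyAcris B p n) ^ M ∣ u - U N := by
  obtain ⟨f, -, hf⟩ := ha M
  have hbox : ∀ᶠ N : ℕ in atTop, ∀ α ∈ f.support, α ∈ box p n (N + 1) := by
    rw [Filter.eventually_all_finset]
    exact fun α _ => eventually_mem_box α
  filter_upwards [hbox] with N hN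
  refine (ha.sub (hU N)).pow_dvd_of_forall fun α => ?_
  rw [Pi.sub_apply]
  by_cases h : α ∈ box p n (N + 1)
  · rw [Set.indicator_of_mem h, sub_self]
    exact dvd_zero _
  · have hα := hf α
    rwa [Finsupp.notMem_support_iff.mp fun h' => h (hN α h'),
      ← Set.indicator_of_notMem h a] at hα

lemma exists_fbar_eq {u : KeyAcris B p n} (hu : u ∈ Acris.prime (KeyQuot B p n) p) :
    ∃ x, fbar x = u := by
  obtain ⟨a, ha⟩ := exists_expands u
  choose w v hwv hv hw using exists_acrisMap_eq_pow_mul_layer ha hu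
  have hker : Ideal.span (Set.range (tiltX B p n)) ≤ RingHom.ker (Perfection.coeff _ p 0) := by
    rw [Ideal.span_le]
    rintro _ ⟨i, rfl⟩
    exact coeff_zero_tiltX i
  obtain ⟨x, hx⟩ := exists_nilLim_layerSum topNilpotent_span_tiltX hker (w := w)
    fun N => hw (N + 1) N.succ_ne_zero
  choose U hU hUexp using exists_acrisMap_layerSum_eq hwv hv
  have hlim : IsDivFrobLim (layerSum w) u := fun M => by
    filter_upwards [ha.eventually_pow_dvd_sub hUexp M] with N hN
    change _ ∣ _ - acrisMap B p n _
    rw [hU N, ← mul_sub, pow_add]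
    exact mul_dvd_mul_left _ hN
  exact ⟨⟨x, hx.mem⟩, (isDivFrobLim_fbar hx).unique hlim⟩

lemma fbarHom_bijective : Function.Bijective (fbarHom (KeyQuot B p n) p) := by
  refine ⟨(injective_iff_map_eq_zero _).mpr fun x hx => Subtype.ext (funext fun m => ?_),
    fun u => (exists_fbar_eq u.2).imp fun _ h => Subtype.ext h⟩
  rw [eq_zero_of_fbar_eq_zero (congrArg Subtype.val hx) m]
  exact (eq_zero_of_fbar_eq_zero (congrArg Subtype.val (map_zero (fbarHom _ p))) m).symm

end surjectivity

end Fontaine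

theorem mainTheorem10 (p : ℕ) [Fact p.Prime] (B : Type*) [CommRing B] [CharP B p]
    [PerfectRing B p] (n : ℕ) :
    (∀ x : Fontaine.BarM (Fontaine.KeyRing B p n) p, Summable (Fontaine.polarTerm x)) ∧
    ∃ e : Fontaine.BarM (Fontaine.KeyRing B p n) p
        ≃ₗ[WittVector p (Perfection (Fontaine.KeyRing B p n) p)]
          Fontaine.Acris.prime (Fontaine.KeyRing B p n) p,
      (∀ x, (e x : Fontaine.Acris (Fontaine.KeyRing B p n) p) = Fontaine.fbar x) ∧
      ∀ x, (e (Fontaine.BarM.frob x) : Fontaine.Acris (Fontaine.KeyRing B p n) p)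
        = Fontaine.Acris.frob (e x : Fontaine.Acris (Fontaine.KeyRing B p n) p) :=
  ⟨Fontaine.summable_polarTerm,
    LinearEquiv.ofBijective (Fontaine.fbarHom (Fontaine.KeyQuot B p n) p)
      Fontaine.fbarHom_bijective,
    fun _ => rfl, Fontaine.fbar_frob (C := Fontaine.KeyQuot B p n)⟩
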